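/- Let $d\ge 1$, let $\gamma_d(dx)=\pi^{-d/2}e^{-|x|^2}dx$ on $\mathbb R^d$, and let $\mu(dt)=dt/t$ on $(0,\infty)$. For a measurable exponent $r(\cdot)$ with finite values and a measure $m$, let $\|f\|_{r(\cdot),m}=\inf\{\lambda>0:\int|f/\lambda|^{r(x)}\,dm\le1\}$, and let $L^{r(\cdot)}(m)$ be the space of measurable $f$ with $\int|f/\lambda|^{r(x)}dm<\infty$ for some $\lambda>0$. For $t>0$ let $$T_tf(x)=(1-e^{-2t})^{-d/2}\int_{\mathbb R^d}\exp\Big(-\tfrac{e^{-2t}(|x|^2+|y|^2)-2e^{-t}\langle x,y\rangle}{1-e^{-2t}}\Big)f(y)\,\gamma_d(dy),\qquad P_tf(x)=\frac1{\sqrt\pi}\int_0^\infty\frac{e^{-u}}{\sqrt u}\,T_{t^2/4u}f(x)\,du$$ be the Ornstein–Uhlenbeck and Poisson–Hermite semigroups, and for $\beta>0$ let $$\mathcal J_\beta f(x)=\frac1{\Gamma(\beta)}\int_0^\infty t^{\beta}e^{-t}P_tf(x)\,\frac{dt}t$$ be the Gaussian Bessel potential of order $\beta$. Let $\alpha\ge0$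 and $\beta>0$. Let $p:\mathbb R^d\to[1,\infty)$ be measurable with $1<p_-\le p_+<\infty$ (essential infimum and supremum), and suppose that there are constants $C_1,C_2>0$ and $p_\infty\ge1$ with $|p(x)-p_\infty|\le C_1/|x|^2$ for all $x\ne0$ and $|p(x)-p(y)|\le C_2/\log(e+1/|x-y|)$ for all $x,y$. Let $q:(0,\infty)\to(0,\infty)$ be measurable with $1\le q_-\le q_+<\infty$, such that the limits $q(0)=\lim_{t\to0}q(t)$ and $q(\infty)=\lim_{t\to\infty}q(t)$ exist and, for some $A$, $|q(t)-q(0)|\le A/\ln(1/t)$ for $0<t\le1/2$ and $|q(t)-q(\infty)|\le A/\ln t$ for $t>2$. For $s\ge0$, with $k$ the smallest integer greater than $s$, let $B^s_{p(\cdot),q(\cdot)}(\gamma_d)$ be the space of all $f\in L^{p(\cdot)}(\gamma_d)$ for which $$\|f\|_{B^s_{p(\cdot),q(\cdot)}}=\|f\|_{p(\cdot),\gamma_d}+\Big\|t^{k-s}\big\|\partial_t^kP_tf\big\|_{p(\cdot),\gamma_d}\Big\|_{q(\cdot),\mu}$$ is finite. Then $\mathcal J_\beta$ is bounded from $B^\alpha_{p(\cdot),q(\cdot)}(\gamma_d)$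 into $B^{\alpha+\beta}_{p(\cdot),q(\cdot)}(\gamma_d)$: there is a constant $C$, independent of $f$, such that for every $f\in B^\alpha_{p(\cdot),q(\cdot)}(\gamma_d)$ one has $\mathcal J_\beta f\in B^{\alpha+\beta}_{p(\cdot),q(\cdot)}(\gamma_d)$ and $$\|\mathcal J_\beta f\|_{B^{\alpha+\beta}_{p(\cdot),q(\cdot)}}\le C\,\|f\|_{B^\alpha_{p(\cdot),q(\cdot)}}.$$ Here $\mathcal J_\beta$ is the operator $(I+\sqrt{-L})^{-\beta}$, $L=\frac12\Delta-\langle x,\nabla\rangle$, in the following sense: for all normalized Hermite polynomials $h_\nu(x)=(2^{|\nu|}\nu!)^{-1/2}\prod_{i=1}^d(-1)^{\nu_i}e^{x_i^2}\partial_{x_i}^{\nu_i}e^{-x_i^2}$ and all $x$, the integral defining $\mathcal J_\beta h_\nu(x)$ converges absolutely and $\mathcal J_\beta h_\nu=(1+\sqrt{|\nu|})^{-\beta}h_\nu$; and for every $f\in L^{p(\cdot)}(\gamma_d)$ the integral defining $\mathcal J_\beta f(x)$ converges absolutely for almost every $x$, and $\mathcal J_\beta$ is bounded on $L^{p(\cdot)}(\gamma_d)$.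 -/

import Mathlib

open MeasureTheory Set Filter Topology
open scoped ENNReal NNReal

noncomputable section

namespace GaussianBesov

/-! ### Variable exponent Lebesgue spaces

All exponents below are finite everywhere, so the set where the exponent equals `∞` is empty and
the modular is just an integral. -/

section Variable

variable {Ω : Type*} [MeasurableSpace Ω]

/-- The essential infimum `p_-` of an exponent. -/
def expInf (p : Ω → ℝ) (μ : Measure Ω) : ℝ≥0∞ := essInf (fun x => ENNReal.ofReal (p x)) μ

/-- The essential supremum `p_+` of an exponent. -/
def expSup (p : Ω → ℝ) (μ : Measure Ω) : ℝ≥0∞ := essSup (fun x => ENNReal.ofReal (p x)) μ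

/-- The modular `ρ(F) = ∫ F(x)^{p(x)} dμ(x)` of a `[0,∞]`-valued function (in the applications
`F` is the absolute value of a function). -/
def modular (p : Ω → ℝ) (μ : Measure Ω) (F : Ω → ℝ≥0∞) : ℝ≥0∞ := ∫⁻ x, F x ^ p x ∂μ

/-- The Luxemburg norm `inf {l > 0 : ρ(F / l) ≤ 1}`, with value `∞` if there is no such `l`. -/
def luxNorm (p : Ω → ℝ) (μ : Measure Ω) (F : Ω → ℝ≥0∞) : ℝ≥0∞ :=
  ⨅ (l : ℝ) (_ : 0 < l ∧ modular p μ (fun x => F x / ENNReal.ofReal l) ≤ 1), ENNReal.ofReal l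

/-- `‖f‖_{p(·),μ}` for a real function `f`. -/
def varNorm (p : Ω → ℝ) (μ : Measure Ω) (f : Ω → ℝ) : ℝ≥0∞ := luxNorm p μ (fun x => ‖f x‖ₑ)

/-- `f ∈ L^{p(·)}(μ)`. -/
def MemVarLp (p : Ω → ℝ) (μ : Measure Ω) (f : Ω → ℝ) : Prop :=
  AEStronglyMeasurable f μ ∧
    ∃ l : ℝ, 0 < l ∧ modular p μ (fun x => ‖f x‖ₑ / ENNReal.ofReal l) < ∞

/-- (Finite) exponent functions: `μ`-measurable with values in `[1,∞)`. -/
def IsExponent (p : Ω → ℝ) (μ : Measure Ω) : Prop :=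
  AEMeasurable p μ ∧ ∀ x, 1 ≤ p x

end Variable

/-! ### The Gaussian measure and the classes of exponents -/

/-- `γ_d(dx) = π^{-d/2} e^{-|x|²} dx` on `ℝ^d`. -/
def gammaD (d : ℕ) : Measure (EuclideanSpace ℝ (Fin d)) :=
  volume.withDensity fun x => ENNReal.ofReal (Real.exp (-‖x‖ ^ 2) / Real.pi ^ ((d : ℝ) / 2))

/-- The measure `dt / t` on `(0,∞)`, as a measure on `ℝ` which vanishes on `(-∞,0]`. -/
def haarPos : Measure ℝ :=
  (volume.restrict (Ioi 0)).withDensity fun t => ENNReal.ofReal (1 / t)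

/-- Local log-Hölder continuity `LH_0(ℝ^d)`. -/
def IsLH0 {d : ℕ} (a : EuclideanSpace ℝ (Fin d) → ℝ) : Prop :=
  ∃ C : ℝ, 0 < C ∧ ∀ x y, |a x - a y| ≤ C / Real.log (Real.exp 1 + 1 / ‖x - y‖)

/-- The class `P^∞_{γ_d}(ℝ^d)`. -/
def IsPGammaInfty {d : ℕ} (p : EuclideanSpace ℝ (Fin d) → ℝ) : Prop :=
  IsExponent p (gammaD d) ∧
    ∃ C pinf : ℝ, 0 < C ∧ 1 ≤ pinf ∧ ∀ x, x ≠ 0 → |p x - pinf| ≤ C / ‖x‖ ^ 2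

/-- The class `P_{0,∞}` of exponents on `(0,∞)`; only the values of `q` on `(0,∞)` matter. -/
structure IsPZeroInfty (q : ℝ → ℝ) : Prop where
  measurable : AEMeasurable q haarPos
  pos : ∀ t, 0 < t → 0 < q t
  one_le_inf : 1 ≤ expInf q haarPos
  sup_lt_top : expSup q haarPos < ∞
  at_zero : ∃ q0 A : ℝ, Tendsto q (𝓝[>] 0) (𝓝 q0) ∧
    ∀ t, 0 < t → t ≤ 1 / 2 → |q t - q0| ≤ A / Real.log (1 / t)
  at_infty : ∃ qinf A : ℝ, Tendsto q atTop (𝓝 qinf) ∧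
    ∀ t, 2 < t → |q t - qinf| ≤ A / Real.log t

/-! ### Semigroups and the Bessel potential -/

/-- The Ornstein-Uhlenbeck semigroup `T_t`, `t > 0`. -/
def ouSemigroup {d : ℕ} (t : ℝ) (f : EuclideanSpace ℝ (Fin d) → ℝ)
    (x : EuclideanSpace ℝ (Fin d)) : ℝ :=
  1 / (1 - Real.exp (-2 * t)) ^ ((d : ℝ) / 2) *
    ∫ y, Real.exp (-(Real.exp (-2 * t) * (‖x‖ ^ 2 + ‖y‖ ^ 2)
        - 2 * Real.exp (-t) * inner ℝ x y) / (1 - Real.exp (-2 * t))) * f y ∂(gammaD d)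

/-- The Poisson-Hermite semigroup `P_t`, `t > 0`, given by Bochner subordination. -/
def poissonHermite {d : ℕ} (t : ℝ) (f : EuclideanSpace ℝ (Fin d) → ℝ)
    (x : EuclideanSpace ℝ (Fin d)) : ℝ :=
  1 / Real.sqrt Real.pi *
    ∫ u in Ioi (0 : ℝ), Real.exp (-u) / Real.sqrt u * ouSemigroup (t ^ 2 / (4 * u)) f x

/-- `u^{(k)}(x,t) = ∂^k/∂t^k P_t f(x)`. For `f ∈ L¹(γ_d)` the function `t ↦ P_t f(x)` is smooth on
`(0,∞)` for every `x`, so for `t > 0` this is a genuine derivative. -/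
def poissonDeriv {d : ℕ} (k : ℕ) (f : EuclideanSpace ℝ (Fin d) → ℝ) (t : ℝ)
    (x : EuclideanSpace ℝ (Fin d)) : ℝ :=
  iteratedDeriv k (fun s => poissonHermite s f x) t

/-- The integrand `t^{β-1} e^{-t} P_t f(x)` of the Bessel potential. -/
def besselIntegrand {d : ℕ} (β : ℝ) (f : EuclideanSpace ℝ (Fin d) → ℝ)
    (x : EuclideanSpace ℝ (Fin d)) (t : ℝ) : ℝ :=
  t ^ (β - 1) * Real.exp (-t) * poissonHermite t f x

/-- The Gaussian Bessel potential `J_β = (I + √(-L))^{-β}`,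
`J_β f(x) = Γ(β)⁻¹ ∫_0^∞ t^β e^{-t} P_t f(x) dt/t`. -/
def besselPotential {d : ℕ} (β : ℝ) (f : EuclideanSpace ℝ (Fin d) → ℝ)
    (x : EuclideanSpace ℝ (Fin d)) : ℝ :=
  1 / Real.Gamma β * ∫ t in Ioi (0 : ℝ), besselIntegrand β f x t

/-- The normalized Hermite polynomial `h_ν` in `d` variables. -/
def hermiteFn {d : ℕ} (ν : Fin d → ℕ) (x : EuclideanSpace ℝ (Fin d)) : ℝ :=
  1 / Real.sqrt ((2 : ℝ) ^ (∑ i, ν i) * ∏ i, ((ν i).factorial : ℝ)) *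
    ∏ i, ((-1 : ℝ) ^ ν i * Real.exp (x i ^ 2) *
      iteratedDeriv (ν i) (fun s : ℝ => Real.exp (-s ^ 2)) (x i))

/-! ### Variable Gaussian Besov-Lipschitz spaces -/

/-- `‖ t^{k-α} ‖∂_t^k P_t f‖_{p(·),γ_d} ‖_{q(·),dt/t}` where `k = ⌊α⌋ + 1` is the smallest integer
greater than `α ≥ 0`. -/
def besovSeminorm {d : ℕ} (α : ℝ) (p : EuclideanSpace ℝ (Fin d) → ℝ) (q : ℝ → ℝ)
    (f : EuclideanSpace ℝ (Fin d) → ℝ) : ℝ≥0∞ :=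
  luxNorm q haarPos fun t =>
    ENNReal.ofReal (t ^ (((⌊α⌋₊ + 1 : ℕ) : ℝ) - α)) *
      varNorm p (gammaD d) (poissonDeriv (⌊α⌋₊ + 1) f t)

/-- The norm of `B^α_{p(·),q(·)}(γ_d)`. -/
def besovNorm {d : ℕ} (α : ℝ) (p : EuclideanSpace ℝ (Fin d) → ℝ) (q : ℝ → ℝ)
    (f : EuclideanSpace ℝ (Fin d) → ℝ) : ℝ≥0∞ :=
  varNorm p (gammaD d) f + besovSeminorm α p q f

/-- `f ∈ B^α_{p(·),q(·)}(γ_d)`. -/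
def MemBesov {d : ℕ} (α : ℝ) (p : EuclideanSpace ℝ (Fin d) → ℝ) (q : ℝ → ℝ)
    (f : EuclideanSpace ℝ (Fin d) → ℝ) : Prop :=
  MemVarLp p (gammaD d) f ∧ besovSeminorm α p q f < ∞

end GaussianBesov

end

/-! Since `γ_d` is a probability measure and `p ≥ 1`, every `f ∈ L^{p(·)}(γ_d)` lies in `L¹(γ_d)`.
There `∂_t^k P_t` is an integral operator (`poissonOp`), and `∂^i P_t ∂^j P_s = ∂^{i+j} P_{t+s}`. By
Fubini, `∂_t^k P_t J_β f` is `Γ(β)⁻¹` times the integral of `∂^k P_{t+s} f` against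
`s^{β-1}e^{-s}ds`.

Let `m`, `k` be the smallest integers above `α`, `α+β`, and put `n = k-m`, `κ = m-α > 0`, `δ = k-α-β
> 0`. Writing `∂^k P_{2u} = ∂^n P_u ∂^m P_u` gives `‖∂^k P_{2u} f‖ ≤ C u^{-n} Φ(u)`, where `Φ(u) =
sup_{s≥u} ‖∂^m P_s f‖` is decreasing and comparable to `‖∂^m P_u f‖`. Inserting `u = (t+s)/2` and
splitting at `s = t` bounds `t^δ ‖∂^k P_t J_β f‖` by the multiplicative convolution of `s^κ Φ(s)`
with `min(t/s,s/t)^δ` (`exists_rpow_mul_lintegral_besselWeight_le`). The seminorm estimate thus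
becomes a Hardy inequality in `L^{q(·)}(dt/t)` (`exists_luxNorm_hardy_le`).

The analytic input is the uniform boundedness of `T_s` on `L^{p(·)}(γ_d)` (`exists_luxNorm_ou_le`).
With `a = 1/p_∞`, the decay of `p - p_∞` makes `(e^{-a|x|²})^{p(x)}` comparable to `e^{-|x|²}`, so
`f ↦ e^{-a|x|²} f` carries the problem to Lebesgue measure. The conjugated Mehler kernel is
dominated by a heat kernel (`quadratic_form_bound`), and heat kernels are bounded uniformly in their
scale (`modular_heat_le`). Both this bound and the Hardy inequality follow one scheme: cut the
function at height 1, apply Jensen pointwise, and pay for replacing one exponent by another with an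
integrable error.

Passing from `T_s` to `P_t` is averaging over the subordinator `η_t(s)ds`, a probability measure.
Since `|∂_t^k η_t| ≤ C t^{-k} η_{t/2}`, derivatives of `P_t` are controlled by `P_{t/2}` itself, and
Minkowski's inequality transfers the bounds. On Hermite polynomials everything is explicit: `T_s`
acts by `e^{-s|ν|}`, its subordinate `P_t` by `e^{-t√|ν|}`, and a Gamma integral gives
`(1+√|ν|)^{-β}`. -/

noncomputable section

namespace GaussianBesov

/-! ### Jensen's inequality and the Luxemburg norm -/

section Lux

variable {Ω : Type*} [MeasurableSpace Ω] {μ : Measure Ω}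

/-- Jensen's inequality for a sub-probability density. -/
theorem rpow_lintegral_mul_le {K f : Ω → ℝ≥0∞} (hK : AEMeasurable K μ) (hK1 : ∫⁻ x, K x ∂μ ≤ 1)
    (hf : AEMeasurable f μ) {p : ℝ} (hp : 1 ≤ p) :
    (∫⁻ x, K x * f x ∂μ) ^ p ≤ ∫⁻ x, K x * f x ^ p ∂μ := by
  have h0 : 0 < p := by linarith
  rcases eq_or_lt_of_le hp with rfl | hp1
  · simp
  have e1 := lintegral_withDensity_eq_lintegral_mul₀ hK hf
  have e2 := lintegral_withDensity_eq_lintegral_mul₀ hK (hf.pow_const p)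
  have e3 := lintegral_withDensity_eq_lintegral_mul₀ hK (aemeasurable_const (b := (1 : ℝ≥0∞)))
  simp only [Pi.mul_apply, mul_one] at e1 e2 e3
  rw [← e1, ← e2]
  -- Hölder against the constant 1 for the measure `K dμ`, whose total mass is at most 1.
  have hc := Real.HolderConjugate.conjExponent hp1
  have h := ENNReal.lintegral_mul_le_Lp_mul_Lq (μ.withDensity K) hc
    (hf.mono_ac (withDensity_absolutelyContinuous _ _)) (aemeasurable_const (b := (1 : ℝ≥0∞)))
  simp only [Pi.mul_apply, mul_one, ENNReal.one_rpow] at h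
  have h1 : (∫⁻ _, (1 : ℝ≥0∞) ∂μ.withDensity K) ^ (1 / p.conjExponent) ≤ 1 := by
    refine ENNReal.rpow_le_one (by rw [e3]; exact hK1) ?_
    have := hc.symm.pos
    positivity
  have h2 : ∫⁻ x, f x ∂μ.withDensity K ≤ (∫⁻ x, f x ^ p ∂μ.withDensity K) ^ (1 / p) :=
    h.trans (by simpa using mul_le_mul_right h1 _)
  calc _ ≤ ((∫⁻ x, f x ^ p ∂μ.withDensity K) ^ (1 / p)) ^ p := by gcongr
    _ = _ := by rw [← ENNReal.rpow_mul, one_div_mul_cancel h0.ne', ENNReal.rpow_one]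

theorem modular_mono {p : Ω → ℝ} (hp : ∀ᵐ x ∂μ, 1 ≤ p x) {F G : Ω → ℝ≥0∞}
    (h : ∀ᵐ x ∂μ, F x ≤ G x) : modular p μ F ≤ modular p μ G := by
  refine lintegral_mono_ae ?_
  filter_upwards [hp, h] with x h1 h2
  exact ENNReal.rpow_le_rpow h2 (by linarith)

/-- Dividing by `D ≥ 1` divides the modular by at least `D`. -/
theorem modular_div_le {p : Ω → ℝ} (hp : ∀ᵐ x ∂μ, 1 ≤ p x) {F : Ω → ℝ≥0∞} {D : ℝ≥0∞}
    (hD : 1 ≤ D) : modular p μ (fun x => F x / D) ≤ modular p μ F / D := by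
  unfold modular
  rw [div_eq_mul_inv, ← lintegral_mul_const' _ _ (by simp; exact (zero_lt_one.trans_le hD).ne')]
  refine lintegral_mono_ae ?_
  filter_upwards [hp] with x hx
  rw [div_eq_mul_inv, ENNReal.mul_rpow_of_nonneg _ _ (by linarith)]
  gcongr
  calc D⁻¹ ^ p x ≤ D⁻¹ ^ (1 : ℝ) := ENNReal.rpow_le_rpow_of_exponent_ge (by simpa using hD) hx
    _ = D⁻¹ := by simp

theorem luxNorm_le {p : Ω → ℝ} {F : Ω → ℝ≥0∞} {a : ℝ≥0∞} (ha : a ≠ 0) (ha' : a ≠ ∞)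
    (h : modular p μ (fun x => F x / a) ≤ 1) : luxNorm p μ F ≤ a := by
  unfold luxNorm
  refine (iInf₂_le a.toReal ⟨ENNReal.toReal_pos ha ha', ?_⟩).trans ?_
  · rw [ENNReal.ofReal_toReal ha']
  · rwa [ENNReal.ofReal_toReal ha']

/-- The strict inequality provides an admissible `l` below `a`, so it does not matter whether the
infimum is attained. -/
theorem modular_div_le_one {p : Ω → ℝ} (hp : ∀ᵐ x ∂μ, 1 ≤ p x) {F : Ω → ℝ≥0∞} {a : ℝ≥0∞}
    (h : luxNorm p μ F < a) : modular p μ (fun x => F x / a) ≤ 1 := by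
  unfold luxNorm at h
  simp only [iInf_lt_iff] at h
  obtain ⟨l, ⟨_, hl1⟩, hl⟩ := h
  refine (modular_mono hp (Eventually.of_forall fun x => ?_)).trans hl1
  exact ENNReal.div_le_div_left hl.le _

theorem luxNorm_mono {p : Ω → ℝ} (hp : ∀ᵐ x ∂μ, 1 ≤ p x) {F G : Ω → ℝ≥0∞}
    (h : ∀ᵐ x ∂μ, F x ≤ G x) : luxNorm p μ F ≤ luxNorm p μ G := by
  unfold luxNorm
  refine le_iInf₂ fun l hl => iInf₂_le l ⟨hl.1, (modular_mono hp ?_).trans hl.2⟩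
  filter_upwards [h] with x hx
  exact ENNReal.div_le_div_right hx _

theorem luxNorm_le_mul_of_modular {Ω' : Type*} [MeasurableSpace Ω'] {μ' : Measure Ω'}
    {p : Ω → ℝ} {p' : Ω' → ℝ} {F : Ω → ℝ≥0∞} {G : Ω' → ℝ≥0∞} {C : ℝ≥0∞} (hC : C ≠ 0) (hC' : C ≠ ∞)
    (h : ∀ l : ℝ≥0∞, l ≠ 0 → l ≠ ∞ → modular p μ (fun x => F x / l) ≤ 1 →
      modular p' μ' (fun x => G x / (C * l)) ≤ 1) :
    luxNorm p' μ' G ≤ C * luxNorm p μ F := by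
  conv_rhs => unfold luxNorm
  simp_rw [ENNReal.mul_iInf_of_ne hC hC']
  refine le_iInf₂ fun l hl => ?_
  have h0 : ENNReal.ofReal l ≠ 0 := by simpa using hl.1
  exact luxNorm_le (mul_ne_zero hC h0) (ENNReal.mul_ne_top hC' ENNReal.ofReal_ne_top)
    (h _ h0 ENNReal.ofReal_ne_top hl.2)

theorem luxNorm_const_mul_le {p : Ω → ℝ} {F : Ω → ℝ≥0∞} {C : ℝ≥0∞} (hC : C ≠ 0) (hC' : C ≠ ∞) :
    luxNorm p μ (fun x => C * F x) ≤ C * luxNorm p μ F := by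
  refine luxNorm_le_mul_of_modular hC hC' fun l _ _ h => ?_
  simpa only [ENNReal.mul_div_mul_left _ _ hC hC'] using h

theorem luxNorm_congr_ae {p : Ω → ℝ} {F G : Ω → ℝ≥0∞} (h : F =ᵐ[μ] G) :
    luxNorm p μ F = luxNorm p μ G := by
  have : ∀ l : ℝ, modular p μ (fun x => F x / ENNReal.ofReal l)
      = modular p μ (fun x => G x / ENNReal.ofReal l) := fun l =>
    lintegral_congr_ae (by filter_upwards [h] with x hx; rw [hx])
  unfold luxNorm
  simp_rw [this]

/-- A finite modular `M` at level `l` drops below 1 at level `l(M+1)`, because exponents are at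
least 1. -/
theorem exists_modular_lt_top_iff {p : Ω → ℝ} (hp : ∀ᵐ x ∂μ, 1 ≤ p x) {F : Ω → ℝ≥0∞} :
    (∃ l : ℝ, 0 < l ∧ modular p μ (fun x => F x / ENNReal.ofReal l) < ∞) ↔
      luxNorm p μ F < ∞ := by
  constructor
  · rintro ⟨l, hl, h⟩
    set M := modular p μ (fun x => F x / ENNReal.ofReal l) with hM
    have h0 : ENNReal.ofReal l ≠ 0 := by simpa using hl
    have h1 : (1 : ℝ≥0∞) ≤ M + 1 := le_add_self
    have h2 : M + 1 ≠ ∞ := by simpa using h.ne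
    refine (luxNorm_le (a := ENNReal.ofReal l * (M + 1)) (mul_ne_zero h0 (by simp))
      (ENNReal.mul_ne_top ENNReal.ofReal_ne_top h2) ?_).trans_lt
      (ENNReal.mul_lt_top ENNReal.ofReal_lt_top h2.lt_top)
    have := modular_div_le hp (F := fun x => F x / ENNReal.ofReal l) h1
    rw [← hM] at this
    refine le_trans (le_of_eq ?_) (this.trans (ENNReal.div_le_of_le_mul (by simp)))
    congr 1; funext x
    rw [div_eq_mul_inv, div_eq_mul_inv, div_eq_mul_inv, mul_assoc, ENNReal.mul_inv (Or.inl h0)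
      (Or.inl ENNReal.ofReal_ne_top)]
  · intro h
    unfold luxNorm at h
    simp only [iInf_lt_iff] at h
    obtain ⟨l, ⟨h1, h2⟩, _⟩ := h
    exact ⟨l, h1, h2.trans_lt ENNReal.one_lt_top⟩

theorem memVarLp_iff {p : Ω → ℝ} (hp : ∀ᵐ x ∂μ, 1 ≤ p x) {f : Ω → ℝ} :
    MemVarLp p μ f ↔ AEStronglyMeasurable f μ ∧ varNorm p μ f < ∞ :=
  and_congr_right fun _ => exists_modular_lt_top_iff hp

/-- A positively homogeneous operator which is bounded on the unit ball of the modular is bounded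
for the Luxemburg norm. -/
theorem luxNorm_le_of_modular_bound {Ω' : Type*} [MeasurableSpace Ω'] {μ' : Measure Ω'}
    {p : Ω → ℝ} {p' : Ω' → ℝ} (hp' : ∀ᵐ x ∂μ', 1 ≤ p' x) {F : Ω → ℝ≥0∞} {G : Ω' → ℝ≥0∞}
    {A D : ℝ≥0∞} (hA : A ≠ 0) (hA' : A ≠ ∞) (hD : 1 ≤ D) (hD' : D ≠ ∞)
    (h : ∀ l : ℝ≥0∞, l ≠ 0 → l ≠ ∞ → modular p μ (fun x => F x / l) ≤ 1 →
      modular p' μ' (fun x => G x / l / A) ≤ D) :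
    luxNorm p' μ' G ≤ A * D * luxNorm p μ F := by
  have hD0 : D ≠ 0 := (zero_lt_one.trans_le hD).ne'
  refine luxNorm_le_mul_of_modular (mul_ne_zero hA hD0)
    (ENNReal.mul_ne_top hA' hD') fun l hl hl' hle => ?_
  have := modular_div_le hp' (F := fun x => G x / l / A) hD
  refine le_trans (le_of_eq ?_) (this.trans (ENNReal.div_le_of_le_mul (by simpa using h l hl hl' hle)))
  congr 1; funext x
  simp only [div_eq_mul_inv]
  rw [ENNReal.mul_inv (Or.inl (mul_ne_zero hA hD0)) (Or.inl (ENNReal.mul_ne_top hA' hD')),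
    ENNReal.mul_inv (Or.inl hA) (Or.inl hA')]
  ring

/-- The mean is at most the larger of the two numbers. The resulting quasi-triangle inequality for
the modular has a constant that does not depend on the size of the exponent. -/
theorem add_div_two_rpow_le (a b : ℝ≥0∞) {p : ℝ} (hp : 0 ≤ p) :
    ((a + b) / 2) ^ p ≤ a ^ p + b ^ p := by
  have key : ∀ u v : ℝ≥0∞, u ≤ v → (u + v) / 2 ≤ v := fun u v h =>
    ENNReal.div_le_of_le_mul (by rw [mul_two]; gcongr)
  rcases le_total a b with h | h
  · exact (ENNReal.rpow_le_rpow (key a b h) hp).trans le_add_self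
  · rw [add_comm a b]
    exact (ENNReal.rpow_le_rpow (key b a h) hp).trans le_self_add

theorem modular_add_div_two_le {p : Ω → ℝ} (hp : ∀ᵐ x ∂μ, 1 ≤ p x) (hpm : AEMeasurable p μ)
    {F G : Ω → ℝ≥0∞} (hF : AEMeasurable F μ) :
    modular p μ (fun x => (F x + G x) / 2) ≤ modular p μ F + modular p μ G := by
  unfold modular
  rw [← lintegral_add_left' (hF.pow hpm)]
  refine lintegral_mono_ae ?_
  filter_upwards [hp] with x hx
  exact add_div_two_rpow_le _ _ (by linarith)

/-- Minkowski's integral inequality for the Luxemburg norm. -/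
theorem luxNorm_lintegral_le [SFinite μ] {S : Type*} [MeasurableSpace S] {ν : Measure S}
    [IsFiniteMeasure ν] {p : Ω → ℝ} (hp : ∀ᵐ x ∂μ, 1 ≤ p x) (hpm : AEMeasurable p μ)
    {F : S → Ω → ℝ≥0∞} (hF : Measurable (Function.uncurry F)) {N : S → ℝ≥0∞} (hN : Measurable N)
    (h : ∀ᵐ s ∂ν, luxNorm p μ (F s) ≤ N s) :
    luxNorm p μ (fun x => ∫⁻ s, F s x ∂ν) ≤ ∫⁻ s, N s ∂ν := by
  by_cases hfin : ∫⁻ s, N s ∂ν = ∞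
  · simp [hfin]
  have hNfin : ∀ᵐ s ∂ν, N s < ∞ := ae_lt_top hN hfin
  refine ENNReal.le_of_forall_pos_le_add fun ε hε _ => ?_
  -- `δ` spreads `ε` over `S`: it makes `N + δ` nonzero and strictly larger than the norm of `F s`,
  -- while `∫ (N + δ) ≤ L`. Hence `(N + δ)/L` is a sub-probability density, and Jensen applies to
  -- the normalized functions `F s / (N s + δ)`.
  set δ : ℝ≥0∞ := ε / (ν univ + 1) with hδ
  have hν : ν univ + 1 ≠ ∞ := by simp
  have hδ0 : δ ≠ 0 := by simp [hδ, hε.ne']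
  have hδt : δ ≠ ∞ := ENNReal.div_ne_top (by simp) (by simp)
  set L : ℝ≥0∞ := ∫⁻ s, N s ∂ν + ε with hL
  have hL0 : L ≠ 0 := by simp [hL, hε.ne']
  have hLt : L ≠ ∞ := by simp [hL, hfin]
  have hint : ∫⁻ s, (N s + δ) / L ∂ν ≤ 1 := by
    simp_rw [div_eq_mul_inv]
    rw [lintegral_mul_const _ (by fun_prop), ← div_eq_mul_inv]
    refine ENNReal.div_le_of_le_mul ?_
    rw [lintegral_add_left hN, lintegral_const, one_mul, hL]
    gcongr
    rw [hδ]
    calc (ε : ℝ≥0∞) / (ν univ + 1) * ν univ ≤ ε / (ν univ + 1) * (ν univ + 1) := by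
          gcongr; exact le_self_add
      _ = ε := ENNReal.div_mul_cancel (by simp) hν
  refine luxNorm_le hL0 hLt ?_
  have hFs : ∀ x, Measurable fun s => F s x := fun x => hF.comp measurable_prodMk_right
  have step : ∀ᵐ x ∂μ, ((∫⁻ s, F s x ∂ν) / L) ^ p x
      ≤ ∫⁻ s, (N s + δ) / L * (F s x / (N s + δ)) ^ p x ∂ν := by
    filter_upwards [hp] with x hx
    have e : (∫⁻ s, F s x ∂ν) / L = ∫⁻ s, (N s + δ) / L * (F s x / (N s + δ)) ∂ν := by
      rw [div_eq_mul_inv, ← lintegral_mul_const _ (hFs x)]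
      refine lintegral_congr_ae ?_
      filter_upwards [hNfin] with s hs
      have h1 : N s + δ ≠ 0 := by simp [hδ0]
      have h2 : N s + δ ≠ ∞ := by simp [hδt, hs.ne]
      rw [div_eq_mul_inv, div_eq_mul_inv]
      calc F s x * L⁻¹ = ((N s + δ) * (N s + δ)⁻¹) * (F s x * L⁻¹) := by
            rw [ENNReal.mul_inv_cancel h1 h2, one_mul]
        _ = _ := by ring
    rw [e]
    exact rpow_lintegral_mul_le (by fun_prop) hint
      (((hFs x).div (by fun_prop)).aemeasurable) hx
  calc modular p μ (fun x => (∫⁻ s, F s x ∂ν) / L)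
      ≤ ∫⁻ x, ∫⁻ s, (N s + δ) / L * (F s x / (N s + δ)) ^ p x ∂ν ∂μ := lintegral_mono_ae step
    _ = ∫⁻ s, ∫⁻ x, (N s + δ) / L * (F s x / (N s + δ)) ^ p x ∂μ ∂ν := by
        refine lintegral_lintegral_swap ?_
        refine AEMeasurable.mul (by fun_prop) (AEMeasurable.pow ?_ ?_)
        · exact ((hF.comp measurable_swap).div (by fun_prop)).aemeasurable
        · exact hpm.comp_fst
    _ ≤ ∫⁻ s, (N s + δ) / L ∂ν := by
        refine lintegral_mono_ae ?_
        filter_upwards [hNfin, h] with s hs hs'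
        rw [lintegral_const_mul' _ _ (ENNReal.div_ne_top (by simp [hs.ne, hδt]) hL0)]
        have : luxNorm p μ (F s) < N s + δ :=
          hs'.trans_lt (ENNReal.lt_add_right hs.ne hδ0)
        calc _ ≤ (N s + δ) / L * 1 := by
              gcongr; exact modular_div_le_one hp this
          _ = _ := mul_one _
    _ ≤ 1 := hint

/-- An operator with a bi-substochastic kernel, on functions for which changing the exponent costs
only an integrable error. -/
theorem lintegral_rpow_kernel_le [SFinite μ] {p : Ω → ℝ} (hp : ∀ᵐ x ∂μ, 1 ≤ p x)
    (hpm : AEMeasurable p μ) {K err : Ω → Ω → ℝ≥0∞} (hK : Measurable (Function.uncurry K))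
    (herr : Measurable (Function.uncurry err))
    (hK1 : ∀ᵐ x ∂μ, ∫⁻ y, K x y ∂μ ≤ 1) (hK2 : ∀ᵐ y ∂μ, ∫⁻ x, K x y ∂μ ≤ 1) {F : Ω → ℝ≥0∞}
    (hF : Measurable F) {C : ℝ≥0∞}
    (h : ∀ᵐ x ∂μ, ∀ᵐ y ∂μ, F y ^ p x ≤ C * F y ^ p y + err x y) :
    modular p μ (fun x => ∫⁻ y, K x y * F y ∂μ)
      ≤ C * modular p μ F + ∫⁻ x, ∫⁻ y, K x y * err x y ∂μ ∂μ := by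
  have hKx : ∀ x, Measurable fun y => K x y := fun x => hK.comp measurable_prodMk_left
  have hEx : ∀ x, Measurable fun y => err x y := fun x => herr.comp measurable_prodMk_left
  have hm : AEMeasurable (fun y => F y ^ p y) μ := hF.aemeasurable.pow hpm
  have step : ∀ᵐ x ∂μ, (∫⁻ y, K x y * F y ∂μ) ^ p x
      ≤ ∫⁻ y, K x y * (C * F y ^ p y) ∂μ + ∫⁻ y, K x y * err x y ∂μ := by
    filter_upwards [hp, hK1, h] with x hx hx1 hx2
    refine (rpow_lintegral_mul_le (hKx x).aemeasurable hx1 hF.aemeasurable hx).trans ?_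
    have hKE : Measurable fun y => K x y * err x y := (hKx x).mul (hEx x)
    rw [← lintegral_add_right _ hKE]
    refine lintegral_mono_ae ?_
    filter_upwards [hx2] with y hy
    rw [← mul_add]
    gcongr
  have hmK : AEMeasurable (Function.uncurry fun x y => K x y * (C * F y ^ p y)) (μ.prod μ) :=
    hK.aemeasurable.mul ((hm.const_mul C).comp_snd)
  calc _ ≤ ∫⁻ x, (∫⁻ y, K x y * (C * F y ^ p y) ∂μ + ∫⁻ y, K x y * err x y ∂μ) ∂μ :=
        lintegral_mono_ae step
    _ = ∫⁻ x, ∫⁻ y, K x y * (C * F y ^ p y) ∂μ ∂μ + ∫⁻ x, ∫⁻ y, K x y * err x y ∂μ ∂μ :=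
        lintegral_add_right _ (Measurable.lintegral_prod_right (hK.mul herr))
    _ ≤ _ := by
        gcongr
        -- The row masses were used in Jensen's inequality; after Tonelli the column masses remove
        -- the kernel.
        rw [lintegral_lintegral_swap hmK]
        unfold modular
        rw [← lintegral_const_mul'' _ hm]
        refine lintegral_mono_ae ?_
        filter_upwards [hK2] with y hy
        have hKy : Measurable fun x => K x y := hK.comp measurable_prodMk_right
        rw [lintegral_mul_const _ hKy]
        exact mul_le_of_le_one_left' hy

end Lux

/-! ### Gaussian convolutions on variable Lebesgue spaces -/

/-- Changing the exponent of a number in `[0,1]`. -/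
theorem rpow_le_mul_rpow_add_exp {u : ℝ≥0∞} (hu : u ≤ 1) {p₁ p₂ w A : ℝ} (hp₁ : 1 ≤ p₁)
    (hA : |p₁ - p₂| * w ≤ A) (hA0 : 0 ≤ A) :
    u ^ p₁ ≤ ENNReal.ofReal (Real.exp A) * u ^ p₂ + ENNReal.ofReal (Real.exp (-w)) := by
  -- Below the threshold `e^{-w}` the error term absorbs `u^{p₁} ≤ u`. Above it, when `p₁ < p₂`, one
  -- has `u^{p₁-p₂} ≤ e^{w|p₁-p₂|} ≤ e^A`.
  rcases le_or_gt u (ENNReal.ofReal (Real.exp (-w))) with h | h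
  · refine le_trans ?_ (h.trans le_add_self)
    calc u ^ p₁ ≤ u ^ (1 : ℝ) := ENNReal.rpow_le_rpow_of_exponent_ge hu hp₁
      _ = u := ENNReal.rpow_one u
  refine le_trans ?_ le_self_add
  have hu0 : u ≠ 0 := (lt_of_le_of_lt (zero_le) h).ne'
  have hut : u ≠ ∞ := (hu.trans_lt ENNReal.one_lt_top).ne
  rcases le_total p₂ p₁ with hpp | hpp
  · calc u ^ p₁ ≤ u ^ p₂ := ENNReal.rpow_le_rpow_of_exponent_ge hu hpp
      _ = 1 * u ^ p₂ := (one_mul _).symm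
      _ ≤ _ := by
        gcongr
        rw [← ENNReal.ofReal_one]
        exact ENNReal.ofReal_le_ofReal (Real.one_le_exp hA0)
  · have e : u ^ p₁ = u ^ (p₁ - p₂) * u ^ p₂ := by
      rw [← ENNReal.rpow_add _ _ hu0 hut, sub_add_cancel]
    rw [e]
    gcongr
    have h1 : u ^ (p₁ - p₂) ≤ (ENNReal.ofReal (Real.exp (-w))) ^ (p₁ - p₂) := by
      have e1 : p₁ - p₂ = -(p₂ - p₁) := by ring
      rw [e1, ENNReal.rpow_neg, ENNReal.rpow_neg]
      exact ENNReal.inv_le_inv.2 (ENNReal.rpow_le_rpow h.le (by linarith))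
    refine h1.trans ?_
    rw [ENNReal.ofReal_rpow_of_pos (Real.exp_pos _), ← Real.exp_mul]
    refine ENNReal.ofReal_le_ofReal (Real.exp_le_exp.2 ?_)
    rw [abs_of_nonpos (by linarith)] at hA
    linarith

section Heat

open Module (finrank)

variable {V : Type*} [NormedAddCommGroup V] [InnerProductSpace ℝ V] [FiniteDimensional ℝ V]
  [MeasurableSpace V] [BorelSpace V]

set_option linter.unusedSectionVars false

/-- The centered Gaussian density of inverse variance `2b`. -/
def heatDensity {V : Type*} [NormedAddCommGroup V] [InnerProductSpace ℝ V] (b : ℝ) (x y : V) :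
    ℝ≥0∞ :=
  ENNReal.ofReal ((b / Real.pi) ^ ((finrank ℝ V : ℝ) / 2) * Real.exp (-b * ‖x - y‖ ^ 2))

theorem lintegral_exp_neg_mul_norm_sq {b : ℝ} (hb : 0 < b) :
    ∫⁻ x : V, ENNReal.ofReal (Real.exp (-b * ‖x‖ ^ 2))
      = ENNReal.ofReal ((Real.pi / b) ^ ((finrank ℝ V : ℝ) / 2)) := by
  have h := GaussianFourier.integral_rexp_neg_mul_sq_norm (V := V) hb
  have hi : Integrable fun x : V => Real.exp (-b * ‖x‖ ^ 2) := by
    -- The Bochner integral of a non-integrable function is 0, which contradicts the positive value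
    -- found in `h`.
    by_contra hn
    rw [integral_undef hn] at h
    have : 0 < (Real.pi / b) ^ ((Module.finrank ℝ V : ℝ) / 2) := by positivity
    exact this.ne h
  rw [← ofReal_integral_eq_lintegral_ofReal hi (Eventually.of_forall fun x => (Real.exp_pos _).le),
    h]

theorem measurable_heatDensity (b : ℝ) : Measurable (Function.uncurry (heatDensity (V := V) b)) := by
  unfold heatDensity Function.uncurry
  fun_prop

theorem lintegral_heatDensity_left {b : ℝ} (hb : 0 < b) (y : V) :
    ∫⁻ x, heatDensity b x y = 1 := by
  unfold heatDensity
  have h0 : 0 ≤ (b / Real.pi) ^ ((finrank ℝ V : ℝ) / 2) := by positivity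
  simp_rw [ENNReal.ofReal_mul h0]
  rw [lintegral_const_mul _ (by fun_prop),
    lintegral_sub_right_eq_self (fun x : V => ENNReal.ofReal (Real.exp (-b * ‖x‖ ^ 2))) y,
    lintegral_exp_neg_mul_norm_sq hb, ← ENNReal.ofReal_mul h0,
    ← Real.mul_rpow (by positivity) (by positivity)]
  have : b / Real.pi * (Real.pi / b) = 1 := by field_simp
  simp [this]

theorem heatDensity_comm (b : ℝ) (x y : V) : heatDensity b x y = heatDensity b y x := by
  unfold heatDensity
  rw [norm_sub_rev]

theorem lintegral_heatDensity_right {b : ℝ} (hb : 0 < b) (x : V) :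
    ∫⁻ y, heatDensity b x y = 1 := by
  simp_rw [heatDensity_comm b x]
  exact lintegral_heatDensity_left hb x

/-- The height of the heat density is a power of `b`, while log-Hölder continuity at distance
`b^{-1/4}` is measured by `log (e + b^{1/4})`. This compares the two. -/
theorem log_le_of_rpow_quarter {b : ℝ} (hb : 0 < b) :
    Real.log b ≤ 4 * Real.log (Real.exp 1 + b ^ (1 / 4 : ℝ)) := by
  have h1 : b ^ (1 / 4 : ℝ) ≤ Real.exp 1 + b ^ (1 / 4 : ℝ) := by
    have := Real.exp_pos 1; linarith
  have h2 := Real.log_le_log (by positivity) h1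
  rw [Real.log_rpow hb] at h2
  linarith

/-- Far from the diagonal the Gaussian density is bounded. -/
theorem heatDensity_le_of_far {b : ℝ} (hb : 0 < b) {x y : V}
    (h : b ^ (-(1 / 4) : ℝ) ≤ ‖x - y‖) : heatDensity b x y ≤ ((finrank ℝ V).factorial : ℝ≥0∞) := by
  unfold heatDensity
  rw [← ENNReal.ofReal_natCast]
  refine ENNReal.ofReal_le_ofReal ?_
  -- At distance `b^{-1/4}` the exponent is already `b^{1/2}`, and `e^{-b^{1/2}}` beats the height
  -- `b^{d/2} = (b^{1/2})^d` up to the factor `d!`.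
  have h1 : b * ‖x - y‖ ^ 2 ≥ b ^ (1 / 2 : ℝ) := by
    calc b * ‖x - y‖ ^ 2 ≥ b * (b ^ (-(1 / 4) : ℝ)) ^ 2 := by gcongr
      _ = b ^ (1 : ℝ) * b ^ (-(1 / 2) : ℝ) := by
        rw [← Real.rpow_natCast, ← Real.rpow_mul hb.le, Real.rpow_one]; norm_num
      _ = b ^ (1 / 2 : ℝ) := by rw [← Real.rpow_add hb]; norm_num
  have h2 : Real.exp (-b * ‖x - y‖ ^ 2) ≤ Real.exp (-b ^ (1 / 2 : ℝ)) :=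
    Real.exp_le_exp.2 (by linarith)
  have h3 : (b / Real.pi) ^ ((finrank ℝ V : ℝ) / 2) ≤ (b ^ (1 / 2 : ℝ)) ^ finrank ℝ V := by
    rw [← Real.rpow_natCast, ← Real.rpow_mul hb.le, one_div_mul_eq_div]
    exact Real.rpow_le_rpow (by positivity)
      (div_le_self hb.le (by linarith [Real.pi_gt_three])) (by positivity)
  have h4 : (b ^ (1 / 2 : ℝ)) ^ finrank ℝ V ≤ (finrank ℝ V).factorial * Real.exp (b ^ (1 / 2 : ℝ)) := by
    have := Real.pow_div_factorial_le_exp (b ^ (1 / 2 : ℝ)) (by positivity) (finrank ℝ V)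
    rw [div_le_iff₀ (by positivity)] at this
    linarith
  calc _ ≤ ((finrank ℝ V).factorial * Real.exp (b ^ (1 / 2 : ℝ))) * Real.exp (-b ^ (1 / 2 : ℝ)) := by
        gcongr; exact h3.trans h4
    _ = (finrank ℝ V).factorial := by rw [mul_assoc, ← Real.exp_add]; simp

/-- A function which is `0` or larger than `1` is below all its powers with exponent `≥ 1`. -/
theorem rpow_le_rpow_of_eq_zero_or {u : ℝ≥0∞} (hu : u = 0 ∨ 1 ≤ u) {r p : ℝ} (hr : 0 < r)
    (h : r ≤ p) : u ^ r ≤ u ^ p := by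
  rcases hu with rfl | hu
  · rw [ENNReal.zero_rpow_of_pos hr]; exact zero_le
  · exact ENNReal.rpow_le_rpow_of_exponent_le hu h

/-- The part of a Gaussian convolution near the diagonal, for functions which are large where they
do not vanish; this is where local log-Hölder continuity enters. -/
theorem rpow_near_heat_le {p : V → ℝ} (hp1 : ∀ x, 1 ≤ p x) {C₀ : ℝ} (hC₀ : 0 < C₀)
    (hLH : ∀ x y, |p x - p y| ≤ C₀ / Real.log (Real.exp 1 + 1 / ‖x - y‖)) {b : ℝ} (hb : 0 < b)
    {F : V → ℝ≥0∞} (hF : Measurable F) (hF1 : ∀ y, F y = 0 ∨ 1 ≤ F y) (hFint : ∫⁻ y, F y ≤ 1)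
    (x : V) :
    (∫⁻ y in Metric.ball x (b ^ (-(1 / 4) : ℝ)), heatDensity b x y * F y) ^ p x
      ≤ ENNReal.ofReal (Real.exp (2 * finrank ℝ V * C₀)) * ∫⁻ y, heatDensity b x y * F y ^ p y := by
  set R : ℝ := b ^ (-(1 / 4) : ℝ) with hR
  have hR0 : 0 < R := by positivity
  have hRi : 1 / R = b ^ (1 / 4 : ℝ) := by rw [hR, Real.rpow_neg hb.le]; simp
  set ℓ := Real.log (Real.exp 1 + b ^ (1 / 4 : ℝ)) with hℓ
  have hℓ1 : 1 ≤ ℓ := by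
    rw [hℓ, Real.le_log_iff_exp_le (by positivity)]
    have : 0 ≤ b ^ (1 / 4 : ℝ) := by positivity
    linarith
  -- `r` is a lower bound for `p` on the ball, still at least 1 so that Jensen applies, and within
  -- `C₀/ℓ` of `p x`. In `I^{p x} = I^{p x - r} I^r` the first factor is bounded by the height of
  -- the kernel, and the second by Jensen together with `F^r ≤ F^{p y}`.
  set r := max 1 (p x - C₀ / ℓ) with hr
  have hr1 : 1 ≤ r := le_max_left _ _
  have hrp : r ≤ p x := max_le (hp1 x) (by have : 0 ≤ C₀ / ℓ := by positivity
                                           linarith)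
  have hpr : p x - r ≤ C₀ / ℓ := by linarith [le_max_right 1 (p x - C₀ / ℓ)]
  have hry : ∀ y ∈ Metric.ball x R, r ≤ p y := by
    intro y hy
    refine max_le (hp1 y) ?_
    by_cases hxy : x = y
    · subst hxy
      have : 0 ≤ C₀ / ℓ := by positivity
      linarith
    have hxy0 : 0 < ‖x - y‖ := norm_pos_iff.2 (sub_ne_zero.2 hxy)
    have h1 : ‖x - y‖ < R := by rwa [Metric.mem_ball, dist_comm, dist_eq_norm] at hy
    have h2 : ℓ ≤ Real.log (Real.exp 1 + 1 / ‖x - y‖) := by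
      rw [hℓ, ← hRi]
      refine Real.log_le_log (by positivity) ?_
      gcongr
    have h3 := (abs_le.1 (hLH x y)).2
    have h4 : C₀ / Real.log (Real.exp 1 + 1 / ‖x - y‖) ≤ C₀ / ℓ := by gcongr
    linarith
  set I := ∫⁻ y in Metric.ball x R, heatDensity b x y * F y with hI
  have hKx : Measurable fun y => heatDensity b x y :=
    (measurable_heatDensity b).of_uncurry_left
  -- the convolution is at most the height of the kernel
  have hIle : I ≤ ENNReal.ofReal ((b / Real.pi) ^ ((finrank ℝ V : ℝ) / 2)) := by
    calc I ≤ ∫⁻ y, heatDensity b x y * F y := setLIntegral_le_lintegral _ _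
      _ ≤ ∫⁻ y, ENNReal.ofReal ((b / Real.pi) ^ ((finrank ℝ V : ℝ) / 2)) * F y := by
          refine lintegral_mono fun y => ?_
          gcongr
          refine ENNReal.ofReal_le_ofReal (mul_le_of_le_one_right (by positivity) ?_)
          rw [Real.exp_le_one_iff]
          nlinarith [sq_nonneg ‖x - y‖]
      _ = ENNReal.ofReal ((b / Real.pi) ^ ((finrank ℝ V : ℝ) / 2)) * ∫⁻ y, F y :=
          lintegral_const_mul _ hF
      _ ≤ _ := mul_le_of_le_one_right' hFint
  have hIt : I ≠ ∞ := (hIle.trans_lt ENNReal.ofReal_lt_top).ne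
  -- The height is at most `b^{d/2} ≤ e^{2dℓ}`, as `log b ≤ 4ℓ`; raising it to a power at most
  -- `C₀/ℓ` cancels `ℓ`.
  have hA : I ^ (p x - r) ≤ ENNReal.ofReal (Real.exp (2 * finrank ℝ V * C₀)) := by
    have hb' : (b / Real.pi) ^ ((finrank ℝ V : ℝ) / 2) ≤ Real.exp (2 * finrank ℝ V * ℓ) := by
      calc (b / Real.pi) ^ ((finrank ℝ V : ℝ) / 2) ≤ b ^ ((finrank ℝ V : ℝ) / 2) :=
            Real.rpow_le_rpow (by positivity)
              (div_le_self hb.le (by linarith [Real.pi_gt_three])) (by positivity)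
        _ = Real.exp (Real.log b * (finrank ℝ V / 2)) := Real.rpow_def_of_pos hb _
        _ ≤ _ := by
            refine Real.exp_le_exp.2 ?_
            have := log_le_of_rpow_quarter hb
            have hd : (0 : ℝ) ≤ finrank ℝ V / 2 := by positivity
            nlinarith
    calc I ^ (p x - r) ≤ (ENNReal.ofReal (Real.exp (2 * finrank ℝ V * ℓ))) ^ (p x - r) :=
          ENNReal.rpow_le_rpow (hIle.trans (ENNReal.ofReal_le_ofReal hb')) (by linarith)
      _ = ENNReal.ofReal (Real.exp (2 * finrank ℝ V * ℓ * (p x - r))) := by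
          rw [ENNReal.ofReal_rpow_of_pos (Real.exp_pos _), ← Real.exp_mul]
      _ ≤ _ := by
          refine ENNReal.ofReal_le_ofReal (Real.exp_le_exp.2 ?_)
          calc 2 * finrank ℝ V * ℓ * (p x - r) ≤ 2 * finrank ℝ V * ℓ * (C₀ / ℓ) := by gcongr
            _ = 2 * finrank ℝ V * C₀ := by field_simp
  have hB : I ^ r ≤ ∫⁻ y, heatDensity b x y * F y ^ p y := by
    calc I ^ r ≤ ∫⁻ y in Metric.ball x R, heatDensity b x y * F y ^ r :=
          rpow_lintegral_mul_le hKx.aemeasurable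
            ((setLIntegral_le_lintegral _ _).trans (lintegral_heatDensity_right hb x).le)
            hF.aemeasurable hr1
      _ ≤ ∫⁻ y in Metric.ball x R, heatDensity b x y * F y ^ p y := by
          refine setLIntegral_mono' Metric.isOpen_ball.measurableSet fun y hy => ?_
          exact mul_le_mul' le_rfl (rpow_le_rpow_of_eq_zero_or (hF1 y) (by linarith) (hry y hy))
      _ ≤ _ := setLIntegral_le_lintegral _ _
  calc I ^ p x = I ^ ((p x - r) + r) := by rw [sub_add_cancel]
    _ = I ^ (p x - r) * I ^ r := ENNReal.rpow_add_of_nonneg _ _ (by linarith) (by linarith)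
    _ ≤ _ := mul_le_mul' hA hB

/-- Gaussian convolutions on the unit ball of the modular, for functions which are large where they
do not vanish. -/
theorem modular_heat_large_le {p : V → ℝ} (hp1 : ∀ x, 1 ≤ p x)
    (hpm : Measurable p) {C₀ : ℝ} (hC₀ : 0 < C₀)
    (hLH : ∀ x y, |p x - p y| ≤ C₀ / Real.log (Real.exp 1 + 1 / ‖x - y‖)) {b : ℝ} (hb : 0 < b)
    {F : V → ℝ≥0∞} (hF : Measurable F) (hF1 : ∀ y, F y = 0 ∨ 1 ≤ F y)
    (hmod : modular p volume F ≤ 1) :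
    modular p volume (fun x => (∫⁻ y, heatDensity b x y * F y) / (2 * (finrank ℝ V).factorial))
      ≤ ENNReal.ofReal (Real.exp (2 * finrank ℝ V * C₀)) + 1 := by
  have hFint : ∫⁻ y, F y ≤ 1 := by
    refine le_trans (lintegral_mono fun y => ?_) hmod
    simpa using rpow_le_rpow_of_eq_zero_or (hF1 y) zero_lt_one (hp1 y)
  set R : ℝ := b ^ (-(1 / 4) : ℝ) with hR
  have hfac1 : (1 : ℝ≥0∞) ≤ (finrank ℝ V).factorial := by exact_mod_cast Nat.one_le_iff_ne_zero.2 (finrank ℝ V).factorial_ne_zero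
  have hfac0 : ((finrank ℝ V).factorial : ℝ≥0∞) ≠ 0 := by exact_mod_cast (finrank ℝ V).factorial_ne_zero
  have hm := measurable_heatDensity (V := V) b
  have hmF : Measurable (Function.uncurry fun x y => heatDensity b x y * F y) :=
    hm.mul (hF.comp measurable_snd)
  set near : V → ℝ≥0∞ := fun x => ∫⁻ y in Metric.ball x R, heatDensity b x y * F y with hnear
  -- Dividing by `d!` makes the far part at most `∫ F ≤ 1`. Powers with exponent at least 1 then
  -- only decrease it, and the `L¹` bound suffices.
  set far : V → ℝ≥0∞ := fun x =>
    (∫⁻ y in (Metric.ball x R)ᶜ, heatDensity b x y * F y) / (finrank ℝ V).factorial with hfar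
  have hnearm : Measurable near := by
    have hs : MeasurableSet {z : V × V | dist z.2 z.1 < R} :=
      (isOpen_lt (by fun_prop) (by fun_prop)).measurableSet
    have : near = fun x => ∫⁻ y, {z : V × V | dist z.2 z.1 < R}.indicator
        (Function.uncurry fun x y => heatDensity b x y * F y) (x, y) := by
      funext x
      simp only [hnear]
      rw [← lintegral_indicator Metric.isOpen_ball.measurableSet]
      rfl
    rw [this]
    exact Measurable.lintegral_prod_right' (hmF.indicator hs)
  have hfar1 : ∀ x, far x ≤ ∫⁻ y, F y := fun x => by
    refine ENNReal.div_le_of_le_mul ?_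
    rw [← lintegral_mul_const _ hF]
    refine (setLIntegral_mono' Metric.isOpen_ball.measurableSet.compl fun y hy => ?_).trans
      (setLIntegral_le_lintegral _ _)
    rw [mul_comm]
    gcongr
    refine heatDensity_le_of_far hb ?_
    rw [← hR]
    simpa [dist_comm x y, dist_eq_norm, norm_sub_rev] using hy
  have hfar2 : ∀ x, far x ≤ ∫⁻ y, heatDensity b x y * F y := fun x => by
    refine ENNReal.div_le_of_le_mul ((setLIntegral_le_lintegral _ _).trans ?_)
    exact le_mul_of_one_le_right' hfac1
  have hle : ∀ x, (∫⁻ y, heatDensity b x y * F y) / (2 * (finrank ℝ V).factorial) ≤ (near x + far x) / 2 := by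
    intro x
    rw [← lintegral_add_compl _ (Metric.isOpen_ball (x := x) (ε := R)).measurableSet]
    rw [mul_comm, div_eq_mul_inv, ENNReal.mul_inv (Or.inl hfac0) (Or.inl (by simp)), ← mul_assoc,
      ← div_eq_mul_inv, ← div_eq_mul_inv]
    refine ENNReal.div_le_div_right ?_ _
    rw [ENNReal.add_div]
    refine add_le_add (ENNReal.div_le_of_le_mul (le_mul_of_one_le_right' hfac1)) le_rfl
  have hp1' : ∀ᵐ x : V, 1 ≤ p x := Eventually.of_forall hp1
  refine (modular_mono hp1' (Eventually.of_forall hle)).trans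
    ((modular_add_div_two_le hp1' hpm.aemeasurable hnearm.aemeasurable).trans (add_le_add ?_ ?_))
  · calc modular p volume near
        ≤ ∫⁻ x, ENNReal.ofReal (Real.exp (2 * finrank ℝ V * C₀)) *
            ∫⁻ y, heatDensity b x y * F y ^ p y :=
          lintegral_mono fun x => rpow_near_heat_le hp1 hC₀ hLH hb hF hF1 hFint x
      _ = ENNReal.ofReal (Real.exp (2 * finrank ℝ V * C₀)) *
            ∫⁻ x, ∫⁻ y, heatDensity b x y * F y ^ p y := by
          refine lintegral_const_mul' _ _ (by simp)
      _ = ENNReal.ofReal (Real.exp (2 * finrank ℝ V * C₀)) * modular p volume F := by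
          congr 1
          rw [lintegral_lintegral_swap
            (hm.mul ((hF.pow hpm).comp measurable_snd)).aemeasurable]
          refine lintegral_congr fun y => ?_
          have : Measurable fun x => heatDensity b x y := hm.of_uncurry_right
          rw [lintegral_mul_const _ this, lintegral_heatDensity_left hb, one_mul]
      _ ≤ _ := mul_le_of_le_one_right' hmod
  · calc modular p volume far ≤ ∫⁻ x, ∫⁻ y, heatDensity b x y * F y := by
          refine lintegral_mono fun x => le_trans ?_ (hfar2 x)
          calc far x ^ p x ≤ far x ^ (1 : ℝ) :=
                ENNReal.rpow_le_rpow_of_exponent_ge ((hfar1 x).trans hFint) (hp1 x)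
            _ = far x := ENNReal.rpow_one _
      _ = ∫⁻ y, F y := by
          rw [lintegral_lintegral_swap hmF.aemeasurable]
          refine lintegral_congr fun y => ?_
          have : Measurable fun x => heatDensity b x y := hm.of_uncurry_right
          rw [lintegral_mul_const _ this, lintegral_heatDensity_left hb, one_mul]
      _ ≤ 1 := hFint

/-- For functions below 1, the behaviour of `p` at infinity alone controls the change of exponent:
it costs `e^{-min(|x|²,|y|²)} ≤ e^{-|x|²} + e^{-|y|²}`, and each term stays integrable after the
kernel is integrated out. -/
theorem modular_heat_small_le [Nontrivial V] {p : V → ℝ} (hp1 : ∀ x, 1 ≤ p x)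
    (hpm : Measurable p) {C₁ pinf : ℝ} (hC₁ : 0 < C₁)
    (hinf : ∀ x, x ≠ 0 → |p x - pinf| ≤ C₁ / ‖x‖ ^ 2) {b : ℝ} (hb : 0 < b)
    {F : V → ℝ≥0∞} (hF : Measurable F) (hF1 : ∀ y, F y ≤ 1)
    (hmod : modular p volume F ≤ 1) :
    modular p volume (fun x => ∫⁻ y, heatDensity b x y * F y)
      ≤ ENNReal.ofReal (Real.exp (2 * C₁)) + 2 * ENNReal.ofReal (Real.pi ^ ((finrank ℝ V : ℝ) / 2)) := by
  -- The decay condition says nothing at the origin, which is a null set because `V` is nontrivial.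
  have hne : ∀ᵐ x : V, x ≠ 0 := by
    simp [ae_iff]
  have hm := measurable_heatDensity (V := V) b
  set w : V → ℝ≥0∞ := fun x => ENNReal.ofReal (Real.exp (-1 * ‖x‖ ^ 2)) with hw
  have hwm : Measurable w := by fun_prop
  have hwint : ∫⁻ x, w x = ENNReal.ofReal (Real.pi ^ ((finrank ℝ V : ℝ) / 2)) := by
    simpa [hw] using lintegral_exp_neg_mul_norm_sq (V := V) zero_lt_one
  have h := lintegral_rpow_kernel_le (μ := (volume : Measure V)) (p := p)
    (Eventually.of_forall hp1) hpm.aemeasurable (K := heatDensity b)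
    (err := fun x y => w x + w y) hm (by unfold Function.uncurry; fun_prop)
    (Eventually.of_forall fun x => (lintegral_heatDensity_right hb x).le)
    (Eventually.of_forall fun x => (lintegral_heatDensity_left hb x).le) hF
    (C := ENNReal.ofReal (Real.exp (2 * C₁))) ?_
  · refine h.trans (add_le_add (mul_le_of_le_one_right' hmod) (le_of_eq ?_))
    have e : ∀ x, ∫⁻ y, heatDensity b x y * (w x + w y)
        = w x + ∫⁻ y, heatDensity b x y * w y := by
      intro x
      have hx : Measurable fun y => heatDensity b x y := hm.of_uncurry_left
      simp_rw [mul_add]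
      rw [lintegral_add_left (hx.mul_const _), lintegral_mul_const _ hx,
        lintegral_heatDensity_right hb, one_mul]
    simp_rw [e]
    rw [lintegral_add_left hwm, lintegral_lintegral_swap
      (hm.mul (hwm.comp measurable_snd)).aemeasurable, hwint, two_mul]
    congr 1
    rw [← hwint]
    refine lintegral_congr fun y => ?_
    have : Measurable fun x => heatDensity b x y := hm.of_uncurry_right
    rw [lintegral_mul_const _ this, lintegral_heatDensity_left hb, one_mul]
  · filter_upwards [hne] with x hx
    filter_upwards [hne] with y hy
    have hx0 : 0 < ‖x‖ ^ 2 := by positivity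
    have hy0 : 0 < ‖y‖ ^ 2 := by positivity
    refine (rpow_le_mul_rpow_add_exp (hF1 y) (w := min (‖x‖ ^ 2) (‖y‖ ^ 2)) (A := 2 * C₁)
      (p₂ := p y) (hp1 x) ?_ (by positivity)).trans ?_
    · have h1 := hinf x hx
      have h2 := hinf y hy
      rw [le_div_iff₀ hx0] at h1
      rw [le_div_iff₀ hy0] at h2
      calc |p x - p y| * min (‖x‖ ^ 2) (‖y‖ ^ 2)
          ≤ (|p x - pinf| + |p y - pinf|) * min (‖x‖ ^ 2) (‖y‖ ^ 2) := by
            gcongr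
            have := abs_sub_le (p x) pinf (p y)
            rwa [abs_sub_comm pinf (p y)] at this
        _ ≤ |p x - pinf| * ‖x‖ ^ 2 + |p y - pinf| * ‖y‖ ^ 2 := by
            rw [add_mul]
            gcongr
            · exact min_le_left _ _
            · exact min_le_right _ _
        _ ≤ 2 * C₁ := by linarith
    · gcongr
      simp only [hw, neg_mul, one_mul]
      rcases min_choice (‖x‖ ^ 2) (‖y‖ ^ 2) with h | h <;> rw [h]
      · exact le_self_add
      · exact le_add_self

/-- Gaussian convolutions are uniformly bounded on the unit ball of the modular. -/
theorem modular_heat_le [Nontrivial V] {p : V → ℝ} (hp1 : ∀ x, 1 ≤ p x)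
    (hpm : Measurable p) {C₀ C₁ pinf : ℝ} (hC₀ : 0 < C₀) (hC₁ : 0 < C₁)
    (hLH : ∀ x y, |p x - p y| ≤ C₀ / Real.log (Real.exp 1 + 1 / ‖x - y‖))
    (hinf : ∀ x, x ≠ 0 → |p x - pinf| ≤ C₁ / ‖x‖ ^ 2) {b : ℝ} (hb : 0 < b)
    {F : V → ℝ≥0∞} (hF : Measurable F) (hmod : modular p volume F ≤ 1) :
    modular p volume (fun x => (∫⁻ y, heatDensity b x y * F y) / (2 * (finrank ℝ V).factorial) / 2)
      ≤ ENNReal.ofReal (Real.exp (2 * C₁)) + 2 * ENNReal.ofReal (Real.pi ^ ((finrank ℝ V : ℝ) / 2)) +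
        (ENNReal.ofReal (Real.exp (2 * finrank ℝ V * C₀)) + 1) := by
  have hp1' : ∀ᵐ x : V, 1 ≤ p x := Eventually.of_forall hp1
  -- Cut at height 1: small values use the decay of `p` at infinity, large values its local
  -- log-Hölder continuity.
  set s : Set V := {y | F y ≤ 1} with hs
  have hsm : MeasurableSet s := measurableSet_le hF measurable_const
  have hm := measurable_heatDensity (V := V) b
  have hmod' : ∀ t : Set V, modular p volume (t.indicator F) ≤ 1 := fun t =>
    (modular_mono hp1' (Eventually.of_forall fun y => indicator_le_self _ _ _)).trans hmod
  have h1 := modular_heat_small_le hp1 hpm hC₁ hinf hb (hF.indicator hsm)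
    (fun y => by by_cases hy : y ∈ s <;> simp [hy]; exact hy) (hmod' s)
  have h2 := modular_heat_large_le hp1 hpm hC₀ hLH hb (hF.indicator hsm.compl)
    (fun y => by
      by_cases hy : y ∈ s
      · simp [hy]
      · simp only [mem_compl_iff, hy, not_false_eq_true, indicator_of_mem]
        exact Or.inr (le_of_not_ge hy)) (hmod' sᶜ)
  refine le_trans ?_ (add_le_add h1 h2)
  refine le_trans (modular_mono hp1' (Eventually.of_forall fun x => ?_))
    (modular_add_div_two_le hp1' hpm.aemeasurable
      (Measurable.lintegral_prod_right
        (hm.mul ((hF.indicator hsm).comp measurable_snd))).aemeasurable)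
  refine ENNReal.div_le_div_right ?_ _
  have hx : Measurable fun y => heatDensity b x y := hm.of_uncurry_left
  have e : ∫⁻ y, heatDensity b x y * F y = (∫⁻ y, heatDensity b x y * s.indicator F y)
      + ∫⁻ y, heatDensity b x y * sᶜ.indicator F y := by
    have hx' : Measurable fun y => heatDensity b x y * s.indicator F y :=
      hx.mul (hF.indicator hsm)
    rw [← lintegral_add_left hx']
    refine lintegral_congr fun y => ?_
    rw [← mul_add]
    congr 1
    exact (congrFun (indicator_self_add_compl s F) y).symm
  rw [e, ENNReal.add_div]
  gcongr
  refine ENNReal.div_le_of_le_mul (le_mul_of_one_le_right' ?_)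
  have : (1 : ℝ≥0∞) ≤ (finrank ℝ V).factorial := by
    exact_mod_cast Nat.one_le_iff_ne_zero.2 (finrank ℝ V).factorial_ne_zero
  exact one_le_mul (by norm_num) this

end Heat

/-! ### The Ornstein-Uhlenbeck semigroup on variable Lebesgue spaces -/

section OU

variable {d : ℕ}

/-- The density of `γ_d`. -/
def gaussDensity (d : ℕ) (x : EuclideanSpace ℝ (Fin d)) : ℝ :=
  Real.exp (-‖x‖ ^ 2) / Real.pi ^ ((d : ℝ) / 2)

/-- The Mehler kernel of `T_s` with respect to `γ_d`. -/
def ouKernel (s : ℝ) (x y : EuclideanSpace ℝ (Fin d)) : ℝ :=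
  1 / (1 - Real.exp (-2 * s)) ^ ((d : ℝ) / 2) *
    Real.exp (-(Real.exp (-2 * s) * (‖x‖ ^ 2 + ‖y‖ ^ 2)
        - 2 * Real.exp (-s) * inner ℝ x y) / (1 - Real.exp (-2 * s)))

theorem ouSemigroup_eq (s : ℝ) (f : EuclideanSpace ℝ (Fin d) → ℝ) (x : EuclideanSpace ℝ (Fin d)) :
    ouSemigroup s f x = ∫ y, ouKernel s x y * f y ∂(gammaD d) := by
  unfold ouSemigroup ouKernel
  rw [← integral_const_mul]
  simp_rw [mul_assoc]

theorem gaussDensity_pos (x : EuclideanSpace ℝ (Fin d)) : 0 < gaussDensity d x := by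
  unfold gaussDensity; positivity

theorem measurable_gaussDensity : Measurable (gaussDensity d) := by
  unfold gaussDensity; fun_prop

theorem lintegral_gammaD {f : EuclideanSpace ℝ (Fin d) → ℝ≥0∞} :
    ∫⁻ x, f x ∂(gammaD d) = ∫⁻ x, ENNReal.ofReal (gaussDensity d x) * f x := by
  unfold gammaD
  exact lintegral_withDensity_eq_lintegral_mul_non_measurable _
    measurable_gaussDensity.ennreal_ofReal (Eventually.of_forall fun _ => ENNReal.ofReal_lt_top) _

instance : IsProbabilityMeasure (gammaD d) := ⟨by
  have h := lintegral_gammaD (d := d) (f := fun _ => 1)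
  simp only [lintegral_const, one_mul, mul_one] at h
  rw [h]
  have h0 : (0 : ℝ) ≤ (Real.pi ^ ((d : ℝ) / 2))⁻¹ := by positivity
  have h2 : ∀ x, ENNReal.ofReal (gaussDensity d x)
      = ENNReal.ofReal (Real.exp (-‖x‖ ^ 2)) * ENNReal.ofReal (Real.pi ^ ((d : ℝ) / 2))⁻¹ :=
    fun x => by rw [← ENNReal.ofReal_mul' h0, gaussDensity, div_eq_mul_inv]
  simp_rw [h2]
  have h1 := lintegral_exp_neg_mul_norm_sq (V := EuclideanSpace ℝ (Fin d)) zero_lt_one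
  simp only [neg_mul, one_mul, div_one, finrank_euclideanSpace, Fintype.card_fin] at h1
  rw [lintegral_mul_const' _ _ ENNReal.ofReal_ne_top, h1,
    ← ENNReal.ofReal_mul (by positivity), mul_inv_cancel₀ (by positivity), ENNReal.ofReal_one]⟩

theorem absolutelyContinuous_gammaD : (volume : Measure (EuclideanSpace ℝ (Fin d))) ≪ gammaD d :=
  withDensity_absolutelyContinuous' measurable_gaussDensity.ennreal_ofReal.aemeasurable
    (Eventually.of_forall fun x => (ENNReal.ofReal_pos.2 (gaussDensity_pos x)).ne')

theorem one_sub_exp_pos {s : ℝ} (hs : 0 < s) : 0 < 1 - Real.exp (-2 * s) := by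
  have : Real.exp (-2 * s) < 1 := Real.exp_lt_one_iff.2 (by linarith)
  linarith

theorem exp_neg_two_mul (s : ℝ) : Real.exp (-2 * s) = Real.exp (-s) ^ 2 := by
  rw [← Real.exp_nat_mul]; congr 1; push_cast; ring

theorem ouKernel_pos {s : ℝ} (hs : 0 < s) (x y : EuclideanSpace ℝ (Fin d)) :
    0 < ouKernel s x y := by
  have := one_sub_exp_pos hs
  unfold ouKernel; positivity

theorem ouKernel_comm (s : ℝ) (x y : EuclideanSpace ℝ (Fin d)) :
    ouKernel s x y = ouKernel s y x := by
  unfold ouKernel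
  rw [real_inner_comm, add_comm (‖x‖ ^ 2)]

theorem measurable_ouKernel : Measurable fun z : ℝ × EuclideanSpace ℝ (Fin d) ×
    EuclideanSpace ℝ (Fin d) => ouKernel z.1 z.2.1 z.2.2 := by
  unfold ouKernel
  refine Measurable.mul ?_ ?_
  · refine Measurable.const_div (Measurable.pow_const ?_ _) _
    fun_prop
  · refine Real.measurable_exp.comp (Measurable.div (Measurable.neg (Measurable.sub ?_ ?_)) ?_)
    · fun_prop
    · exact Measurable.mul (by fun_prop)
        (Measurable.inner (measurable_fst.comp measurable_snd) (measurable_snd.comp measurable_snd))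
    · fun_prop

attribute [irreducible] ouKernel

theorem measurable_ouKernel_comp {Ω : Type*} [MeasurableSpace Ω] {s : Ω → ℝ}
    {x y : Ω → EuclideanSpace ℝ (Fin d)} (hs : Measurable s) (hx : Measurable x)
    (hy : Measurable y) : Measurable fun ω => ouKernel (s ω) (x ω) (y ω) :=
  Measurable.comp (g := fun z : ℝ × EuclideanSpace ℝ (Fin d) × EuclideanSpace ℝ (Fin d) =>
    ouKernel z.1 z.2.1 z.2.2) measurable_ouKernel (hs.prodMk (hx.prodMk hy))

/-- The quadratic form governing `e^{-a|x|²} M_s(x,y) e^{a|y|²}` dominates that of a heat kernel. -/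
theorem quadratic_form_bound {V : Type*} [NormedAddCommGroup V] [InnerProductSpace ℝ V]
    {r a : ℝ} (hr0 : 0 < r) (hr1 : r < 1) (ha0 : 0 < a) (ha1 : a < 1) (x y : V) :
    a * (1 - a) * ‖x - y‖ ^ 2 ≤ r ^ 2 * (‖x‖ ^ 2 + ‖y‖ ^ 2) - 2 * r * inner ℝ x y
      + (1 - r ^ 2) * (‖y‖ ^ 2 + a * ‖x‖ ^ 2 - a * ‖y‖ ^ 2) := by
  set c := a * (1 - a) with hc
  -- `A₂ = (1-a)² + r²a` is the coefficient of `‖y‖²` in the difference of the two sides.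
  -- Multiplying by it and completing the square in `y` leaves a nonnegative multiple of `‖x‖²`.
  set A₂ := 1 - (1 - r ^ 2) * a - c with hA₂
  have hr2 : r ^ 2 < 1 := by nlinarith
  have hA₂0 : 0 < A₂ := by
    have h : 0 < (1 - a) ^ 2 := by have : 0 < 1 - a := by linarith
                                   positivity
    have : 0 < r ^ 2 * a := by positivity
    nlinarith
  have hc0 : 0 ≤ c := mul_nonneg ha0.le (by linarith)
  have h1 : ‖A₂ • y - (r - c) • x‖ ^ 2
      = A₂ ^ 2 * ‖y‖ ^ 2 - 2 * A₂ * (r - c) * inner ℝ x y + (r - c) ^ 2 * ‖x‖ ^ 2 := by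
    rw [norm_sub_sq_real, norm_smul, norm_smul, inner_smul_left, inner_smul_right, mul_pow, mul_pow,
      Real.norm_eq_abs, Real.norm_eq_abs, sq_abs, sq_abs, real_inner_comm]
    simp; ring
  have h2 : ‖x - y‖ ^ 2 = ‖x‖ ^ 2 - 2 * inner ℝ x y + ‖y‖ ^ 2 := norm_sub_sq_real x y
  have h3 : 0 ≤ ‖A₂ • y - (r - c) • x‖ ^ 2
      + (1 - r) ^ 2 * c * ((1 + r) ^ 2 - 1) * ‖x‖ ^ 2 := by
    have : 0 ≤ (1 + r) ^ 2 - 1 := by nlinarith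
    positivity
  have h4 : A₂ * (r ^ 2 * (‖x‖ ^ 2 + ‖y‖ ^ 2) - 2 * r * inner ℝ x y
      + (1 - r ^ 2) * (‖y‖ ^ 2 + a * ‖x‖ ^ 2 - a * ‖y‖ ^ 2) - c * ‖x - y‖ ^ 2)
      = ‖A₂ • y - (r - c) • x‖ ^ 2 + (1 - r) ^ 2 * c * ((1 + r) ^ 2 - 1) * ‖x‖ ^ 2 := by
    rw [h1, h2, hA₂, hc]; ring
  have h5 : 0 ≤ r ^ 2 * (‖x‖ ^ 2 + ‖y‖ ^ 2) - 2 * r * inner ℝ x y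
      + (1 - r ^ 2) * (‖y‖ ^ 2 + a * ‖x‖ ^ 2 - a * ‖y‖ ^ 2) - c * ‖x - y‖ ^ 2 :=
    nonneg_of_mul_nonneg_right (h4 ▸ h3) hA₂0
  linarith

/-- This is conjugation by `e^{a|x|²}`: the quadratic form bound, divided by `1 - e^{-2s}`, becomes
a heat kernel of parameter `a(1-a)/(1 - e^{-2s})`. The power of `a(1-a)` corrects its normalization,
independently of `s`. -/
theorem ouKernel_mul_gaussDensity_le {s a : ℝ} (hs : 0 < s) (ha0 : 0 < a) (ha1 : a < 1)
    (x y : EuclideanSpace ℝ (Fin d)) :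
    gaussDensity d y * ouKernel s x y ≤
      Real.exp (a * ‖x‖ ^ 2) * (a * (1 - a)) ^ (-((d : ℝ) / 2)) *
      (((a * (1 - a) / (1 - Real.exp (-2 * s))) / Real.pi) ^ ((d : ℝ) / 2) *
        Real.exp (-(a * (1 - a) / (1 - Real.exp (-2 * s))) * ‖x - y‖ ^ 2)) *
      Real.exp (-a * ‖y‖ ^ 2) := by
  have hτ := one_sub_exp_pos hs
  have hq := quadratic_form_bound (r := Real.exp (-s)) (Real.exp_pos _)
    (Real.exp_lt_one_iff.2 (by linarith)) ha0 ha1 x y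
  unfold gaussDensity ouKernel
  rw [exp_neg_two_mul] at hτ ⊢
  set r := Real.exp (-s)
  set τ := 1 - r ^ 2 with hτd
  set c := a * (1 - a) with hc
  have hc0 : 0 < c := mul_pos ha0 (by linarith)
  have hpre : c ^ (-((d : ℝ) / 2)) * (c / τ / Real.pi) ^ ((d : ℝ) / 2)
      = 1 / Real.pi ^ ((d : ℝ) / 2) * (1 / τ ^ ((d : ℝ) / 2)) := by
    rw [Real.rpow_neg hc0.le, Real.div_rpow (by positivity) Real.pi_pos.le,
      Real.div_rpow hc0.le hτ.le]
    have : c ^ ((d : ℝ) / 2) ≠ 0 := by positivity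
    field_simp
  have hexp : Real.exp (-‖y‖ ^ 2) *
      Real.exp (-(r ^ 2 * (‖x‖ ^ 2 + ‖y‖ ^ 2) - 2 * r * inner ℝ x y) / τ) ≤
      Real.exp (a * ‖x‖ ^ 2) * Real.exp (-(c / τ) * ‖x - y‖ ^ 2) * Real.exp (-a * ‖y‖ ^ 2) := by
    rw [← Real.exp_add, ← Real.exp_add, ← Real.exp_add]
    refine Real.exp_le_exp.2 ?_
    have e : a * ‖x‖ ^ 2 + -(c / τ) * ‖x - y‖ ^ 2 + -a * ‖y‖ ^ 2 -
      (-‖y‖ ^ 2 + -(r ^ 2 * (‖x‖ ^ 2 + ‖y‖ ^ 2) - 2 * r * inner ℝ x y) / τ) =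
      (r ^ 2 * (‖x‖ ^ 2 + ‖y‖ ^ 2) - 2 * r * inner ℝ x y
      + τ * (‖y‖ ^ 2 + a * ‖x‖ ^ 2 - a * ‖y‖ ^ 2) - c * ‖x - y‖ ^ 2) / τ := by
      field_simp; ring
    rw [← sub_nonneg, e]
    exact div_nonneg (by linarith) hτ.le
  calc _ = (1 / Real.pi ^ ((d : ℝ) / 2) * (1 / τ ^ ((d : ℝ) / 2))) * (Real.exp (-‖y‖ ^ 2) *
      Real.exp (-(r ^ 2 * (‖x‖ ^ 2 + ‖y‖ ^ 2) - 2 * r * inner ℝ x y) / τ)) := by ring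
    _ ≤ (1 / Real.pi ^ ((d : ℝ) / 2) * (1 / τ ^ ((d : ℝ) / 2))) * (Real.exp (a * ‖x‖ ^ 2) *
        Real.exp (-(c / τ) * ‖x - y‖ ^ 2) * Real.exp (-a * ‖y‖ ^ 2)) := by gcongr
    _ = _ := by rw [← hpre]; ring

/-- The action of `T_s` on nonnegative functions. -/
def ouLintegral (s : ℝ) (f : EuclideanSpace ℝ (Fin d) → ℝ≥0∞) (x : EuclideanSpace ℝ (Fin d)) :
    ℝ≥0∞ := ∫⁻ y, ENNReal.ofReal (ouKernel s x y) * f y ∂(gammaD d)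

theorem ouLintegral_le_heat {s a : ℝ} (hs : 0 < s) (ha0 : 0 < a) (ha1 : a < 1)
    {f : EuclideanSpace ℝ (Fin d) → ℝ≥0∞} (x : EuclideanSpace ℝ (Fin d)) :
    ouLintegral s f x ≤
      ENNReal.ofReal (Real.exp (a * ‖x‖ ^ 2) * (a * (1 - a)) ^ (-((d : ℝ) / 2))) *
      ∫⁻ y, heatDensity (a * (1 - a) / (1 - Real.exp (-2 * s))) x y *
        (ENNReal.ofReal (Real.exp (-a * ‖y‖ ^ 2)) * f y) := by
  have hc0 : 0 < a * (1 - a) := mul_pos ha0 (by linarith)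
  have hτ := one_sub_exp_pos hs
  unfold ouLintegral
  rw [lintegral_gammaD, ← lintegral_const_mul' _ _ ENNReal.ofReal_ne_top]
  refine lintegral_mono fun y => ?_
  simp only [← mul_assoc]
  refine mul_le_mul' ?_ le_rfl
  unfold heatDensity
  rw [finrank_euclideanSpace, Fintype.card_fin,
    ← ENNReal.ofReal_mul (gaussDensity_pos y).le, ← ENNReal.ofReal_mul (by positivity),
    ← ENNReal.ofReal_mul (by positivity)]
  exact ENNReal.ofReal_le_ofReal (ouKernel_mul_gaussDensity_le hs ha0 ha1 x y)

/-- With `n = ‖x‖²` this says that `(e^{‖x‖²/p_∞})^{p(x)}` equals `e^{‖x‖²}` up to the factors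
`e^{±C₁}`. It is the reason for a decay rate of order `‖x‖^{-2}`. -/
theorem abs_exponent_le {p pinf C₁ n : ℝ} (hpinf : 1 ≤ pinf) (hn : 0 < n)
    (h : |p - pinf| ≤ C₁ / n) : |n - 1 / pinf * n * p| ≤ C₁ := by
  have h0 : 0 < pinf := by linarith
  have e : n - 1 / pinf * n * p = -(n / pinf * (p - pinf)) := by field_simp; ring
  rw [e, abs_neg, abs_mul, abs_of_pos (by positivity)]
  rw [le_div_iff₀ hn] at h
  calc n / pinf * |p - pinf| ≤ n * |p - pinf| := by
        gcongr; exact div_le_self hn.le hpinf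
    _ ≤ C₁ := by linarith

/-- The Ornstein-Uhlenbeck semigroup is uniformly bounded on `L^{p(·)}(γ_d)`. -/
theorem exists_luxNorm_ou_le (hd : 1 ≤ d) {p : EuclideanSpace ℝ (Fin d) → ℝ}
    (hp1 : ∀ x, 1 ≤ p x) (hpm : Measurable p) {C₀ C₁ pinf : ℝ} (hC₀ : 0 < C₀) (hC₁ : 0 < C₁)
    (hLH : ∀ x y, |p x - p y| ≤ C₀ / Real.log (Real.exp 1 + 1 / ‖x - y‖))
    (hinf : ∀ x, x ≠ 0 → |p x - pinf| ≤ C₁ / ‖x‖ ^ 2) (hpinf : 1 < pinf) :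
    ∃ C : ℝ≥0∞, C ≠ 0 ∧ C ≠ ∞ ∧ ∀ s, 0 < s → ∀ f : EuclideanSpace ℝ (Fin d) → ℝ≥0∞,
      Measurable f → luxNorm p (gammaD d) (ouLintegral s f) ≤ C * luxNorm p (gammaD d) f := by
  have : Nonempty (Fin d) := ⟨⟨0, hd⟩⟩
  have : Nontrivial (EuclideanSpace ℝ (Fin d)) := inferInstance
  have hne : ∀ᵐ x : EuclideanSpace ℝ (Fin d), x ≠ 0 := by simp [ae_iff]
  have hp1' : ∀ᵐ x : EuclideanSpace ℝ (Fin d), 1 ≤ p x := Eventually.of_forall hp1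
  -- With this `a`, the weight `e^{-a|x|²}` raised to the power `p(x)` reproduces the Gaussian
  -- density up to constants; `pinf > 1` gives `a < 1`, hence a nondegenerate heat kernel.
  set a := 1 / pinf with ha
  have ha0 : 0 < a := by positivity
  have ha1 : a < 1 := by rw [ha, div_lt_one (by linarith)]; exact hpinf
  have hc0 : 0 < a * (1 - a) := mul_pos ha0 (by linarith)
  set Γ : ℝ := Real.exp C₁ * Real.pi ^ ((d : ℝ) / 2) with hΓ
  have hΓ1 : 1 ≤ Γ := one_le_mul_of_one_le_of_one_le (Real.one_le_exp hC₁.le)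
    (Real.one_le_rpow (by linarith [Real.pi_gt_three]) (by positivity))
  set κ : ℝ := (a * (1 - a)) ^ (-((d : ℝ) / 2)) with hκ
  have hκ0 : 0 < κ := by positivity
  set H : ℝ≥0∞ := 2 * (d.factorial : ℝ≥0∞) with hH
  have hH0 : H ≠ 0 := by simp [hH, d.factorial_ne_zero]
  have hHt : H ≠ ∞ := ENNReal.mul_ne_top (by simp) (by simp)
  set B : ℝ≥0∞ := ENNReal.ofReal Γ with hB
  have hB1 : 1 ≤ B := by rw [hB, ← ENNReal.ofReal_one]; exact ENNReal.ofReal_le_ofReal hΓ1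
  have hB0 : B ≠ 0 := (zero_lt_one.trans_le hB1).ne'
  have hBt : B ≠ ∞ := ENNReal.ofReal_ne_top
  set A : ℝ≥0∞ := ENNReal.ofReal κ * B * (H * 2) with hA
  have hA0 : A ≠ 0 := by
    simp only [hA, ne_eq, mul_eq_zero, not_or]
    exact ⟨⟨by simpa using hκ0, hB0⟩, hH0, by simp⟩
  have hAt : A ≠ ∞ := ENNReal.mul_ne_top (ENNReal.mul_ne_top (by simp) hBt)
    (ENNReal.mul_ne_top hHt (by simp))
  set M : ℝ≥0∞ := ENNReal.ofReal (Real.exp (2 * C₁)) + 2 * ENNReal.ofReal (Real.pi ^ ((d : ℝ) / 2)) +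
        (ENNReal.ofReal (Real.exp (2 * d * C₀)) + 1) with hM
  have hMt : M ≠ ∞ := by
    simp only [hM, ne_eq, ENNReal.add_eq_top, not_or]
    exact ⟨⟨by simp, ENNReal.mul_ne_top (by simp) (by simp)⟩, by simp, by simp⟩
  set D : ℝ≥0∞ := ENNReal.ofReal (Real.exp C₁) * M with hD
  have hD1 : 1 ≤ D := by
    refine one_le_mul ?_ ?_
    · rw [← ENNReal.ofReal_one]; exact ENNReal.ofReal_le_ofReal (Real.one_le_exp hC₁.le)
    · exact le_add_self.trans le_add_self
  have hDt : D ≠ ∞ := ENNReal.mul_ne_top (by simp) hMt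
  refine ⟨A * D, mul_ne_zero hA0 (zero_lt_one.trans_le hD1).ne', ENNReal.mul_ne_top hAt hDt,
    fun s hs f hf => ?_⟩
  have hτ := one_sub_exp_pos hs
  refine luxNorm_le_of_modular_bound (Eventually.of_forall hp1) hA0 hAt hD1 hDt
    fun l hl hl' hmod => ?_
  set w : EuclideanSpace ℝ (Fin d) → ℝ≥0∞ :=
    fun y => ENNReal.ofReal (Real.exp (-a * ‖y‖ ^ 2)) with hw
  -- The weighted function, divided by `B` so as to lie in the unit ball of the Lebesgue modular.
  -- `B` collects the normalization `π^{d/2}` and the loss `e^{C₁}` from `abs_exponent_le`.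
  set F : EuclideanSpace ℝ (Fin d) → ℝ≥0∞ := fun y => w y * (f y / l) / B with hF
  have hFm : Measurable F := by fun_prop
  have hFmod : modular p volume F ≤ 1 := by
    refine (modular_div_le hp1' (F := fun y => w y * (f y / l)) hB1).trans
      (ENNReal.div_le_of_le_mul ?_)
    calc modular p volume (fun y => w y * (f y / l))
        ≤ ∫⁻ y, B * (ENNReal.ofReal (gaussDensity d y) * (f y / l) ^ p y) := by
          refine lintegral_mono_ae ?_
          filter_upwards [hne] with y hy
          rw [ENNReal.mul_rpow_of_nonneg _ _ (by linarith [hp1 y]), ← mul_assoc]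
          gcongr
          rw [hw, ENNReal.ofReal_rpow_of_pos (Real.exp_pos _), ← Real.exp_mul, hB,
            ← ENNReal.ofReal_mul (by positivity)]
          refine ENNReal.ofReal_le_ofReal ?_
          have e : Γ * gaussDensity d y = Real.exp (C₁ + -‖y‖ ^ 2) := by
            rw [hΓ, gaussDensity, Real.exp_add]; field_simp
          rw [e]
          refine Real.exp_le_exp.2 ?_
          have := (abs_le.1 (abs_exponent_le hpinf.le (by positivity : 0 < ‖y‖ ^ 2) (hinf y hy))).2
          rw [← ha] at this
          linarith
      _ = B * modular p (gammaD d) (fun x => f x / l) := by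
          rw [lintegral_const_mul' _ _ hBt, ← lintegral_gammaD]; rfl
      _ ≤ 1 * B := by rw [mul_comm]; gcongr
  have hheat := modular_heat_le hp1 hpm hC₀ hC₁ hLH hinf
    (b := a * (1 - a) / (1 - Real.exp (-2 * s))) (by positivity) hFm hFmod
  rw [finrank_euclideanSpace, Fintype.card_fin, ← hM, ← hH] at hheat
  set G : EuclideanSpace ℝ (Fin d) → ℝ≥0∞ := fun x =>
    (∫⁻ y, heatDensity (a * (1 - a) / (1 - Real.exp (-2 * s))) x y * F y) / H / 2 with hG
  have hle : ∀ x, ouLintegral s f x / l / A ≤ ENNReal.ofReal (Real.exp (a * ‖x‖ ^ 2)) * G x := by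
    intro x
    refine ENNReal.div_le_of_le_mul (ENNReal.div_le_of_le_mul ?_)
    refine (ouLintegral_le_heat hs ha0 ha1 x).trans (le_of_eq ?_)
    have e : ∫⁻ y, heatDensity (a * (1 - a) / (1 - Real.exp (-2 * s))) x y *
        (ENNReal.ofReal (Real.exp (-a * ‖y‖ ^ 2)) * f y)
        = (∫⁻ y, heatDensity (a * (1 - a) / (1 - Real.exp (-2 * s))) x y * F y) * (B * l) := by
      rw [← lintegral_mul_const' _ _ (ENNReal.mul_ne_top hBt hl')]
      refine lintegral_congr fun y => ?_
      have : F y * (B * l) = w y * f y := by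
        simp only [hF]
        rw [← mul_assoc, ENNReal.div_mul_cancel hB0 hBt, mul_assoc, ENNReal.div_mul_cancel hl hl']
      rw [mul_assoc, this]
    rw [e, ENNReal.ofReal_mul (by positivity), hA, hG]
    set I := ∫⁻ y, heatDensity (a * (1 - a) / (1 - Real.exp (-2 * s))) x y * F y
    have e2 : I / H / 2 * (H * 2) = I := by
      rw [mul_comm H, ← mul_assoc, ENNReal.div_mul_cancel (by simp) (by simp),
        ENNReal.div_mul_cancel hH0 hHt]
    calc _ = ENNReal.ofReal (Real.exp (a * ‖x‖ ^ 2)) * ENNReal.ofReal κ * (I * (B * l)) := rfl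
      _ = ENNReal.ofReal (Real.exp (a * ‖x‖ ^ 2)) * ENNReal.ofReal κ *
          ((I / H / 2 * (H * 2)) * (B * l)) := by rw [e2]
      _ = _ := by ring
  refine (modular_mono (Eventually.of_forall hp1) (Eventually.of_forall hle)).trans ?_
  unfold modular
  rw [lintegral_gammaD, hD]
  refine le_trans ?_ (mul_le_mul' le_rfl hheat)
  unfold modular
  rw [← lintegral_const_mul' _ _ ENNReal.ofReal_ne_top]
  -- Back to `γ_d`: the factor `e^{a|x|²}` to the power `p(x)` is cancelled by the Gaussian density,
  -- again up to `e^{C₁}`.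
  refine lintegral_mono_ae ?_
  filter_upwards [hne] with x hx
  rw [ENNReal.mul_rpow_of_nonneg _ _ (by linarith [hp1 x]), ← mul_assoc]
  gcongr
  rw [ENNReal.ofReal_rpow_of_pos (Real.exp_pos _), ← Real.exp_mul,
    ← ENNReal.ofReal_mul (gaussDensity_pos x).le]
  refine ENNReal.ofReal_le_ofReal ?_
  have h1 : gaussDensity d x ≤ Real.exp (-‖x‖ ^ 2) :=
    div_le_self (Real.exp_pos _).le (Real.one_le_rpow (by linarith [Real.pi_gt_three]) (by positivity))
  have := (abs_le.1 (abs_exponent_le hpinf.le (by positivity : 0 < ‖x‖ ^ 2) (hinf x hx))).1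
  rw [← ha] at this
  calc _ ≤ Real.exp (-‖x‖ ^ 2) * Real.exp (a * ‖x‖ ^ 2 * p x) := by gcongr
    _ = Real.exp (-‖x‖ ^ 2 + a * ‖x‖ ^ 2 * p x) := (Real.exp_add _ _).symm
    _ ≤ _ := Real.exp_le_exp.2 (by linarith)

/-- Exponents as in the theorem are measurable, and `T_s` is uniformly bounded on `L^{p(·)}(γ_d)`. -/
theorem isPGammaInfty_ouLintegral_bounded (hd : 1 ≤ d) {p : EuclideanSpace ℝ (Fin d) → ℝ} (hp : IsPGammaInfty p)
    (hpLH : IsLH0 p) (hp_inf : 1 < expInf p (gammaD d)) :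
    (∀ x, 1 ≤ p x) ∧ Measurable p ∧ ∃ C : ℝ≥0∞, C ≠ 0 ∧ C ≠ ∞ ∧
      ∀ s, 0 < s → ∀ f : EuclideanSpace ℝ (Fin d) → ℝ≥0∞, Measurable f →
        luxNorm p (gammaD d) (ouLintegral s f) ≤ C * luxNorm p (gammaD d) f := by
  have : Nonempty (Fin d) := ⟨⟨0, hd⟩⟩
  have : Nontrivial (EuclideanSpace ℝ (Fin d)) := inferInstance
  obtain ⟨⟨_, hp1⟩, C₁, pinf, hC₁, hpinf, hinf⟩ := hp
  obtain ⟨C₀, hC₀, hLH⟩ := hpLH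
  have hcont : Continuous p := by
    refine continuous_iff_continuousAt.2 fun x => ?_
    rw [ContinuousAt, tendsto_iff_dist_tendsto_zero]
    -- The point `y = x` is treated apart: there `1/0 = 0`, so the log-Hölder bound reads `C₀` and
    -- does not tend to 0.
    have h1 : Tendsto (fun y => ‖y - x‖) (𝓝[≠] x) (𝓝[>] 0) := by
      refine tendsto_nhdsWithin_iff.2 ⟨?_, ?_⟩
      · have : Continuous fun y => ‖y - x‖ := by fun_prop
        simpa using (this.tendsto x).mono_left nhdsWithin_le_nhds
      · filter_upwards [self_mem_nhdsWithin] with y hy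
        exact norm_pos_iff.2 (sub_ne_zero.2 hy)
    have h2 : Tendsto (fun u : ℝ => C₀ / Real.log (Real.exp 1 + 1 / u)) (𝓝[>] 0) (𝓝 0) := by
      refine Tendsto.div_atTop tendsto_const_nhds (Real.tendsto_log_atTop.comp ?_)
      refine tendsto_atTop_add_const_left _ _ ?_
      exact (tendsto_inv_nhdsGT_zero (𝕜 := ℝ)).congr fun u => (one_div u).symm
    have h3 : Tendsto (fun y => dist (p y) (p x)) (𝓝[≠] x) (𝓝 0) := by
      refine squeeze_zero (fun _ => dist_nonneg) (fun y => ?_) (h2.comp h1)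
      rw [Real.dist_eq]
      exact hLH y x
    have h4 : Tendsto (fun y => dist (p y) (p x)) (pure x) (𝓝 0) := by
      rw [tendsto_pure_left]
      intro s hs
      simpa using mem_of_mem_nhds hs
    rw [← pure_sup_nhdsNE]
    exact h4.sup h3
  refine ⟨hp1, hcont.measurable, exists_luxNorm_ou_le hd hp1 hcont.measurable hC₀ hC₁ hLH hinf ?_⟩
  -- `p_∞ > 1` follows from `p_- > 1`: the bound `p ≥ c > 1` holds almost everywhere, hence
  -- everywhere by continuity, hence in the limit `‖x‖ → ∞`.
  obtain ⟨c, hc1, hc2⟩ := exists_between hp_inf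
  have hae : ∀ᵐ x ∂(gammaD d), c < ENNReal.ofReal (p x) := ae_lt_of_lt_essInf hc2
  have hct : c ≠ ∞ := hc2.ne_top
  have hae' : ∀ᵐ x : EuclideanSpace ℝ (Fin d), c.toReal ≤ p x := by
    filter_upwards [absolutelyContinuous_gammaD.ae_le hae] with x hx
    rw [← ENNReal.ofReal_toReal hct] at hx
    exact (ENNReal.ofReal_lt_ofReal_iff (by linarith [hp1 x])).1 hx |>.le
  have hall : ∀ x, c.toReal ≤ p x := by
    have hcl : IsClosed {x | c.toReal ≤ p x} := isClosed_le continuous_const hcont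
    have hdense : Dense {x | c.toReal ≤ p x} := Measure.dense_of_ae hae'
    intro x
    exact (hcl.closure_eq ▸ hdense x : x ∈ {x | c.toReal ≤ p x})
  have hc1' : 1 < c.toReal := by
    rw [← ENNReal.toReal_one]; exact (ENNReal.toReal_lt_toReal (by simp) hct).2 hc1
  refine hc1'.trans_le (le_of_forall_pos_le_add fun ε hε => ?_)
  obtain ⟨x, hx⟩ := NormedSpace.exists_lt_norm ℝ (EuclideanSpace ℝ (Fin d)) (max 1 (C₁ / ε))
  have hx1 : 1 < ‖x‖ := (le_max_left _ _).trans_lt hx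
  have hx0 : x ≠ 0 := by rintro rfl; simp at hx1; linarith
  have h1 := (abs_le.1 (hinf x hx0)).2
  have h2 : C₁ / ‖x‖ ^ 2 ≤ ε := by
    rw [div_le_iff₀ (by positivity)]
    have h3 : C₁ / ε < ‖x‖ := (le_max_right _ _).trans_lt hx
    rw [div_lt_iff₀ hε] at h3
    nlinarith
  linarith [hall x]

end OU

/-! ### Hardy operators on `L^{q(·)}(dt/t)` -/

section Hardy

theorem lintegral_haarPos (f : ℝ → ℝ≥0∞) :
    ∫⁻ t, f t ∂haarPos = ∫⁻ t in Ioi 0, ENNReal.ofReal (1 / t) * f t := by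
  unfold haarPos
  exact lintegral_withDensity_eq_lintegral_mul_non_measurable _
    (by fun_prop) (Eventually.of_forall fun _ => ENNReal.ofReal_lt_top) _

theorem ae_haarPos_pos : ∀ᵐ t ∂haarPos, 0 < t :=
  (withDensity_absolutelyContinuous _ _).ae_le (ae_restrict_mem measurableSet_Ioi)

instance : SFinite haarPos := by unfold haarPos; infer_instance

/-- The kernel `min (t/s) (s/t) ^ δ`. -/
def hardyKernel (δ t s : ℝ) : ℝ≥0∞ := ENNReal.ofReal (min (t / s) (s / t) ^ δ)

theorem hardyKernel_comm (δ t s : ℝ) : hardyKernel δ t s = hardyKernel δ s t := by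
  unfold hardyKernel; rw [min_comm]

theorem measurable_hardyKernel (δ : ℝ) : Measurable (Function.uncurry (hardyKernel δ)) := by
  unfold hardyKernel Function.uncurry
  fun_prop

theorem hardyKernel_le_one {δ t s : ℝ} (hδ : 0 < δ) (ht : 0 < t) (hs : 0 < s) :
    hardyKernel δ t s ≤ 1 := by
  unfold hardyKernel
  rw [← ENNReal.ofReal_one]
  refine ENNReal.ofReal_le_ofReal (Real.rpow_le_one (by positivity) ?_ hδ.le)
  rcases le_total t s with h | h
  · exact (min_le_left _ _).trans ((div_le_one hs).2 h)
  · exact (min_le_right _ _).trans ((div_le_one ht).2 h)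

theorem lintegral_Ioc_rpow {δ t : ℝ} (hδ : 0 < δ) (ht : 0 < t) :
    ∫⁻ s in Ioc 0 t, ENNReal.ofReal (s ^ (δ - 1)) = ENNReal.ofReal (t ^ δ / δ) := by
  have hi : IntegrableOn (fun s : ℝ => s ^ (δ - 1)) (Ioc 0 t) := by
    rw [← intervalIntegrable_iff_integrableOn_Ioc_of_le ht.le]
    exact intervalIntegral.intervalIntegrable_rpow' (by linarith)
  rw [← ofReal_integral_eq_lintegral_ofReal hi]
  · rw [← intervalIntegral.integral_of_le ht.le, integral_rpow (Or.inl (by linarith))]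
    simp [hδ.ne']
  · filter_upwards [ae_restrict_mem measurableSet_Ioc] with s hs
    exact Real.rpow_nonneg hs.1.le _

theorem lintegral_Ioi_rpow {δ t : ℝ} (hδ : 0 < δ) (ht : 0 < t) :
    ∫⁻ s in Ioi t, ENNReal.ofReal (s ^ (-δ - 1)) = ENNReal.ofReal (t ^ (-δ) / δ) := by
  have hi : IntegrableOn (fun s : ℝ => s ^ (-δ - 1)) (Ioi t) :=
    integrableOn_Ioi_rpow_of_lt (by linarith) ht
  rw [← ofReal_integral_eq_lintegral_ofReal hi]
  · rw [integral_Ioi_rpow_of_lt (by linarith) ht]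
    congr 1
    simp [neg_div_neg_eq]
  · filter_upwards [ae_restrict_mem measurableSet_Ioi] with s hs
    exact Real.rpow_nonneg (ht.trans hs).le _

/-- Each side of `s = t` contributes `1/δ`. As the kernel is symmetric, division by a constant makes
it bi-substochastic. -/
theorem lintegral_hardyKernel {δ t : ℝ} (hδ : 0 < δ) (ht : 0 < t) :
    ∫⁻ s, hardyKernel δ t s ∂haarPos = ENNReal.ofReal (2 / δ) := by
  rw [lintegral_haarPos, ← Ioc_union_Ioi_eq_Ioi ht.le,
    lintegral_union measurableSet_Ioi (Ioc_disjoint_Ioi le_rfl)]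
  have h1 : ∫⁻ s in Ioc 0 t, ENNReal.ofReal (1 / s) * hardyKernel δ t s
      = ENNReal.ofReal (1 / δ) := by
    have : ∫⁻ s in Ioc 0 t, ENNReal.ofReal (1 / s) * hardyKernel δ t s
        = ∫⁻ s in Ioc 0 t, ENNReal.ofReal (t ^ (-δ)) * ENNReal.ofReal (s ^ (δ - 1)) := by
      refine setLIntegral_congr_fun measurableSet_Ioc fun s hs => ?_
      have hs0 : 0 < s := hs.1
      have hmin : min (t / s) (s / t) = s / t :=
        min_eq_right (((div_le_one ht).2 hs.2).trans ((one_le_div hs0).2 hs.2))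
      simp only [hardyKernel, hmin]
      rw [← ENNReal.ofReal_mul (by positivity), ← ENNReal.ofReal_mul (by positivity),
        Real.div_rpow hs0.le ht.le, Real.rpow_sub_one hs0.ne', Real.rpow_neg ht.le]
      congr 1; field_simp
    rw [this, lintegral_const_mul' _ _ ENNReal.ofReal_ne_top, lintegral_Ioc_rpow hδ ht,
      ← ENNReal.ofReal_mul (by positivity), Real.rpow_neg ht.le]
    congr 1
    have : t ^ δ ≠ 0 := by positivity
    field_simp
  have h2 : ∫⁻ s in Ioi t, ENNReal.ofReal (1 / s) * hardyKernel δ t s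
      = ENNReal.ofReal (1 / δ) := by
    have : ∫⁻ s in Ioi t, ENNReal.ofReal (1 / s) * hardyKernel δ t s
        = ∫⁻ s in Ioi t, ENNReal.ofReal (t ^ δ) * ENNReal.ofReal (s ^ (-δ - 1)) := by
      refine setLIntegral_congr_fun measurableSet_Ioi fun s hs => ?_
      have hs0 : 0 < s := ht.trans hs
      have hmin : min (t / s) (s / t) = t / s :=
        min_eq_left (((div_le_one hs0).2 (le_of_lt hs)).trans ((one_le_div ht).2 (le_of_lt hs)))
      simp only [hardyKernel, hmin]
      rw [← ENNReal.ofReal_mul (by positivity), ← ENNReal.ofReal_mul (by positivity),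
        Real.div_rpow ht.le hs0.le, Real.rpow_sub_one hs0.ne', Real.rpow_neg hs0.le]
      congr 1; field_simp
    rw [this, lintegral_const_mul' _ _ ENNReal.ofReal_ne_top, lintegral_Ioi_rpow hδ ht,
      ← ENNReal.ofReal_mul (by positivity), Real.rpow_neg ht.le]
    congr 1
    have : t ^ δ ≠ 0 := by positivity
    field_simp
  rw [h1, h2, ← ENNReal.ofReal_add (by positivity) (by positivity)]
  congr 1; ring

/-- Pairs of points on opposite sides of `[1/2,2]`. -/
def oppositeSides : Set (ℝ × ℝ) :=
  {z | (z.1 ≤ 1 / 2 ∧ 2 < z.2) ∨ (z.2 ≤ 1 / 2 ∧ 2 < z.1)}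

theorem measurableSet_oppositeSides : MeasurableSet oppositeSides := by
  unfold oppositeSides
  refine MeasurableSet.union (MeasurableSet.inter ?_ ?_) (MeasurableSet.inter ?_ ?_)
  · exact measurableSet_le measurable_fst measurable_const
  · exact measurableSet_lt measurable_const measurable_snd
  · exact measurableSet_le measurable_snd measurable_const
  · exact measurableSet_lt measurable_const measurable_fst

/-- The exponents near 0 and near infinity need not be close, so no comparison is possible between
them. There the kernel pays instead: `min(t/s,s/t)` factors through the point 1 into a product that
is integrable in `t` and `s` separately. -/
theorem hardyKernel_mul_indicator_le {δ t s : ℝ} (ht : 0 < t) (hs : 0 < s) :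
    hardyKernel δ t s * oppositeSides.indicator 1 (t, s)
      ≤ hardyKernel δ 1 t * hardyKernel δ 1 s := by
  by_cases h : (t, s) ∈ oppositeSides
  · rw [indicator_of_mem h, Pi.one_apply, mul_one]
    unfold hardyKernel
    rw [← ENNReal.ofReal_mul (by positivity), ← Real.mul_rpow (by positivity) (by positivity)]
    refine (congrArg (fun u => ENNReal.ofReal (u ^ δ)) ?_).le
    have key : ∀ u v : ℝ, 0 < u → u ≤ 1 / 2 → 2 < v →
        min (u / v) (v / u) = min (1 / u) (u / 1) * min (1 / v) (v / 1) := by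
      intro u v hu hu2 hv
      have hv0 : 0 < v := by linarith
      rw [min_eq_left, min_eq_right, min_eq_left]
      · ring
      · rw [div_one, div_le_iff₀ hv0]; nlinarith
      · rw [div_one, le_div_iff₀ hu]; nlinarith
      · rw [div_le_div_iff₀ hv0 hu]; nlinarith
    rcases h with ⟨h1, h2⟩ | ⟨h1, h2⟩
    · exact key t s ht h1 h2
    · rw [min_comm, mul_comm]; exact key s t hs h1 h2
  · rw [indicator_of_notMem h, mul_zero]; exact zero_le

theorem hardyKernel_one_one {t : ℝ} : hardyKernel 1 1 t = ENNReal.ofReal (min (1 / t) t) := by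
  unfold hardyKernel; simp

theorem abs_log_mul_le {q₁ q₂ q₀ A l₁ l₂ : ℝ} (hl₁ : 0 < l₁) (hl₂ : 0 < l₂)
    (h₁ : |q₁ - q₀| ≤ A / l₁) (h₂ : |q₂ - q₀| ≤ A / l₂) : |q₁ - q₂| * min l₁ l₂ ≤ 2 * A := by
  rw [le_div_iff₀ hl₁] at h₁
  rw [le_div_iff₀ hl₂] at h₂
  calc |q₁ - q₂| * min l₁ l₂ ≤ (|q₁ - q₀| + |q₂ - q₀|) * min l₁ l₂ := by
        gcongr
        have := abs_sub_le q₁ q₀ q₂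
        rwa [abs_sub_comm q₀ q₂] at this
    _ ≤ |q₁ - q₀| * l₁ + |q₂ - q₀| * l₂ := by
        rw [add_mul]
        gcongr
        · exact min_le_left _ _
        · exact min_le_right _ _
    _ ≤ 2 * A := by linarith

/-- If `t` and `s` are both small or both large, the logarithmic condition at 0 or infinity is used
with `w` the smaller of the two logarithms, and `e^{-w}` is a multiple of the integrable
`min(v,1/v)` at `t` or `s`. In all other cases the error term is at least 1. -/
theorem exists_rpow_le_of_isPZeroInfty {q : ℝ → ℝ} (hq : IsPZeroInfty q) :
    ∃ C : ℝ≥0∞, C ≠ ∞ ∧ ∀ u : ℝ≥0∞, u ≤ 1 → ∀ t s, 0 < t → 0 < s → 1 ≤ q t →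
      u ^ q t ≤ C * u ^ q s
        + (2 * hardyKernel 1 1 t + 2 * hardyKernel 1 1 s + oppositeSides.indicator 1 (t, s)) := by
  obtain ⟨q0, A, -, h0⟩ := hq.at_zero
  obtain ⟨qi, B, -, hi⟩ := hq.at_infty
  set M := max (2 * A) (max (2 * B) 0) with hM
  have hM0 : 0 ≤ M := (le_max_right _ _).trans (le_max_right _ _)
  refine ⟨ENNReal.ofReal (Real.exp M), ENNReal.ofReal_ne_top, fun u hu t s ht hs hqt => ?_⟩
  have hle1 : u ^ q t ≤ 1 := ENNReal.rpow_le_one hu (by linarith)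
  have mid : ∀ v : ℝ, 1 / 2 < v → v ≤ 2 → 1 ≤ 2 * hardyKernel 1 1 v := by
    intro v h1 h2
    have hv : 0 < v := by linarith
    have : (1 / 2 : ℝ) ≤ min (1 / v) v := le_min (by
      rw [div_le_div_iff₀ (by norm_num) hv]; linarith) h1.le
    rw [hardyKernel_one_one]
    calc (1 : ℝ≥0∞) = 2 * ENNReal.ofReal (1 / 2) := by
          rw [← ENNReal.ofReal_ofNat, ← ENNReal.ofReal_mul (by norm_num)]; norm_num
      _ ≤ _ := by gcongr
  rcases le_or_gt t (1 / 2) with h1 | h1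
  · rcases le_or_gt s (1 / 2) with h2 | h2
    · have l1 : 0 < Real.log (1 / t) := Real.log_pos (by rw [lt_div_iff₀ ht]; linarith)
      have l2 : 0 < Real.log (1 / s) := Real.log_pos (by rw [lt_div_iff₀ hs]; linarith)
      refine (rpow_le_mul_rpow_add_exp hu hqt
        ((abs_log_mul_le l1 l2 (h0 t ht h1) (h0 s hs h2)).trans (le_max_left _ _)) hM0).trans ?_
      gcongr
      refine le_trans ?_ le_self_add
      have key : ∀ v : ℝ, 0 < v → v ≤ 1 / 2 →
          ENNReal.ofReal (Real.exp (-Real.log (1 / v))) ≤ 2 * hardyKernel 1 1 v := by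
        intro v hv hv2
        rw [hardyKernel_one_one, min_eq_right (by rw [le_div_iff₀ hv]; nlinarith), one_div,
          Real.log_inv, neg_neg, Real.exp_log hv]
        exact le_mul_of_one_le_left' (by norm_num)
      rcases min_choice (Real.log (1 / t)) (Real.log (1 / s)) with h | h <;> rw [h]
      · exact (key t ht h1).trans le_self_add
      · exact (key s hs h2).trans le_add_self
    · rcases le_or_gt s 2 with h3 | h3
      · exact hle1.trans ((mid s h2 h3).trans (le_add_self.trans (le_self_add.trans le_add_self)))
      · have : (t, s) ∈ oppositeSides := Or.inl ⟨h1, h3⟩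
        rw [indicator_of_mem this]
        exact hle1.trans (le_add_self.trans le_add_self)
  · rcases le_or_gt t 2 with h2 | h2
    · exact hle1.trans ((mid t h1 h2).trans (le_self_add.trans (le_self_add.trans le_add_self)))
    · rcases le_or_gt s (1 / 2) with h3 | h3
      · have : (t, s) ∈ oppositeSides := Or.inr ⟨h3, h2⟩
        rw [indicator_of_mem this]
        exact hle1.trans (le_add_self.trans le_add_self)
      · rcases le_or_gt s 2 with h4 | h4
        · exact hle1.trans
            ((mid s h3 h4).trans (le_add_self.trans (le_self_add.trans le_add_self)))
        · have l1 : 0 < Real.log t := Real.log_pos (by linarith)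
          have l2 : 0 < Real.log s := Real.log_pos (by linarith)
          refine (rpow_le_mul_rpow_add_exp hu hqt
            ((abs_log_mul_le l1 l2 (hi t h2) (hi s h4)).trans
              ((le_max_left _ _).trans (le_max_right _ _))) hM0).trans ?_
          gcongr
          refine le_trans ?_ le_self_add
          have key : ∀ v : ℝ, 2 < v →
              ENNReal.ofReal (Real.exp (-Real.log v)) ≤ 2 * hardyKernel 1 1 v := by
            intro v hv2
            have hv : 0 < v := by linarith
            rw [hardyKernel_one_one, min_eq_left (by rw [div_le_iff₀ hv]; nlinarith), one_div,
              Real.exp_neg, Real.exp_log hv]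
            exact le_mul_of_one_le_left' (by norm_num)
          rcases min_choice (Real.log t) (Real.log s) with h | h <;> rw [h]
          · exact (key t h2).trans le_self_add
          · exact (key s h4).trans le_add_self

theorem ae_one_le_of_isPZeroInfty {q : ℝ → ℝ} (hq : IsPZeroInfty q) :
    ∀ᵐ t ∂haarPos, 1 ≤ q t := by
  have h : ∀ᵐ t ∂haarPos, expInf q haarPos ≤ ENNReal.ofReal (q t) := ae_essInf_le
  filter_upwards [h] with t ht
  have := hq.one_le_inf.trans ht
  rwa [ENNReal.one_le_ofReal] at this

/-- Boundedness of the Hardy operators on `L^{q(·)}(dt/t)`. -/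
theorem exists_luxNorm_hardy_le {q : ℝ → ℝ} (hq : IsPZeroInfty q) {δ : ℝ} (hδ : 0 < δ) :
    ∃ C : ℝ≥0∞, C ≠ 0 ∧ C ≠ ∞ ∧ ∀ F : ℝ → ℝ≥0∞, Measurable F →
      luxNorm q haarPos (fun t => ∫⁻ s, hardyKernel δ t s * F s ∂haarPos)
        ≤ C * luxNorm q haarPos F := by
  have hq1 := ae_one_le_of_isPZeroInfty hq
  obtain ⟨C, hCt, hC⟩ := exists_rpow_le_of_isPZeroInfty hq
  set R : ℝ≥0∞ := ENNReal.ofReal (2 / δ) with hR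
  -- The added 1 ensures `N ≥ 1`, so that normalizing the rows also gives `K ≤ hardyKernel`.
  set N : ℝ≥0∞ := R + 1 with hN
  have hRt : R ≠ ∞ := ENNReal.ofReal_ne_top
  have hN1 : 1 ≤ N := le_add_self
  have hN0 : N ≠ 0 := (zero_lt_one.trans_le hN1).ne'
  have hNt : N ≠ ∞ := by simp [hN, hRt]
  set K : ℝ → ℝ → ℝ≥0∞ := fun t s => hardyKernel δ t s / N with hK
  have hKm : Measurable (Function.uncurry K) := (measurable_hardyKernel δ).div_const N
  have hKle : ∀ t s, K t s ≤ hardyKernel δ t s := fun t s =>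
    ENNReal.div_le_of_le_mul (le_mul_of_one_le_right' hN1)
  have hmt : ∀ t, Measurable (hardyKernel δ t) := fun t =>
    (measurable_hardyKernel δ).of_uncurry_left
  have hrow : ∀ t, 0 < t → ∫⁻ s, K t s ∂haarPos ≤ 1 := by
    intro t ht
    simp only [hK, div_eq_mul_inv]
    rw [lintegral_mul_const _ (hmt t), lintegral_hardyKernel hδ ht, ← div_eq_mul_inv]
    exact ENNReal.div_le_of_le_mul (by rw [one_mul]; exact le_self_add)
  have hKcomm : ∀ t s, K t s = K s t := fun t s => by simp only [hK, hardyKernel_comm]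
  have hrow' : ∀ᵐ t ∂haarPos, ∫⁻ s, K t s ∂haarPos ≤ 1 := by
    filter_upwards [ae_haarPos_pos] with t ht using hrow t ht
  have hcol' : ∀ᵐ s ∂haarPos, ∫⁻ t, K t s ∂haarPos ≤ 1 := by
    filter_upwards [ae_haarPos_pos] with s hs
    simp_rw [hKcomm _ s]
    exact hrow s hs
  set err : ℝ → ℝ → ℝ≥0∞ := fun t s =>
    2 * hardyKernel 1 1 t + 2 * hardyKernel 1 1 s + oppositeSides.indicator 1 (t, s) with herr
  have hom : Measurable (hardyKernel 1 1) := (measurable_hardyKernel 1).of_uncurry_left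
  have hopm : Measurable (Function.uncurry fun t s : ℝ =>
      oppositeSides.indicator (1 : ℝ × ℝ → ℝ≥0∞) (t, s)) :=
    (measurable_one.indicator measurableSet_oppositeSides)
  have herrm : Measurable (Function.uncurry err) := by
    refine Measurable.add (Measurable.add ?_ ?_) hopm
    · exact (hom.comp measurable_fst).const_mul 2
    · exact (hom.comp measurable_snd).const_mul 2
  have hI1 : ∫⁻ t, hardyKernel 1 1 t ∂haarPos = 2 := by
    rw [lintegral_hardyKernel one_pos one_pos]; simp
  have hKe : ∫⁻ t, ∫⁻ s, K t s * err t s ∂haarPos ∂haarPos ≤ 8 + R * R := by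
    have hKt : ∀ t, Measurable (K t) := fun t => hKm.of_uncurry_left
    have e : ∀ t, ∫⁻ s, K t s * err t s ∂haarPos
        = (∫⁻ s, K t s * (2 * hardyKernel 1 1 t) ∂haarPos
          + ∫⁻ s, K t s * (2 * hardyKernel 1 1 s) ∂haarPos)
          + ∫⁻ s, K t s * oppositeSides.indicator 1 (t, s) ∂haarPos := by
      intro t
      have m1 : Measurable fun s => K t s * (2 * hardyKernel 1 1 t) := (hKt t).mul_const _
      have m2 : Measurable fun s => K t s * (2 * hardyKernel 1 1 s) :=
        (hKt t).mul (hom.const_mul 2)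
      have m12 : Measurable fun s =>
          K t s * (2 * hardyKernel 1 1 t) + K t s * (2 * hardyKernel 1 1 s) := m1.add m2
      rw [← lintegral_add_left m1, ← lintegral_add_left m12]
      simp only [herr, mul_add]
    have m1 : Measurable (Function.uncurry fun t s => K t s * (2 * hardyKernel 1 1 t)) :=
      hKm.mul ((hom.comp measurable_fst).const_mul 2)
    have m2 : Measurable (Function.uncurry fun t s => K t s * (2 * hardyKernel 1 1 s)) :=
      hKm.mul ((hom.comp measurable_snd).const_mul 2)
    simp_rw [e]
    have m12 : Measurable fun t => ∫⁻ s, K t s * (2 * hardyKernel 1 1 t) ∂haarPos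
        + ∫⁻ s, K t s * (2 * hardyKernel 1 1 s) ∂haarPos :=
      m1.lintegral_prod_right.add m2.lintegral_prod_right
    rw [lintegral_add_left m12,
      lintegral_add_left m1.lintegral_prod_right]
    have b1 : ∫⁻ t, ∫⁻ s, K t s * (2 * hardyKernel 1 1 t) ∂haarPos ∂haarPos ≤ 4 := by
      calc _ ≤ ∫⁻ t, 2 * hardyKernel 1 1 t ∂haarPos := by
            refine lintegral_mono_ae ?_
            filter_upwards [hrow'] with t ht
            rw [lintegral_mul_const _ (hKt t)]
            exact mul_le_of_le_one_left' ht
        _ = 4 := by rw [lintegral_const_mul _ hom, hI1]; norm_num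
    have b2 : ∫⁻ t, ∫⁻ s, K t s * (2 * hardyKernel 1 1 s) ∂haarPos ∂haarPos ≤ 4 := by
      rw [lintegral_lintegral_swap m2.aemeasurable]
      calc _ ≤ ∫⁻ t, 2 * hardyKernel 1 1 t ∂haarPos := by
            refine lintegral_mono_ae ?_
            filter_upwards [hcol'] with s hs
            rw [lintegral_mul_const _ hKm.of_uncurry_right]
            exact mul_le_of_le_one_left' hs
        _ = 4 := by rw [lintegral_const_mul _ hom, hI1]; norm_num
    have b3 : ∫⁻ t, ∫⁻ s, K t s * oppositeSides.indicator 1 (t, s) ∂haarPos ∂haarPos ≤ R * R := by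
      calc _ ≤ ∫⁻ t, ∫⁻ s, hardyKernel δ 1 t * hardyKernel δ 1 s ∂haarPos ∂haarPos := by
            refine lintegral_mono_ae ?_
            filter_upwards [ae_haarPos_pos] with t ht
            refine lintegral_mono_ae ?_
            filter_upwards [ae_haarPos_pos] with s hs
            exact (mul_le_mul' (hKle t s) le_rfl).trans (hardyKernel_mul_indicator_le ht hs)
        _ = R * R := by
            simp_rw [lintegral_const_mul _ (hmt 1)]
            rw [lintegral_mul_const _ (hmt 1), lintegral_hardyKernel hδ one_pos]
    calc _ ≤ (4 : ℝ≥0∞) + 4 + R * R := add_le_add (add_le_add b1 b2) b3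
      _ = _ := by norm_num
  set D : ℝ≥0∞ := C + (8 + R * R) + 1 with hD
  have hDt : D ≠ ∞ := by
    simp only [hD, ne_eq, ENNReal.add_eq_top, not_or]
    exact ⟨⟨hCt, by simp, ENNReal.mul_ne_top hRt hRt⟩, by simp⟩
  have hD1 : 1 ≤ D := le_add_self
  refine ⟨N * 2 * D, mul_ne_zero (mul_ne_zero hN0 (by simp)) (zero_lt_one.trans_le hD1).ne',
    ENNReal.mul_ne_top (ENNReal.mul_ne_top hNt (by simp)) hDt, fun F hF => ?_⟩
  refine luxNorm_le_of_modular_bound hq1 (mul_ne_zero hN0 (by simp))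
    (ENNReal.mul_ne_top hNt (by simp)) hD1 hDt fun l hl hl' hmod => ?_
  set G : ℝ → ℝ≥0∞ := fun s => F s / l with hG
  have hGm : Measurable G := hF.div_const l
  set S : Set ℝ := {s | G s ≤ 1} with hS
  have hSm : MeasurableSet S := measurableSet_le hGm measurable_const
  have hmod' : ∀ t : Set ℝ, modular q haarPos (t.indicator G) ≤ 1 := fun t =>
    (modular_mono hq1 (Eventually.of_forall fun y => indicator_le_self _ _ _)).trans hmod
  have hsmall : modular q haarPos (fun t => ∫⁻ s, K t s * S.indicator G s ∂haarPos)
      ≤ C + (8 + R * R) := by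
    refine (lintegral_rpow_kernel_le hq1 hq.measurable hKm herrm hrow' hcol'
      (hGm.indicator hSm) (C := C) ?_).trans
      (add_le_add (mul_le_of_le_one_right' (hmod' S)) hKe)
    filter_upwards [hq1, ae_haarPos_pos] with t ht1 ht
    filter_upwards [ae_haarPos_pos] with s hs
    refine hC _ ?_ t s ht hs ht1
    by_cases h : s ∈ S <;> simp [h]
    exact h
  -- Where the large part is nonzero it is at least 1, so its integral is at most its modular. With
  -- a kernel bounded by 1 the image is at most 1, and its powers are at most itself: no regularity
  -- of `q` enters here.
  have hlarge : modular q haarPos (fun t => ∫⁻ s, K t s * Sᶜ.indicator G s ∂haarPos) ≤ 1 := by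
    have hLm := hGm.indicator hSm.compl
    have hint : ∫⁻ s, Sᶜ.indicator G s ∂haarPos ≤ 1 := by
      refine le_trans (lintegral_mono_ae ?_) (hmod' Sᶜ)
      filter_upwards [hq1] with s hs
      have hor : Sᶜ.indicator G s = 0 ∨ 1 ≤ Sᶜ.indicator G s := by
        by_cases h : s ∈ S
        · simp [h]
        · simp only [mem_compl_iff, h, not_false_eq_true, indicator_of_mem]
          exact Or.inr (le_of_not_ge h)
      simpa using rpow_le_rpow_of_eq_zero_or hor zero_lt_one hs
    calc _ ≤ ∫⁻ t, ∫⁻ s, K t s * Sᶜ.indicator G s ∂haarPos ∂haarPos := by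
          refine lintegral_mono_ae ?_
          filter_upwards [hq1, ae_haarPos_pos] with t ht1 ht
          have hle : ∫⁻ s, K t s * Sᶜ.indicator G s ∂haarPos ≤ 1 := by
            refine le_trans (lintegral_mono_ae ?_) hint
            filter_upwards [ae_haarPos_pos] with s hs
            exact mul_le_of_le_one_left' ((hKle t s).trans (hardyKernel_le_one hδ ht hs))
          calc _ ≤ (∫⁻ s, K t s * Sᶜ.indicator G s ∂haarPos) ^ (1 : ℝ) :=
                ENNReal.rpow_le_rpow_of_exponent_ge hle ht1
            _ = _ := ENNReal.rpow_one _
      _ = ∫⁻ s, ∫⁻ t, K t s * Sᶜ.indicator G s ∂haarPos ∂haarPos :=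
          lintegral_lintegral_swap (hKm.mul (hLm.comp measurable_snd)).aemeasurable
      _ ≤ ∫⁻ s, Sᶜ.indicator G s ∂haarPos := by
          refine lintegral_mono_ae ?_
          filter_upwards [hcol'] with s hs
          rw [lintegral_mul_const _ hKm.of_uncurry_right]
          exact mul_le_of_le_one_left' hs
      _ ≤ 1 := hint
  refine le_trans ?_ (add_le_add hsmall hlarge)
  refine le_trans (modular_mono hq1 (Eventually.of_forall fun t => le_of_eq ?_))
    (modular_add_div_two_le hq1 hq.measurable (Measurable.lintegral_prod_right
        (hKm.mul ((hGm.indicator hSm).comp measurable_snd))).aemeasurable)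
  have hKt : Measurable (K t) := hKm.of_uncurry_left
  have m1 : Measurable fun s => K t s * S.indicator G s := hKt.mul (hGm.indicator hSm)
  rw [← lintegral_add_left m1]
  have e : ∀ s, K t s * S.indicator G s + K t s * Sᶜ.indicator G s
      = hardyKernel δ t s * F s * (l⁻¹ * N⁻¹) := fun s => by
    rw [← mul_add]
    have : S.indicator G s + Sᶜ.indicator G s = G s :=
      congrFun (indicator_self_add_compl S G) s
    rw [this]
    simp only [hK, hG, div_eq_mul_inv]; ring
  simp_rw [e]
  have m3 : Measurable fun s => hardyKernel δ t s * F s := (hmt t).mul hF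
  rw [lintegral_mul_const _ m3]
  simp only [div_eq_mul_inv]
  rw [ENNReal.mul_inv (Or.inl hN0) (Or.inl hNt)]
  ring

end Hardy

/-! ### The one-sided stable subordinator of order `1/2` -/

section Subordinator

open Polynomial

/-- The polynomials in `∂_v^k (v e^{-v²/4}) = p_k(v) e^{-v²/4}`. -/
def subPoly : ℕ → ℝ[X]
  | 0 => X
  | k + 1 => derivative (subPoly k) - C (1 / 2) * X * subPoly k

/-- `∂_t^k η_t(s)` for the density `η_t(s) = t (4π)^{-1/2} s^{-3/2} e^{-t²/4s}`. -/
def subDeriv (k : ℕ) (t s : ℝ) : ℝ :=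
  (√s)⁻¹ ^ (k + 2) *
    ((subPoly k).eval (t * (√s)⁻¹) * Real.exp (-(t * (√s)⁻¹) ^ 2 / 4)) / (2 * √Real.pi)

theorem subDeriv_zero (t s : ℝ) :
    subDeriv 0 t s = (√s)⁻¹ ^ 3 * t * Real.exp (-(t * (√s)⁻¹) ^ 2 / 4) / (2 * √Real.pi) := by
  simp only [subDeriv, subPoly, eval_X]; ring

/-- For `s ≤ 0` the square root and its inverse both take the value 0. The density is thus extended
by 0, and convolutions can be computed on the whole line. -/
theorem subDeriv_of_nonpos (k : ℕ) (t : ℝ) {s : ℝ} (hs : s ≤ 0) : subDeriv k t s = 0 := by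
  simp [subDeriv, Real.sqrt_eq_zero_of_nonpos hs]

theorem subDeriv_zero_nonneg {t : ℝ} (ht : 0 ≤ t) (s : ℝ) : 0 ≤ subDeriv 0 t s := by
  rw [subDeriv_zero]; positivity

theorem measurable_subDeriv (k : ℕ) : Measurable (Function.uncurry (subDeriv k)) := by
  unfold subDeriv Function.uncurry
  have h : Measurable fun v : ℝ => (subPoly k).eval v := (subPoly k).continuous.measurable
  have h2 : Measurable fun z : ℝ × ℝ => z.1 * (√z.2)⁻¹ := by fun_prop
  have h3 := h.comp h2
  simp only [Function.comp_def] at h3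
  fun_prop

theorem measurable_subDeriv_comp (k : ℕ) {Ω : Type*} [MeasurableSpace Ω] {t s : Ω → ℝ}
    (ht : Measurable t) (hs : Measurable s) : Measurable fun ω => subDeriv k (t ω) (s ω) :=
  Measurable.comp (g := Function.uncurry (subDeriv k)) (measurable_subDeriv k) (ht.prodMk hs)

theorem hasDerivAt_subDeriv (k : ℕ) (t s : ℝ) :
    HasDerivAt (fun t => subDeriv k t s) (subDeriv (k + 1) t s) t := by
  unfold subDeriv
  set σ := (√s)⁻¹
  have h1 : HasDerivAt (fun t : ℝ => t * σ) σ t := hasDerivAt_mul_const σ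
  have h2 := ((subPoly k).hasDerivAt (t * σ)).comp t h1
  have h3 : HasDerivAt (fun t : ℝ => -(t * σ) ^ 2 / 4) (-(2 * (t * σ) * σ) / 4) t := by
    have := ((h1.pow 2).neg).div_const 4
    simpa using this
  have h4 := ((h2.mul h3.exp).const_mul (σ ^ (k + 2))).div_const (2 * √Real.pi)
  refine h4.congr_deriv ?_
  simp only [subPoly, eval_sub, eval_mul, eval_C, eval_X, Function.comp]
  ring

/-- The number `3/16 = 1/4 - 1/16` is the gap between the exponents of `e^{-v²/4}` and
`e^{-(v/2)²/4}`: polynomial factors are absorbed by replacing `t` with `t/2` in the subordinator. -/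
theorem exists_abs_eval_le_exp (Q : ℝ[X]) :
    ∃ M : ℝ, 0 < M ∧ ∀ v : ℝ, |Q.eval v| ≤ M * Real.exp (3 * v ^ 2 / 16) := by
  induction Q using Polynomial.induction_on' with
  | add p q hp hq =>
    obtain ⟨M, hM, h⟩ := hp
    obtain ⟨M', hM', h'⟩ := hq
    refine ⟨M + M', by positivity, fun v => ?_⟩
    rw [eval_add, add_mul]
    exact (abs_add_le _ _).trans (add_le_add (h v) (h' v))
  | monomial n a =>
    refine ⟨(|a| + 1) * (n.factorial * Real.exp 2), by positivity, fun v => ?_⟩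
    rw [eval_monomial, abs_mul, abs_pow]
    have h1 : |v| ^ n ≤ n.factorial * Real.exp |v| := by
      have := Real.pow_div_factorial_le_exp |v| (abs_nonneg _) n
      rw [div_le_iff₀ (by positivity)] at this
      linarith
    have h2 : Real.exp |v| ≤ Real.exp 2 * Real.exp (3 * v ^ 2 / 16) := by
      rw [← Real.exp_add]
      refine Real.exp_le_exp.2 ?_
      -- The square gives `|v| ≤ 4/3 + 3v²/16`.
      nlinarith [sq_abs v, sq_nonneg (|v| - 8 / 3)]
    calc |a| * |v| ^ n ≤ (|a| + 1) * (n.factorial * (Real.exp 2 * Real.exp (3 * v ^ 2 / 16))) := by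
          gcongr
          · linarith
          · exact h1.trans (by gcongr)
      _ = _ := by ring

/-- The derivatives of the subordinator are dominated by the subordinator itself. -/
theorem exists_abs_subDeriv_le (k : ℕ) :
    ∃ M : ℝ, 0 < M ∧ ∀ t s, 0 < t → |subDeriv k t s| ≤ M * (t ^ k)⁻¹ * subDeriv 0 (t / 2) s := by
  -- The majorant `η_{t/2}` carries a factor `v = t/√s`. Multiplication by `t^k` provides it when `k
  -- ≥ 1`, and `subPoly 0 = X` provides it when `k = 0`.
  obtain ⟨Q, hQ⟩ : ∃ Q : ℝ[X], X ^ k * subPoly k = X * Q := by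
    cases k with
    | zero => exact ⟨1, by simp [subPoly]⟩
    | succ k => exact ⟨X ^ k * subPoly (k + 1), by ring⟩
  obtain ⟨M, hM, h⟩ := exists_abs_eval_le_exp Q
  refine ⟨2 * M, by positivity, fun t s ht => ?_⟩
  rw [subDeriv_zero]
  unfold subDeriv
  set σ := (√s)⁻¹ with hσ
  have hσ0 : 0 ≤ σ := by positivity
  have e1 : t ^ k * (σ ^ (k + 2) * (eval (t * σ) (subPoly k) * Real.exp (-(t * σ) ^ 2 / 4)))
      = σ ^ 2 * (t * σ) * (eval (t * σ) Q * Real.exp (-(t * σ) ^ 2 / 4)) := by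
    have := congrArg (eval (t * σ)) hQ
    simp only [eval_mul, eval_pow, eval_X] at this
    calc _ = σ ^ 2 * ((t * σ) ^ k * eval (t * σ) (subPoly k)) * Real.exp (-(t * σ) ^ 2 / 4) := by
          ring
      _ = _ := by rw [this]; ring
  have e2 : |eval (t * σ) Q * Real.exp (-(t * σ) ^ 2 / 4)|
      ≤ M * Real.exp (-(t / 2 * σ) ^ 2 / 4) := by
    rw [abs_mul, abs_of_pos (Real.exp_pos _)]
    calc _ ≤ M * Real.exp (3 * (t * σ) ^ 2 / 16) * Real.exp (-(t * σ) ^ 2 / 4) := by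
          gcongr; exact h _
      _ = _ := by rw [mul_assoc, ← Real.exp_add]; congr 2; ring
  have ht' : 0 < t ^ k := by positivity
  rw [abs_div, abs_of_pos (by positivity : 0 < 2 * √Real.pi), ← mul_div_assoc]
  gcongr
  rw [mul_comm (2 * M), mul_assoc, ← div_eq_inv_mul, le_div_iff₀ ht', mul_comm _ (t ^ k)]
  nth_rewrite 1 [← abs_of_pos ht']
  rw [← abs_mul, e1, abs_mul, abs_of_nonneg (by positivity : 0 ≤ σ ^ 2 * (t * σ))]
  calc _ ≤ σ ^ 2 * (t * σ) * (M * Real.exp (-(t / 2 * σ) ^ 2 / 4)) := by gcongr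
    _ = _ := by ring

/-- The exponential decreases in `t` and the linear factor grows by at most `c`. This gives one
majorant for a whole range of times when differentiating under the integral. -/
theorem subDeriv_zero_le_mul {a b c : ℝ} (ha : 0 < a) (hab : a ≤ b) (hb : b ≤ c * a) (s : ℝ) :
    subDeriv 0 b s ≤ c * subDeriv 0 a s := by
  rw [subDeriv_zero, subDeriv_zero, ← mul_div_assoc]
  refine div_le_div_of_nonneg_right ?_ (by positivity)
  set σ := (√s)⁻¹
  have hσ0 : 0 ≤ σ := by positivity
  calc σ ^ 3 * b * Real.exp (-(b * σ) ^ 2 / 4)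
      ≤ σ ^ 3 * (c * a) * Real.exp (-(a * σ) ^ 2 / 4) := by
        have hb0 : 0 ≤ b := ha.le.trans hab
        have hca : 0 ≤ c * a := hb0.trans hb
        gcongr
    _ = c * (σ ^ 3 * a * Real.exp (-(a * σ) ^ 2 / 4)) := by ring

/-- The subordinator absorbs negative powers of `s`. -/
theorem exists_subDeriv_zero_mul_le (d : ℕ) {t₀ : ℝ} (ht₀ : 0 < t₀) :
    ∃ M : ℝ, 0 < M ∧ ∀ t s, t₀ ≤ t → 0 < s →
      subDeriv 0 t s * (1 / (1 - Real.exp (-2 * s)) ^ ((d : ℝ) / 2))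
        ≤ M * subDeriv 0 (t / 2) s := by
  -- As `1 - e^{-2s} ≥ s/(1+s)`, the singular factor is at most `(1 + 1/s)^d`. For `t ≥ t₀` this is
  -- at most a polynomial in `v = t/√s`, which the exponential absorbs.
  obtain ⟨Q, hQ⟩ : ∃ Q : ℝ[X], Q = (1 + C (t₀⁻¹ ^ 2) * X ^ 2) ^ d := ⟨_, rfl⟩
  obtain ⟨M, hM, h⟩ := exists_abs_eval_le_exp Q
  refine ⟨2 * M, by positivity, fun t s ht hs => ?_⟩
  have ht0 : 0 < t := ht₀.trans_le ht
  rw [subDeriv_zero, subDeriv_zero]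
  set σ := (√s)⁻¹ with hσ
  have hσ0 : 0 < σ := by positivity
  have hσ2 : σ ^ 2 = 1 / s := by rw [hσ, inv_pow, Real.sq_sqrt hs.le, one_div]
  have hτ : 1 / (1 + σ ^ 2) ≤ 1 - Real.exp (-2 * s) := by
    rw [hσ2]
    have h1 : Real.exp (-2 * s) ≤ 1 / (1 + 2 * s) := by
      rw [show -2 * s = -(2 * s) by ring, Real.exp_neg, ← one_div]
      exact one_div_le_one_div_of_le (by positivity) (by linarith [Real.add_one_le_exp (2 * s)])
    have h2 : 1 / (1 + 1 / s) ≤ 1 - 1 / (1 + 2 * s) := by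
      rw [le_sub_iff_add_le]
      have : 1 / (1 + 1 / s) + 1 / (1 + 2 * s) = (s * (1 + 2 * s) + (s + 1)) / ((s + 1) * (1 + 2 * s)) := by
        field_simp
      rw [this, div_le_one (by positivity)]
      nlinarith
    linarith
  have hτ0 : 0 < 1 - Real.exp (-2 * s) := lt_of_lt_of_le (by positivity) hτ
  have hpow : 1 / (1 - Real.exp (-2 * s)) ^ ((d : ℝ) / 2) ≤ (1 + σ ^ 2) ^ d := by
    rw [one_div, ← Real.inv_rpow hτ0.le]
    have h1 : (1 - Real.exp (-2 * s))⁻¹ ≤ 1 + σ ^ 2 := by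
      rw [inv_le_comm₀ hτ0 (by positivity), ← one_div]; exact hτ
    calc (1 - Real.exp (-2 * s))⁻¹ ^ ((d : ℝ) / 2) ≤ (1 + σ ^ 2) ^ ((d : ℝ) / 2) := by gcongr
      _ ≤ (1 + σ ^ 2) ^ (d : ℝ) := by
          refine Real.rpow_le_rpow_of_exponent_le (by nlinarith [sq_nonneg σ]) ?_
          have : (0 : ℝ) ≤ d := by positivity
          linarith
      _ = _ := Real.rpow_natCast _ _
  have hQe : (1 + σ ^ 2) ^ d ≤ M * Real.exp (3 * (t * σ) ^ 2 / 16) := by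
    have h1 := h (t * σ)
    have h2 : eval (t * σ) Q = (1 + t₀⁻¹ ^ 2 * (t * σ) ^ 2) ^ d := by simp [hQ]
    rw [h2, abs_of_nonneg (by positivity)] at h1
    refine le_trans ?_ h1
    have h3 : 1 ≤ t₀⁻¹ * t := by rw [← div_eq_inv_mul, le_div_iff₀ ht₀]; linarith
    have h4 : 1 ≤ (t₀⁻¹ * t) ^ 2 := one_le_pow₀ h3
    have h5 : σ ^ 2 ≤ t₀⁻¹ ^ 2 * (t * σ) ^ 2 := by
      calc σ ^ 2 = 1 * σ ^ 2 := (one_mul _).symm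
        _ ≤ (t₀⁻¹ * t) ^ 2 * σ ^ 2 := by gcongr
        _ = _ := by ring
    gcongr
  calc _ ≤ σ ^ 3 * t * Real.exp (-(t * σ) ^ 2 / 4) / (2 * √Real.pi) *
        (M * Real.exp (3 * (t * σ) ^ 2 / 16)) := by gcongr; exact hpow.trans hQe
    _ = M * (σ ^ 3 * t * (Real.exp (-(t * σ) ^ 2 / 4) * Real.exp (3 * (t * σ) ^ 2 / 16))
          / (2 * √Real.pi)) := by ring
    _ = M * (σ ^ 3 * t * Real.exp (-(t / 2 * σ) ^ 2 / 4) / (2 * √Real.pi)) := by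
        rw [← Real.exp_add]; congr 5; ring
    _ = _ := by ring

/-! #### The Cauchy–Schlömilch substitution -/

/-- The map `v ↦ Av - B/v` is an increasing bijection of `(0,∞)` onto `ℝ` with derivative `A +
B/v²`, so this is the Gaussian integral. -/
theorem lintegral_schlomilch_add {A B : ℝ} (hA : 0 < A) (hB : 0 < B) :
    ∫⁻ v in Ioi (0 : ℝ), ENNReal.ofReal (A + B / v ^ 2) *
      ENNReal.ofReal (Real.exp (-(A * v - B / v) ^ 2)) = ENNReal.ofReal √Real.pi := by
  set f : ℝ → ℝ := fun v => A * v - B / v with hf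
  have hder : ∀ v ∈ Ioi (0 : ℝ), HasDerivWithinAt f (A + B / v ^ 2) (Ioi 0) v := by
    intro v hv
    have hv0 : v ≠ 0 := ne_of_gt hv
    have h1 : HasDerivAt (fun v : ℝ => B / v) (-(B / v ^ 2)) v := by
      have := (hasDerivAt_inv hv0).const_mul B
      simpa [div_eq_mul_inv] using this
    have h2 := ((hasDerivAt_id v).const_mul A).sub h1
    refine (h2.congr_deriv ?_).hasDerivWithinAt
    ring
  have hmono : StrictMonoOn f (Ioi 0) := by
    intro u hu v hv huv
    have hu0 : (0 : ℝ) < u := hu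
    have h1 : A * u < A * v := by gcongr
    have h2 : B / v < B / u := by gcongr
    simp only [hf]; linarith
  have himg : f '' Ioi 0 = univ := by
    refine eq_univ_of_forall fun z => ?_
    set v := (z + √(z ^ 2 + 4 * A * B)) / (2 * A) with hv
    have h1 : |z| < √(z ^ 2 + 4 * A * B) := by
      rw [← Real.sqrt_sq_eq_abs]
      exact Real.sqrt_lt_sqrt (sq_nonneg _) (by nlinarith [mul_pos hA hB])
    have hv0 : 0 < v := div_pos (by linarith [neg_abs_le z]) (by positivity)
    refine ⟨v, hv0, ?_⟩
    have h2 : (2 * A * v - z) ^ 2 = z ^ 2 + 4 * A * B := by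
      have : 2 * A * v - z = √(z ^ 2 + 4 * A * B) := by rw [hv]; field_simp; ring
      rw [this, Real.sq_sqrt (by positivity)]
    have h3 : A * v ^ 2 - B = z * v := by nlinarith
    simp only [hf]
    field_simp
    linarith
  have h := lintegral_image_eq_lintegral_abs_deriv_mul measurableSet_Ioi hder hmono.injOn
    (fun z => ENNReal.ofReal (Real.exp (-z ^ 2)))
  rw [himg, setLIntegral_univ] at h
  have hg : ∫⁻ z : ℝ, ENNReal.ofReal (Real.exp (-z ^ 2)) = ENNReal.ofReal √Real.pi := by
    rw [← ofReal_integral_eq_lintegral_ofReal]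
    · have := integral_gaussian 1
      simp only [neg_mul, one_mul, div_one] at this
      rw [this]
    · simpa using integrable_exp_neg_mul_sq zero_lt_one
    · exact Eventually.of_forall fun _ => (Real.exp_pos _).le
  rw [← hg, h]
  refine setLIntegral_congr_fun measurableSet_Ioi fun v hv => ?_
  have : 0 < A + B / v ^ 2 := by
    have hv0 : (0 : ℝ) < v := hv
    positivity
  simp only [abs_of_pos this, hf]

/-- The involution `v ↦ B/(Av)` changes the sign of `Av - B/v` and exchanges the two weights. -/
theorem lintegral_schlomilch_symm {A B : ℝ} (hA : 0 < A) (hB : 0 < B) :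
    ∫⁻ v in Ioi (0 : ℝ), ENNReal.ofReal A * ENNReal.ofReal (Real.exp (-(A * v - B / v) ^ 2))
      = ∫⁻ v in Ioi (0 : ℝ), ENNReal.ofReal (B / v ^ 2) *
        ENNReal.ofReal (Real.exp (-(A * v - B / v) ^ 2)) := by
  set f : ℝ → ℝ := fun v => B / A / v with hf
  have hder : ∀ v ∈ Ioi (0 : ℝ), HasDerivWithinAt f (-(B / A / v ^ 2)) (Ioi 0) v := by
    intro v hv
    have := (hasDerivAt_inv (ne_of_gt hv : v ≠ 0)).const_mul (B / A)
    refine (this.congr_deriv ?_).hasDerivWithinAt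
    rw [mul_neg, div_eq_mul_inv _ (v ^ 2)]
  have hinv : ∀ v, 0 < v → f (f v) = v := by
    intro v hv
    simp only [hf]; field_simp
  have hpos : ∀ v, 0 < v → 0 < f v := fun v hv => by simp only [hf]; positivity
  have hinj : InjOn f (Ioi 0) := by
    intro u hu v hv huv
    rw [← hinv u hu, ← hinv v hv, huv]
  have himg : f '' Ioi 0 = Ioi 0 := by
    ext z
    constructor
    · rintro ⟨v, hv, rfl⟩; exact hpos v hv
    · intro hz; exact ⟨f z, hpos z hz, hinv z hz⟩
  have h := lintegral_image_eq_lintegral_abs_deriv_mul measurableSet_Ioi hder hinj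
    (fun v => ENNReal.ofReal A * ENNReal.ofReal (Real.exp (-(A * v - B / v) ^ 2)))
  rw [himg] at h
  rw [h]
  refine setLIntegral_congr_fun measurableSet_Ioi fun v hv => ?_
  have hv0 : (0 : ℝ) < v := hv
  simp only [hf]
  rw [← mul_assoc, ← ENNReal.ofReal_mul (abs_nonneg _), abs_neg, abs_of_pos (by positivity)]
  congr 2
  · field_simp
  · congr 2
    field_simp
    ring

theorem lintegral_schlomilch {A B : ℝ} (hA : 0 < A) (hB : 0 ≤ B) :
    ∫⁻ v in Ioi (0 : ℝ), ENNReal.ofReal A * ENNReal.ofReal (Real.exp (-(A * v - B / v) ^ 2))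
      = ENNReal.ofReal (√Real.pi / 2) := by
  rcases hB.eq_or_lt with rfl | hB
  · simp only [zero_div, sub_zero]
    rw [lintegral_const_mul' _ _ ENNReal.ofReal_ne_top, ← ofReal_integral_eq_lintegral_ofReal,
      ← ENNReal.ofReal_mul hA.le]
    · simp only [mul_pow, ← neg_mul]
      rw [integral_gaussian_Ioi, Real.sqrt_div' _ (by positivity), Real.sqrt_sq hA.le]
      congr 1; field_simp
    · have := (integrable_exp_neg_mul_sq (pow_pos hA 2)).integrableOn (s := Ioi (0 : ℝ))
      simpa only [mul_pow, ← neg_mul, IntegrableOn] using this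
    · exact Eventually.of_forall fun _ => (Real.exp_pos _).le
  · have h1 := lintegral_schlomilch_symm hA hB
    have h2 := lintegral_schlomilch_add hA hB
    have h3 : ∫⁻ v in Ioi (0 : ℝ), ENNReal.ofReal (A + B / v ^ 2) *
      ENNReal.ofReal (Real.exp (-(A * v - B / v) ^ 2)) =
      (∫⁻ v in Ioi (0 : ℝ), ENNReal.ofReal A * ENNReal.ofReal (Real.exp (-(A * v - B / v) ^ 2)))
      + ∫⁻ v in Ioi (0 : ℝ), ENNReal.ofReal (B / v ^ 2) *
        ENNReal.ofReal (Real.exp (-(A * v - B / v) ^ 2)) := by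
      rw [← lintegral_add_left (by fun_prop)]
      refine setLIntegral_congr_fun measurableSet_Ioi fun v hv => ?_
      rw [ENNReal.ofReal_add hA.le (by positivity), add_mul]
    rw [h3, ← h1, ← two_mul] at h2
    set I := ∫⁻ v in Ioi (0 : ℝ),
      ENNReal.ofReal A * ENNReal.ofReal (Real.exp (-(A * v - B / v) ^ 2))
    have h4 : I = ENNReal.ofReal √Real.pi / 2 := by
      rw [← h2, mul_comm, ENNReal.mul_div_cancel_right (by simp) (by simp)]
    rw [h4, ENNReal.ofReal_div_of_pos (by norm_num)]
    simp

/-! ### Laplace transform, total mass and convolution property of the subordinator. -/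

theorem image_inv_sq_Ioi : (fun v : ℝ => (v ^ 2)⁻¹) '' Ioi 0 = Ioi (0 : ℝ) := by
  ext z
  constructor
  · rintro ⟨v, hv, rfl⟩
    have hv0 : (0 : ℝ) < v := hv
    exact inv_pos.2 (pow_pos hv0 2)
  · intro hz
    have hz0 : (0 : ℝ) < z := hz
    refine ⟨(√z)⁻¹, inv_pos.2 (Real.sqrt_pos.2 hz0), ?_⟩
    simp [Real.sq_sqrt hz0.le]

/-- The subordinator in the variable `v = s^{-1/2}`. -/
theorem lintegral_subDeriv_zero_mul {t : ℝ} (ht : 0 < t) (G : ℝ → ℝ≥0∞) :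
    ∫⁻ s in Ioi (0 : ℝ), ENNReal.ofReal (subDeriv 0 t s) * G s
      = ∫⁻ v in Ioi (0 : ℝ), ENNReal.ofReal (t / √Real.pi * Real.exp (-(t * v) ^ 2 / 4)) *
          G (v ^ 2)⁻¹ := by
  have hder : ∀ v ∈ Ioi (0 : ℝ),
      HasDerivWithinAt (fun v : ℝ => (v ^ 2)⁻¹) (-(2 * v) / (v ^ 2) ^ 2) (Ioi 0) v := by
    intro v hv
    have hv0 : (0 : ℝ) < v := hv
    have h1 : HasDerivAt (fun v : ℝ => v ^ 2) (2 * v) v := by simpa using hasDerivAt_pow 2 v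
    exact (h1.inv (by positivity)).hasDerivWithinAt
  have hinj : InjOn (fun v : ℝ => (v ^ 2)⁻¹) (Ioi 0) := by
    intro u hu v hv huv
    have h1 := inv_injective huv
    exact (pow_left_inj₀ (le_of_lt hu) (le_of_lt hv) two_ne_zero).1 h1
  have h := lintegral_image_eq_lintegral_abs_deriv_mul measurableSet_Ioi hder hinj
    (fun s => ENNReal.ofReal (subDeriv 0 t s) * G s)
  rw [image_inv_sq_Ioi] at h
  rw [h]
  refine setLIntegral_congr_fun measurableSet_Ioi fun v hv => ?_
  have hv0 : (0 : ℝ) < v := hv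
  rw [← mul_assoc, ← ENNReal.ofReal_mul (abs_nonneg _), neg_div, abs_neg,
    abs_of_pos (by positivity)]
  congr 2
  rw [subDeriv_zero, Real.sqrt_inv, inv_inv, Real.sqrt_sq hv0.le]
  field_simp

/-- Completing the square, `(tv)²/4 + l/v² = (tv/2 - √l/v)² + t√l`, which leaves a Schlömilch
integral. The case `l = 0` is the total mass, and `l = |ν|` gives the eigenvalues of `P_t`. -/
theorem lintegral_subDeriv_zero_mul_exp {t l : ℝ} (ht : 0 < t) (hl : 0 ≤ l) :
    ∫⁻ s in Ioi (0 : ℝ), ENNReal.ofReal (subDeriv 0 t s) * ENNReal.ofReal (Real.exp (-(l * s)))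
      = ENNReal.ofReal (Real.exp (-(t * √l))) := by
  rw [lintegral_subDeriv_zero_mul ht (fun s => ENNReal.ofReal (Real.exp (-(l * s))))]
  have h := lintegral_schlomilch (A := t / 2) (B := √l) (by positivity) (Real.sqrt_nonneg l)
  have e : ∫⁻ v in Ioi (0 : ℝ), ENNReal.ofReal (t / √Real.pi * Real.exp (-(t * v) ^ 2 / 4)) *
        ENNReal.ofReal (Real.exp (-(l * (v ^ 2)⁻¹)))
      = ENNReal.ofReal (2 / √Real.pi * Real.exp (-(t * √l))) *
        ∫⁻ v in Ioi (0 : ℝ), ENNReal.ofReal (t / 2) *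
          ENNReal.ofReal (Real.exp (-(t / 2 * v - √l / v) ^ 2)) := by
    rw [← lintegral_const_mul' _ _ ENNReal.ofReal_ne_top]
    refine setLIntegral_congr_fun measurableSet_Ioi fun v hv => ?_
    have hv0 : (0 : ℝ) < v := hv
    rw [← ENNReal.ofReal_mul (by positivity), ← ENNReal.ofReal_mul (by positivity),
      ← ENNReal.ofReal_mul (by positivity)]
    congr 1
    have hexp : Real.exp (-(t * v) ^ 2 / 4) * Real.exp (-(l * (v ^ 2)⁻¹))
        = Real.exp (-(t * √l)) * Real.exp (-(t / 2 * v - √l / v) ^ 2) := by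
      rw [← Real.exp_add, ← Real.exp_add]
      congr 1
      have : l = √l ^ 2 := (Real.sq_sqrt hl).symm
      nth_rewrite 1 [this]
      field_simp
      ring
    calc _ = t / √Real.pi * (Real.exp (-(t * v) ^ 2 / 4) * Real.exp (-(l * (v ^ 2)⁻¹))) := by ring
      _ = _ := by rw [hexp]; ring
  rw [e, h, ← ENNReal.ofReal_mul (by positivity)]
  congr 1
  have : √Real.pi ≠ 0 := by positivity
  field_simp

theorem lintegral_subDeriv_zero {t : ℝ} (ht : 0 < t) :
    ∫⁻ s in Ioi (0 : ℝ), ENNReal.ofReal (subDeriv 0 t s) = 1 := by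
  simpa using lintegral_subDeriv_zero_mul_exp ht le_rfl

theorem integrableOn_subDeriv_zero {t : ℝ} (ht : 0 < t) :
    IntegrableOn (subDeriv 0 t) (Ioi 0) := by
  refine ⟨((measurable_subDeriv 0).of_uncurry_left).aestronglyMeasurable, ?_⟩
  rw [hasFiniteIntegral_iff_ofReal (Eventually.of_forall fun s => subDeriv_zero_nonneg ht.le s),
    lintegral_subDeriv_zero ht]
  exact ENNReal.one_lt_top

/-- Put `s = a/(1+v²)`. Then `t²/4s + t'²/4(a-s) = (t+t')²/4a + (Av - B/v)²` with `A = t/(2√a)` and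
`B = t'/(2√a)`, and the algebraic factors split into the two weights `A` and `B/v²` of the
Schlömilch integrals. -/
theorem lintegral_subDeriv_zero_conv {t t' a : ℝ} (ht : 0 < t) (ht' : 0 < t') (ha : 0 < a) :
    ∫⁻ s in Ioo 0 a, ENNReal.ofReal (subDeriv 0 t s) * ENNReal.ofReal (subDeriv 0 t' (a - s))
      = ENNReal.ofReal (subDeriv 0 (t + t') a) := by
  set f : ℝ → ℝ := fun v => a / (1 + v ^ 2) with hf
  have hder : ∀ v ∈ Ioi (0 : ℝ),
      HasDerivWithinAt f (-(a * (2 * v) / (1 + v ^ 2) ^ 2)) (Ioi 0) v := by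
    intro v hv
    have h1 : HasDerivAt (fun v : ℝ => 1 + v ^ 2) (2 * v) v := by
      simpa using (hasDerivAt_pow 2 v).const_add 1
    have h2 := (h1.inv (by positivity)).const_mul a
    refine (h2.congr_deriv ?_).hasDerivWithinAt
    ring
  have hinj : InjOn f (Ioi 0) := by
    intro u hu v hv huv
    simp only [hf] at huv
    have h1 : (1 + u ^ 2) = 1 + v ^ 2 := by
      rw [div_eq_div_iff (by positivity) (by positivity)] at huv
      exact (mul_left_cancel₀ ha.ne' huv).symm
    exact (pow_left_inj₀ (le_of_lt hu) (le_of_lt hv) two_ne_zero).1 (by linarith)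
  have himg : f '' Ioi 0 = Ioo 0 a := by
    ext z
    constructor
    · rintro ⟨v, hv, rfl⟩
      have hv0 : (0 : ℝ) < v := hv
      refine ⟨by simp only [hf]; positivity, ?_⟩
      simp only [hf]
      rw [div_lt_iff₀ (by positivity)]
      nlinarith [mul_pos ha (pow_pos hv0 2)]
    · rintro ⟨h1, h2⟩
      have h3 : 0 < a / z - 1 := by rw [sub_pos, lt_div_iff₀ h1]; linarith
      refine ⟨√(a / z - 1), Real.sqrt_pos.2 h3, ?_⟩
      simp only [hf]
      rw [Real.sq_sqrt h3.le]
      field_simp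
      ring
  have h := lintegral_image_eq_lintegral_abs_deriv_mul measurableSet_Ioi hder hinj
    (fun s => ENNReal.ofReal (subDeriv 0 t s) * ENNReal.ofReal (subDeriv 0 t' (a - s)))
  rw [himg] at h
  rw [h]
  set A := t / (2 * √a) with hA
  set B := t' / (2 * √a) with hB
  have hA0 : 0 < A := by positivity
  have hB0 : 0 < B := by positivity
  have hsa : √a ^ 2 = a := Real.sq_sqrt ha.le
  set κ := Real.exp (-(t + t') ^ 2 / (4 * a)) / (Real.pi * a) with hκ
  have hκ0 : 0 ≤ κ := by positivity
  have key : ∀ v ∈ Ioi (0 : ℝ), ENNReal.ofReal |-(a * (2 * v) / (1 + v ^ 2) ^ 2)| *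
      (ENNReal.ofReal (subDeriv 0 t (f v)) * ENNReal.ofReal (subDeriv 0 t' (a - f v)))
      = ENNReal.ofReal (2 * κ * B) *
          (ENNReal.ofReal A * ENNReal.ofReal (Real.exp (-(A * v - B / v) ^ 2)))
        + ENNReal.ofReal (2 * κ * A) * (ENNReal.ofReal (B / v ^ 2) *
          ENNReal.ofReal (Real.exp (-(A * v - B / v) ^ 2))) := by
    intro v hv
    have hv0 : (0 : ℝ) < v := hv
    set w := √(1 + v ^ 2) with hw
    have hw2 : w ^ 2 = 1 + v ^ 2 := Real.sq_sqrt (by positivity)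
    have hw0 : 0 < w := Real.sqrt_pos.2 (by positivity)
    have s1 : √(f v) = √a / w := by rw [hf, Real.sqrt_div ha.le]
    have s2 : √(a - f v) = √a * v / w := by
      have : a - f v = a * v ^ 2 / (1 + v ^ 2) := by simp only [hf]; field_simp; ring
      rw [this, Real.sqrt_div (by positivity), Real.sqrt_mul ha.le, Real.sqrt_sq hv0.le]
    rw [abs_neg, abs_of_pos (by positivity)]
    have n1 : 0 ≤ subDeriv 0 t (f v) := subDeriv_zero_nonneg ht.le _
    have n2 : 0 ≤ subDeriv 0 t' (a - f v) := subDeriv_zero_nonneg ht'.le _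
    rw [← ENNReal.ofReal_mul n1, ← ENNReal.ofReal_mul (by positivity),
      ← ENNReal.ofReal_mul hA0.le, ← ENNReal.ofReal_mul (by positivity),
      ← ENNReal.ofReal_mul (by positivity), ← ENNReal.ofReal_mul (by positivity),
      ← ENNReal.ofReal_add (by positivity) (by positivity)]
    congr 1
    rw [subDeriv_zero, subDeriv_zero, s1, s2]
    have hexp : Real.exp (-(t * (√a / w)⁻¹) ^ 2 / 4) * Real.exp (-(t' * (√a * v / w)⁻¹) ^ 2 / 4)
        = Real.exp (-(t + t') ^ 2 / (4 * a)) * Real.exp (-(A * v - B / v) ^ 2) := by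
      rw [← Real.exp_add, ← Real.exp_add]
      congr 1
      rw [hA, hB]
      field_simp
      rw [hw2, hsa]
      field_simp
      ring
    have hpi : √Real.pi ^ 2 = Real.pi := Real.sq_sqrt Real.pi_pos.le
    calc _ = a * (2 * v) / (1 + v ^ 2) ^ 2 * ((√a / w)⁻¹ ^ 3 * t * ((√a * v / w)⁻¹ ^ 3 * t')
          / (2 * √Real.pi * (2 * √Real.pi))) *
          (Real.exp (-(t * (√a / w)⁻¹) ^ 2 / 4) * Real.exp (-(t' * (√a * v / w)⁻¹) ^ 2 / 4)) := by
            ring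
      _ = (2 * (Real.exp (-(t + t') ^ 2 / (4 * a)) / (Real.pi * a)) * B * A
          + 2 * (Real.exp (-(t + t') ^ 2 / (4 * a)) / (Real.pi * a)) * A * (B / v ^ 2)) *
          Real.exp (-(A * v - B / v) ^ 2) := by
            rw [hexp]
            have : a * (2 * v) / (1 + v ^ 2) ^ 2 * ((√a / w)⁻¹ ^ 3 * t * ((√a * v / w)⁻¹ ^ 3 * t')
              / (2 * √Real.pi * (2 * √Real.pi))) = 2 * (1 / (Real.pi * a)) * A * B * (1 + 1 / v ^ 2) := by
              have e1 : (√a / w)⁻¹ ^ 3 * (√a * v / w)⁻¹ ^ 3 = (1 + v ^ 2) ^ 3 / (a ^ 3 * v ^ 3) := by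
                rw [← hw2]
                nth_rewrite 3 [← hsa]
                field_simp
              have e2 : A * B = t * t' / (4 * a) := by
                rw [hA, hB]; nth_rewrite 3 [← hsa]; field_simp; ring
              have e3 : 2 * √Real.pi * (2 * √Real.pi) = 4 * Real.pi := by nlinarith
              calc _ = a * (2 * v) / (1 + v ^ 2) ^ 2 * (((√a / w)⁻¹ ^ 3 * (√a * v / w)⁻¹ ^ 3) * (t * t')
                    / (2 * √Real.pi * (2 * √Real.pi))) := by ring
                _ = 2 * (1 / (Real.pi * a)) * (A * B) * (1 + 1 / v ^ 2) := by
                  rw [e1, e2, e3]; field_simp; ring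
                _ = _ := by ring
            rw [this]; ring
      _ = _ := by rw [hκ]; ring
  rw [setLIntegral_congr_fun measurableSet_Ioi key, lintegral_add_left (by fun_prop),
    lintegral_const_mul' (ENNReal.ofReal (2 * κ * B)) _ ENNReal.ofReal_ne_top,
    lintegral_const_mul' (ENNReal.ofReal (2 * κ * A)) _ ENNReal.ofReal_ne_top,
    ← lintegral_schlomilch_symm hA0 hB0, lintegral_schlomilch hA0 hB0.le,
    ← ENNReal.ofReal_mul (by positivity), ← ENNReal.ofReal_mul (by positivity),
    ← ENNReal.ofReal_add (by positivity) (by positivity)]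
  congr 1
  rw [subDeriv_zero, hκ, hA, hB]
  have h1 : -((t + t') * (√a)⁻¹) ^ 2 / 4 = -(t + t') ^ 2 / (4 * a) := by
    rw [mul_pow, inv_pow, hsa]; field_simp
  rw [h1]
  have hpi : √Real.pi ^ 2 = Real.pi := Real.sq_sqrt Real.pi_pos.le
  have aux : ∀ p r e : ℝ, p ≠ 0 → r ≠ 0 → 2 * (e / (p ^ 2 * r ^ 2)) * (t' / (2 * r)) * (p / 2)
      + 2 * (e / (p ^ 2 * r ^ 2)) * (t / (2 * r)) * (p / 2) = r⁻¹ ^ 3 * (t + t') * e / (2 * p) := by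
    intro p r e hp hr
    field_simp
    ring
  have := aux √Real.pi √a (Real.exp (-(t + t') ^ 2 / (4 * a))) (by positivity) (by positivity)
  rwa [hpi, hsa] at this

/-- The subordinator is a convolution semigroup. -/
theorem lintegral_lintegral_subDeriv_zero {t t' : ℝ} (ht : 0 < t) (ht' : 0 < t') {G : ℝ → ℝ≥0∞}
    (hG : Measurable G) :
    ∫⁻ s in Ioi (0 : ℝ), ∫⁻ s' in Ioi (0 : ℝ), ENNReal.ofReal (subDeriv 0 t s) *
        (ENNReal.ofReal (subDeriv 0 t' s') * G (s + s'))
      = ∫⁻ a in Ioi (0 : ℝ), ENNReal.ofReal (subDeriv 0 (t + t') a) * G a := by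
  have hm : ∀ t, Measurable (subDeriv 0 t) := fun t => (measurable_subDeriv 0).of_uncurry_left
  -- The density vanishes for `s ≤ 0`, so integrals run over `ℝ` and translation invariance applies.
  have full : ∀ (t : ℝ) (H : ℝ → ℝ≥0∞), ∫⁻ s in Ioi (0 : ℝ), ENNReal.ofReal (subDeriv 0 t s) * H s
      = ∫⁻ s, ENNReal.ofReal (subDeriv 0 t s) * H s := by
    intro t H
    rw [← lintegral_indicator measurableSet_Ioi]
    refine lintegral_congr fun s => ?_
    by_cases hs : s ∈ Ioi (0 : ℝ)
    · rw [indicator_of_mem hs]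
    · rw [indicator_of_notMem hs, subDeriv_of_nonpos 0 t (not_lt.1 hs)]; simp
  have e1 : ∀ s, ∫⁻ s' in Ioi (0 : ℝ), ENNReal.ofReal (subDeriv 0 t s) *
        (ENNReal.ofReal (subDeriv 0 t' s') * G (s + s'))
      = ENNReal.ofReal (subDeriv 0 t s) * ∫⁻ a, ENNReal.ofReal (subDeriv 0 t' (a - s)) * G a := by
    intro s
    rw [lintegral_const_mul' _ _ ENNReal.ofReal_ne_top, full t' (fun s' => G (s + s')),
      ← lintegral_sub_right_eq_self _ s]
    simp only [add_sub_cancel]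
  simp_rw [e1]
  rw [full t (fun s => ∫⁻ a, ENNReal.ofReal (subDeriv 0 t' (a - s)) * G a), full (t + t') G]
  simp_rw [← lintegral_const_mul' _ _ (ENNReal.ofReal_ne_top (r := subDeriv 0 t _))]
  rw [lintegral_lintegral_swap]
  · refine lintegral_congr fun a => ?_
    simp_rw [← mul_assoc]
    have hms : Measurable fun s => ENNReal.ofReal (subDeriv 0 t s) *
        ENNReal.ofReal (subDeriv 0 t' (a - s)) :=
      (hm t).ennreal_ofReal.mul (((hm t').comp (measurable_const.sub measurable_id)).ennreal_ofReal)
    rw [lintegral_mul_const _ hms]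
    congr 1
    rcases le_or_gt a 0 with ha | ha
    · rw [subDeriv_of_nonpos 0 _ ha, ENNReal.ofReal_zero, lintegral_eq_zero_iff hms]
      refine Eventually.of_forall fun s => ?_
      rcases le_or_gt s 0 with hs | hs
      · simp [subDeriv_of_nonpos 0 t hs]
      · simp [subDeriv_of_nonpos 0 t' (by linarith : a - s ≤ 0)]
    · rw [← lintegral_subDeriv_zero_conv ht ht' ha, ← lintegral_indicator measurableSet_Ioo]
      refine lintegral_congr fun s => ?_
      by_cases hs : s ∈ Ioo 0 a
      · rw [indicator_of_mem hs]
      · rw [indicator_of_notMem hs]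
        rcases le_or_gt s 0 with hs0 | hs0
        · simp [subDeriv_of_nonpos 0 t hs0]
        · have : a - s ≤ 0 := by
            by_contra hc
            exact hs ⟨hs0, by linarith⟩
          simp [subDeriv_of_nonpos 0 t' this]
  · refine Measurable.aemeasurable ?_
    refine ((hm t).comp measurable_fst).ennreal_ofReal.mul (Measurable.mul ?_
      (hG.comp measurable_snd))
    exact ((hm t').comp (measurable_snd.sub measurable_fst)).ennreal_ofReal

attribute [irreducible] subDeriv

end Subordinator

/-! ### The kernels of the semigroups -/

section Kernels

variable {d : ℕ}

theorem lintegral_exp_neg_mul_norm_sub_sq {b : ℝ} (hb : 0 < b) (w : EuclideanSpace ℝ (Fin d)) :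
    ∫⁻ y, ENNReal.ofReal (Real.exp (-b * ‖y - w‖ ^ 2))
      = ENNReal.ofReal ((Real.pi / b) ^ ((d : ℝ) / 2)) := by
  rw [lintegral_sub_right_eq_self
    (fun y : EuclideanSpace ℝ (Fin d) => ENNReal.ofReal (Real.exp (-b * ‖y‖ ^ 2))) w,
    lintegral_exp_neg_mul_norm_sq hb, finrank_euclideanSpace, Fintype.card_fin]

theorem lintegral_ouKernel {s : ℝ} (hs : 0 < s) (x : EuclideanSpace ℝ (Fin d)) :
    ∫⁻ y, ENNReal.ofReal (ouKernel s x y) ∂(gammaD d) = 1 := by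
  have hτ := one_sub_exp_pos hs
  rw [lintegral_gammaD]
  rw [exp_neg_two_mul] at hτ
  set r := Real.exp (-s) with hr
  set τ := 1 - r ^ 2 with hτd
  have e : ∀ y, ENNReal.ofReal (gaussDensity d y) * ENNReal.ofReal (ouKernel s x y)
      = ENNReal.ofReal (1 / (Real.pi ^ ((d : ℝ) / 2) * τ ^ ((d : ℝ) / 2))) *
        ENNReal.ofReal (Real.exp (-(1 / τ) * ‖y - r • x‖ ^ 2)) := by
    intro y
    rw [← ENNReal.ofReal_mul (gaussDensity_pos y).le, ← ENNReal.ofReal_mul (by positivity)]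
    congr 1
    unfold gaussDensity ouKernel
    rw [exp_neg_two_mul, ← hr, ← hτd]
    have hn : ‖y - r • x‖ ^ 2 = ‖y‖ ^ 2 - 2 * r * inner ℝ x y + r ^ 2 * ‖x‖ ^ 2 := by
      rw [norm_sub_sq_real, norm_smul, inner_smul_right, mul_pow, Real.norm_eq_abs, sq_abs,
        real_inner_comm]
      ring
    have hexp : Real.exp (-‖y‖ ^ 2) *
        Real.exp (-(r ^ 2 * (‖x‖ ^ 2 + ‖y‖ ^ 2) - 2 * r * inner ℝ x y) / τ)
        = Real.exp (-(1 / τ) * ‖y - r • x‖ ^ 2) := by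
      rw [← Real.exp_add, hn]
      congr 1
      field_simp
      rw [hτd]; ring
    rw [← hexp]
    field_simp
  simp_rw [e]
  rw [lintegral_const_mul' _ _ ENNReal.ofReal_ne_top,
    lintegral_exp_neg_mul_norm_sub_sq (by positivity), ← ENNReal.ofReal_mul (by positivity),
    ← Real.mul_rpow Real.pi_pos.le hτ.le]
  have : Real.pi / (1 / τ) = Real.pi * τ := by field_simp
  rw [this, one_div_mul_cancel (by positivity), ENNReal.ofReal_one]

/-- The semigroup property of `T_s`. -/
theorem lintegral_ouKernel_mul_ouKernel {a b : ℝ} (ha : 0 < a) (hb : 0 < b)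
    (x z : EuclideanSpace ℝ (Fin d)) :
    ∫⁻ y, ENNReal.ofReal (ouKernel a x y) * ENNReal.ofReal (ouKernel b y z) ∂(gammaD d)
      = ENNReal.ofReal (ouKernel (a + b) x z) := by
  have hτ₁ := one_sub_exp_pos ha
  have hτ₂ := one_sub_exp_pos hb
  have hT := one_sub_exp_pos (add_pos ha hb)
  rw [lintegral_gammaD]
  have hab : Real.exp (-(a + b)) = Real.exp (-a) * Real.exp (-b) := by
    rw [← Real.exp_add]; congr 1; ring
  rw [exp_neg_two_mul] at hτ₁ hτ₂ hT
  rw [hab] at hT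
  set r := Real.exp (-a) with hr
  set ρ := Real.exp (-b) with hρ
  set τ₁ := 1 - r ^ 2 with hτ₁d
  set τ₂ := 1 - ρ ^ 2 with hτ₂d
  set T := 1 - (r * ρ) ^ 2 with hTd
  -- `A = 1 + r²/τ₁ + ρ²/τ₂` is the coefficient of `‖y‖²` in the product of the three exponentials,
  -- and `w` below is the centre found by completing the square.
  set A := T / (τ₁ * τ₂) with hA
  have hA0 : 0 < A := by positivity
  set w : EuclideanSpace ℝ (Fin d) := (r / τ₁ / A) • x + (ρ / τ₂ / A) • z with hw
  set κ := Real.exp (-((r * ρ) ^ 2 * (‖x‖ ^ 2 + ‖z‖ ^ 2) - 2 * (r * ρ) * inner ℝ x z) / T) with hκ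
  set c := 1 / (Real.pi ^ ((d : ℝ) / 2) * τ₁ ^ ((d : ℝ) / 2) * τ₂ ^ ((d : ℝ) / 2)) with hc
  have hc0 : 0 < c := by positivity
  have e : ∀ y, ENNReal.ofReal (gaussDensity d y) *
      (ENNReal.ofReal (ouKernel a x y) * ENNReal.ofReal (ouKernel b y z))
      = ENNReal.ofReal (c * κ) * ENNReal.ofReal (Real.exp (-A * ‖y - w‖ ^ 2)) := by
    intro y
    rw [← ENNReal.ofReal_mul (ouKernel_pos ha x y).le, ← ENNReal.ofReal_mul (gaussDensity_pos y).le,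
      ← ENNReal.ofReal_mul (by positivity)]
    congr 1
    unfold gaussDensity ouKernel
    rw [exp_neg_two_mul, exp_neg_two_mul, ← hr, ← hρ, ← hτ₁d, ← hτ₂d]
    have hn : ‖y - w‖ ^ 2 = ‖y‖ ^ 2 - 2 * (r / τ₁ / A * inner ℝ x y + ρ / τ₂ / A * inner ℝ y z)
        + ((r / τ₁ / A) ^ 2 * ‖x‖ ^ 2 + 2 * (r / τ₁ / A) * (ρ / τ₂ / A) * inner ℝ x z
          + (ρ / τ₂ / A) ^ 2 * ‖z‖ ^ 2) := by
      rw [norm_sub_sq_real, hw, norm_add_sq_real, norm_smul, norm_smul, inner_add_right,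
        inner_smul_right, inner_smul_right, inner_smul_left, inner_smul_right, mul_pow, mul_pow,
        Real.norm_eq_abs, Real.norm_eq_abs, sq_abs, sq_abs, real_inner_comm x y]
      simp only [RCLike.conj_to_real]
      ring
    have hexp : Real.exp (-‖y‖ ^ 2) *
        Real.exp (-(r ^ 2 * (‖x‖ ^ 2 + ‖y‖ ^ 2) - 2 * r * inner ℝ x y) / τ₁) *
        Real.exp (-(ρ ^ 2 * (‖y‖ ^ 2 + ‖z‖ ^ 2) - 2 * ρ * inner ℝ y z) / τ₂)
        = κ * Real.exp (-A * ‖y - w‖ ^ 2) := by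
      rw [hκ, ← Real.exp_add, ← Real.exp_add, ← Real.exp_add, hn]
      congr 1
      rw [hA]
      field_simp
      rw [hTd, hτ₁d, hτ₂d]
      ring
    calc _ = c * (Real.exp (-‖y‖ ^ 2) *
        Real.exp (-(r ^ 2 * (‖x‖ ^ 2 + ‖y‖ ^ 2) - 2 * r * inner ℝ x y) / τ₁) *
        Real.exp (-(ρ ^ 2 * (‖y‖ ^ 2 + ‖z‖ ^ 2) - 2 * ρ * inner ℝ y z) / τ₂)) := by
          rw [hc]; field_simp
      _ = _ := by rw [hexp]; ring
  simp_rw [e]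
  rw [lintegral_const_mul' _ _ ENNReal.ofReal_ne_top, lintegral_exp_neg_mul_norm_sub_sq hA0,
    ← ENNReal.ofReal_mul (by positivity)]
  congr 1
  unfold ouKernel
  rw [exp_neg_two_mul, hab, ← hTd, ← hκ, hc]
  have hp : (Real.pi / A) ^ ((d : ℝ) / 2)
      = Real.pi ^ ((d : ℝ) / 2) * τ₁ ^ ((d : ℝ) / 2) * τ₂ ^ ((d : ℝ) / 2) / T ^ ((d : ℝ) / 2) := by
    rw [← Real.mul_rpow Real.pi_pos.le hτ₁.le, ← Real.mul_rpow (by positivity) hτ₂.le,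
      ← Real.div_rpow (by positivity) hT.le]
    congr 1
    rw [hA]; field_simp
  rw [hp]
  have h1 : Real.pi ^ ((d : ℝ) / 2) ≠ 0 := by positivity
  have h2 : τ₁ ^ ((d : ℝ) / 2) ≠ 0 := by positivity
  have h3 : τ₂ ^ ((d : ℝ) / 2) ≠ 0 := by positivity
  have h4 : T ^ ((d : ℝ) / 2) ≠ 0 := by positivity
  field_simp

/-- The exponent of the Mehler kernel is `‖x‖² - ‖x - e^{-s}y‖²/(1 - e^{-2s})`. A bound free of `y`
is what makes the integrals against every `f ∈ L¹(γ_d)` converge at every `x`. -/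
theorem ouKernel_le {s : ℝ} (hs : 0 < s) (x y : EuclideanSpace ℝ (Fin d)) :
    ouKernel s x y ≤ 1 / (1 - Real.exp (-2 * s)) ^ ((d : ℝ) / 2) * Real.exp (‖x‖ ^ 2) := by
  have hτ := one_sub_exp_pos hs
  unfold ouKernel
  gcongr
  rw [div_le_iff₀ hτ]
  rw [exp_neg_two_mul]
  have h : ‖x - Real.exp (-s) • y‖ ^ 2
      = ‖x‖ ^ 2 - 2 * Real.exp (-s) * inner ℝ x y + Real.exp (-s) ^ 2 * ‖y‖ ^ 2 := by
    rw [norm_sub_sq_real, norm_smul, inner_smul_right, mul_pow, Real.norm_eq_abs, sq_abs]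
    ring
  nlinarith [sq_nonneg ‖x - Real.exp (-s) • y‖]

/-- One halving of `t` absorbs the derivatives in `t`, a second one the singularity of the Mehler
kernel at `s = 0`. The majorant is integrable in `s` and free of `y`; it justifies Fubini and
differentiation under the integral. -/
theorem exists_abs_subDeriv_mul_ouKernel_le (d k : ℕ) {t₀ : ℝ} (ht₀ : 0 < t₀) :
    ∃ M : ℝ, 0 < M ∧ ∀ t s, t₀ ≤ t → 0 < s → ∀ x y : EuclideanSpace ℝ (Fin d),
      |subDeriv k t s| * ouKernel s x y ≤ M * Real.exp (‖x‖ ^ 2) * subDeriv 0 (t / 4) s := by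
  obtain ⟨M₁, hM₁, h₁⟩ := exists_abs_subDeriv_le k
  obtain ⟨M₂, hM₂, h₂⟩ := exists_subDeriv_zero_mul_le d (half_pos ht₀)
  refine ⟨M₁ * (t₀ ^ k)⁻¹ * M₂, by positivity, fun t s ht hs x y => ?_⟩
  have ht0 : 0 < t := ht₀.trans_le ht
  have hη := subDeriv_zero_nonneg (by linarith : 0 ≤ t / 2) s
  have hτ := one_sub_exp_pos hs
  have h3 := h₂ (t / 2) s (by linarith) hs
  rw [div_div, show (2 : ℝ) * 2 = 4 by norm_num] at h3
  calc |subDeriv k t s| * ouKernel s x y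
      ≤ (M₁ * (t₀ ^ k)⁻¹ * subDeriv 0 (t / 2) s) *
        (1 / (1 - Real.exp (-2 * s)) ^ ((d : ℝ) / 2) * Real.exp (‖x‖ ^ 2)) := by
        have h4 : |subDeriv k t s| ≤ M₁ * (t₀ ^ k)⁻¹ * subDeriv 0 (t / 2) s :=
          (h₁ t s ht0).trans (by gcongr)
        exact mul_le_mul h4 (ouKernel_le hs x y) (ouKernel_pos hs x y).le (by positivity)
    _ = M₁ * (t₀ ^ k)⁻¹ * Real.exp (‖x‖ ^ 2) *
        (subDeriv 0 (t / 2) s * (1 / (1 - Real.exp (-2 * s)) ^ ((d : ℝ) / 2))) := by ring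
    _ ≤ M₁ * (t₀ ^ k)⁻¹ * Real.exp (‖x‖ ^ 2) * (M₂ * subDeriv 0 (t / 4) s) := by gcongr
    _ = _ := by ring

/-- `∂_t^k` of the kernel of `P_t` with respect to `γ_d`. -/
def poissonKernel (k : ℕ) (t : ℝ) (x y : EuclideanSpace ℝ (Fin d)) : ℝ :=
  ∫ s in Ioi (0 : ℝ), subDeriv k t s * ouKernel s x y

theorem poissonKernel_comm (k : ℕ) (t : ℝ) (x y : EuclideanSpace ℝ (Fin d)) :
    poissonKernel k t x y = poissonKernel k t y x := by
  unfold poissonKernel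
  simp_rw [ouKernel_comm _ x y]

theorem measurable_poissonKernel (k : ℕ) :
    Measurable fun z : ℝ × EuclideanSpace ℝ (Fin d) × EuclideanSpace ℝ (Fin d) =>
      poissonKernel k z.1 z.2.1 z.2.2 := by
  have h : Measurable (Function.uncurry
      fun (z : ℝ × EuclideanSpace ℝ (Fin d) × EuclideanSpace ℝ (Fin d)) (s : ℝ) =>
        subDeriv k z.1 s * ouKernel s z.2.1 z.2.2) := by
    refine Measurable.mul ?_ ?_
    · exact measurable_subDeriv_comp k (by fun_prop) measurable_snd
    · exact measurable_ouKernel_comp measurable_snd (by fun_prop) (by fun_prop)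
  exact (h.stronglyMeasurable.integral_prod_right).measurable

theorem measurable_poissonKernel_comp (k : ℕ) {Ω : Type*} [MeasurableSpace Ω] {t : Ω → ℝ}
    {x y : Ω → EuclideanSpace ℝ (Fin d)} (ht : Measurable t) (hx : Measurable x)
    (hy : Measurable y) : Measurable fun ω => poissonKernel k (t ω) (x ω) (y ω) :=
  Measurable.comp (g := fun z : ℝ × EuclideanSpace ℝ (Fin d) × EuclideanSpace ℝ (Fin d) =>
    poissonKernel k z.1 z.2.1 z.2.2) (measurable_poissonKernel k) (ht.prodMk (hx.prodMk hy))

theorem measurable_subDeriv_mul_ouKernel (k : ℕ) (t : ℝ) (x y : EuclideanSpace ℝ (Fin d)) :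
    Measurable fun s => subDeriv k t s * ouKernel s x y :=
  (measurable_subDeriv_comp k measurable_const measurable_id).mul
    (measurable_ouKernel_comp measurable_id measurable_const measurable_const)

theorem integrableOn_subDeriv_mul_ouKernel (k : ℕ) {t : ℝ} (ht : 0 < t)
    (x y : EuclideanSpace ℝ (Fin d)) :
    IntegrableOn (fun s => subDeriv k t s * ouKernel s x y) (Ioi 0) := by
  obtain ⟨M, hM, h⟩ := exists_abs_subDeriv_mul_ouKernel_le d k ht
  refine Integrable.mono' ((integrableOn_subDeriv_zero (by positivity : 0 < t / 4)).const_mul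
    (M * Real.exp (‖x‖ ^ 2))) (measurable_subDeriv_mul_ouKernel k t x y).aestronglyMeasurable ?_
  filter_upwards [ae_restrict_mem measurableSet_Ioi] with s hs
  rw [Real.norm_eq_abs, abs_mul, abs_of_pos (ouKernel_pos hs x y)]
  exact h t s le_rfl hs x y

theorem exists_abs_poissonKernel_le (d k : ℕ) {t₀ : ℝ} (ht₀ : 0 < t₀) :
    ∃ M : ℝ, 0 < M ∧ ∀ t, t₀ ≤ t → ∀ x y : EuclideanSpace ℝ (Fin d),
      |poissonKernel k t x y| ≤ M * Real.exp (‖x‖ ^ 2) := by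
  obtain ⟨M, hM, h⟩ := exists_abs_subDeriv_mul_ouKernel_le d k ht₀
  refine ⟨M, hM, fun t ht x y => ?_⟩
  have ht0 : 0 < t / 4 := by linarith [ht₀.trans_le ht]
  have hint : ∫ s in Ioi (0 : ℝ), subDeriv 0 (t / 4) s = 1 := by
    rw [integral_eq_lintegral_of_nonneg_ae (Eventually.of_forall fun s =>
      subDeriv_zero_nonneg ht0.le s) (integrableOn_subDeriv_zero ht0).1, lintegral_subDeriv_zero ht0,
      ENNReal.toReal_one]
  calc |poissonKernel k t x y| ≤ ∫ s in Ioi (0 : ℝ), M * Real.exp (‖x‖ ^ 2) * subDeriv 0 (t / 4) s := by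
        unfold poissonKernel
        rw [← Real.norm_eq_abs]
        refine norm_integral_le_of_norm_le ((integrableOn_subDeriv_zero ht0).const_mul _) ?_
        filter_upwards [ae_restrict_mem measurableSet_Ioi] with s hs
        rw [Real.norm_eq_abs, abs_mul, abs_of_pos (ouKernel_pos hs x y)]
        exact h t s ht hs x y
    _ = _ := by rw [integral_const_mul, hint, mul_one]

theorem poissonKernel_zero_nonneg {t : ℝ} (ht : 0 < t) (x y : EuclideanSpace ℝ (Fin d)) :
    0 ≤ poissonKernel 0 t x y := by
  refine setIntegral_nonneg measurableSet_Ioi fun s hs => ?_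
  exact mul_nonneg (subDeriv_zero_nonneg ht.le s) (ouKernel_pos hs x y).le

/-- The derivatives of the Poisson kernel are dominated by the Poisson kernel. -/
theorem exists_abs_poissonKernel_le_zero (d k : ℕ) :
    ∃ M : ℝ, 0 < M ∧ ∀ t, 0 < t → ∀ x y : EuclideanSpace ℝ (Fin d),
      |poissonKernel k t x y| ≤ M * (t ^ k)⁻¹ * poissonKernel 0 (t / 2) x y := by
  obtain ⟨M, hM, h⟩ := exists_abs_subDeriv_le k
  refine ⟨M, hM, fun t ht x y => ?_⟩
  rw [poissonKernel, poissonKernel, ← integral_const_mul, ← Real.norm_eq_abs]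
  refine norm_integral_le_of_norm_le
    ((integrableOn_subDeriv_mul_ouKernel 0 (half_pos ht) x y).const_mul _) ?_
  filter_upwards [ae_restrict_mem measurableSet_Ioi] with s hs
  rw [Real.norm_eq_abs, abs_mul, abs_of_pos (ouKernel_pos hs x y), ← mul_assoc]
  exact mul_le_mul_of_nonneg_right (h t s ht) (ouKernel_pos hs x y).le

theorem hasDerivAt_poissonKernel (k : ℕ) {t : ℝ} (ht : 0 < t) (x y : EuclideanSpace ℝ (Fin d)) :
    HasDerivAt (fun t => poissonKernel k t x y) (poissonKernel (k + 1) t x y) t := by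
  obtain ⟨M, hM, h⟩ := exists_abs_subDeriv_mul_ouKernel_le d (k + 1) (half_pos ht)
  refine (hasDerivAt_integral_of_dominated_loc_of_deriv_le
    (F := fun t s => subDeriv k t s * ouKernel s x y)
    (F' := fun t s => subDeriv (k + 1) t s * ouKernel s x y)
    -- For `t/2 < u < 2t` one has `t/8 ≤ u/4 ≤ 4 · t/8`, so a single density at time `t/8`
    -- dominates.
    (bound := fun s => M * Real.exp (‖x‖ ^ 2) * (4 * subDeriv 0 (t / 8) s))
    (Ioo_mem_nhds (by linarith : t / 2 < t) (by linarith : t < 2 * t)) ?_ ?_ ?_ ?_ ?_ ?_).2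
  · exact Eventually.of_forall fun t => (measurable_subDeriv_mul_ouKernel k t x y).aestronglyMeasurable
  · exact integrableOn_subDeriv_mul_ouKernel k ht x y
  · exact (measurable_subDeriv_mul_ouKernel (k + 1) t x y).aestronglyMeasurable
  · filter_upwards [ae_restrict_mem measurableSet_Ioi] with s hs u hu
    rw [Real.norm_eq_abs, abs_mul, abs_of_pos (ouKernel_pos hs x y)]
    refine (h u s hu.1.le hs x y).trans ?_
    gcongr
    exact subDeriv_zero_le_mul (by positivity) (by linarith [hu.1]) (by linarith [hu.2]) s
  · exact ((integrableOn_subDeriv_zero (by positivity)).const_mul 4).const_mul _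
  · exact Eventually.of_forall fun s u _ => (hasDerivAt_subDeriv k u s).mul_const _

theorem ofReal_poissonKernel_zero {t : ℝ} (ht : 0 < t) (x y : EuclideanSpace ℝ (Fin d)) :
    ENNReal.ofReal (poissonKernel 0 t x y)
      = ∫⁻ s in Ioi (0 : ℝ), ENNReal.ofReal (subDeriv 0 t s) * ENNReal.ofReal (ouKernel s x y) := by
  unfold poissonKernel
  rw [ofReal_integral_eq_lintegral_ofReal (integrableOn_subDeriv_mul_ouKernel 0 ht x y)]
  · exact lintegral_congr fun s => ENNReal.ofReal_mul (subDeriv_zero_nonneg ht.le s)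
  · filter_upwards [ae_restrict_mem measurableSet_Ioi] with s hs
    exact mul_nonneg (subDeriv_zero_nonneg ht.le s) (ouKernel_pos hs x y).le

theorem measurable_sub_mul_ou (t : ℝ) (x : EuclideanSpace ℝ (Fin d)) :
    Measurable (Function.uncurry fun (y : EuclideanSpace ℝ (Fin d)) (s : ℝ) =>
      ENNReal.ofReal (subDeriv 0 t s) * ENNReal.ofReal (ouKernel s x y)) := by
  refine Measurable.mul (f := fun z : EuclideanSpace ℝ (Fin d) × ℝ =>
    ENNReal.ofReal (subDeriv 0 t z.2)) (g := fun z => ENNReal.ofReal (ouKernel z.2 x z.1)) ?_ ?_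
  · exact (measurable_subDeriv_comp 0 measurable_const measurable_snd).ennreal_ofReal
  · exact (measurable_ouKernel_comp measurable_snd measurable_const measurable_fst).ennreal_ofReal

/-- `P_t` on nonnegative functions is an average of the operators `T_s`. -/
theorem lintegral_poissonKernel_mul {t : ℝ} (ht : 0 < t) {f : EuclideanSpace ℝ (Fin d) → ℝ≥0∞}
    (hf : Measurable f) (x : EuclideanSpace ℝ (Fin d)) :
    ∫⁻ y, ENNReal.ofReal (poissonKernel 0 t x y) * f y ∂(gammaD d)
      = ∫⁻ s in Ioi (0 : ℝ), ENNReal.ofReal (subDeriv 0 t s) * ouLintegral s f x := by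
  have hm := measurable_sub_mul_ou t x
  calc _ = ∫⁻ y, (∫⁻ s in Ioi (0 : ℝ), ENNReal.ofReal (subDeriv 0 t s) *
        ENNReal.ofReal (ouKernel s x y) * f y) ∂(gammaD d) := by
        refine lintegral_congr fun y => ?_
        rw [ofReal_poissonKernel_zero ht, lintegral_mul_const _ hm.of_uncurry_left]
    _ = ∫⁻ s in Ioi (0 : ℝ), (∫⁻ y, ENNReal.ofReal (subDeriv 0 t s) *
        ENNReal.ofReal (ouKernel s x y) * f y ∂(gammaD d)) :=
        lintegral_lintegral_swap (hm.mul (hf.comp measurable_fst)).aemeasurable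
    _ = _ := by
        refine lintegral_congr fun s => ?_
        unfold ouLintegral
        rw [← lintegral_const_mul' _ _ ENNReal.ofReal_ne_top]
        simp_rw [mul_assoc]

theorem lintegral_poissonKernel {t : ℝ} (ht : 0 < t) (x : EuclideanSpace ℝ (Fin d)) :
    ∫⁻ y, ENNReal.ofReal (poissonKernel 0 t x y) ∂(gammaD d) = 1 := by
  have h := lintegral_poissonKernel_mul ht (f := fun _ => 1) measurable_const x
  simp only [mul_one] at h
  rw [h]
  refine Eq.trans ?_ (lintegral_subDeriv_zero ht)
  refine setLIntegral_congr_fun measurableSet_Ioi fun s hs => ?_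
  simp only [ouLintegral, mul_one]
  rw [lintegral_ouKernel hs, mul_one]

theorem lintegral_poissonKernel_left {t : ℝ} (ht : 0 < t) (y : EuclideanSpace ℝ (Fin d)) :
    ∫⁻ x, ENNReal.ofReal (poissonKernel 0 t x y) ∂(gammaD d) = 1 := by
  simp_rw [poissonKernel_comm 0 t _ y]
  exact lintegral_poissonKernel ht y

/-- Tonelli turns this into Chapman–Kolmogorov for the Mehler kernel, integrated against the
convolution semigroup of the subordinator. -/
theorem lintegral_poissonKernel_mul_poissonKernel {t t' : ℝ} (ht : 0 < t) (ht' : 0 < t')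
    (x z : EuclideanSpace ℝ (Fin d)) :
    ∫⁻ y, ENNReal.ofReal (poissonKernel 0 t x y) * ENNReal.ofReal (poissonKernel 0 t' y z) ∂(gammaD d)
      = ENNReal.ofReal (poissonKernel 0 (t + t') x z) := by
  have hG : Measurable fun s => ENNReal.ofReal (ouKernel s x z) :=
    (measurable_ouKernel_comp measurable_id measurable_const measurable_const).ennreal_ofReal
  have hf : Measurable fun y => ENNReal.ofReal (poissonKernel 0 t' y z) := by
    exact (measurable_poissonKernel_comp 0 measurable_const measurable_id
      measurable_const).ennreal_ofReal
  rw [lintegral_poissonKernel_mul ht hf, ofReal_poissonKernel_zero (add_pos ht ht'),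
    ← lintegral_lintegral_subDeriv_zero ht ht' hG]
  refine setLIntegral_congr_fun measurableSet_Ioi fun s hs => ?_
  rw [lintegral_const_mul' _ _ ENNReal.ofReal_ne_top]
  congr 1
  unfold ouLintegral
  calc _ = ∫⁻ y, ENNReal.ofReal (poissonKernel 0 t' z y) * ENNReal.ofReal (ouKernel s x y) ∂(gammaD d) := by
        simp_rw [poissonKernel_comm 0 t' _ z, mul_comm]
    _ = ∫⁻ s' in Ioi (0 : ℝ), ENNReal.ofReal (subDeriv 0 t' s') *
          ouLintegral s' (fun y => ENNReal.ofReal (ouKernel s x y)) z :=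
        lintegral_poissonKernel_mul ht' (measurable_ouKernel_comp measurable_const measurable_const
          measurable_id).ennreal_ofReal z
    _ = _ := by
        refine setLIntegral_congr_fun measurableSet_Ioi fun s' hs' => ?_
        simp only [ouLintegral]
        congr 1
        rw [← lintegral_ouKernel_mul_ouKernel hs hs']
        refine lintegral_congr fun y => ?_
        rw [mul_comm, ouKernel_comm s' z y]

end Kernels

/-! ### The Poisson-Hermite semigroup -/

section Poisson

variable {d : ℕ}

/-- Bochner subordination in the variable `s = t²/4u`. -/
theorem subordination_eq {t : ℝ} (ht : 0 < t) (Φ : ℝ → ℝ) :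
    1 / √Real.pi * ∫ u in Ioi (0 : ℝ), Real.exp (-u) / √u * Φ (t ^ 2 / (4 * u))
      = ∫ s in Ioi (0 : ℝ), subDeriv 0 t s * Φ s := by
  set f : ℝ → ℝ := fun s => t ^ 2 / 4 * s⁻¹ with hf
  have hder : ∀ s ∈ Ioi (0 : ℝ), HasDerivWithinAt f (t ^ 2 / 4 * (-(s ^ 2)⁻¹)) (Ioi 0) s :=
    fun s hs => ((hasDerivAt_inv (ne_of_gt hs : s ≠ 0)).const_mul _).hasDerivWithinAt
  have hinv : ∀ s, 0 < s → f (f s) = s := fun s hs => by simp only [hf]; field_simp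
  have hpos : ∀ s, 0 < s → 0 < f s := fun s hs => by simp only [hf]; positivity
  have hinj : InjOn f (Ioi 0) := by
    intro u hu v hv huv
    rw [← hinv u hu, ← hinv v hv, huv]
  have himg : f '' Ioi 0 = Ioi 0 := by
    ext z
    constructor
    · rintro ⟨v, hv, rfl⟩; exact hpos v hv
    · intro hz; exact ⟨f z, hpos z hz, hinv z hz⟩
  have h := integral_image_eq_integral_abs_deriv_smul measurableSet_Ioi hder hinj
    (fun u => Real.exp (-u) / √u * Φ (t ^ 2 / (4 * u)))
  rw [himg] at h
  rw [h, ← integral_const_mul]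
  refine setIntegral_congr_fun measurableSet_Ioi fun s hs => ?_
  have hs0 : (0 : ℝ) < s := hs
  have e1 : t ^ 2 / (4 * f s) = s := by simp only [hf]; field_simp
  have e2 : √(f s) = t / 2 * (√s)⁻¹ := by
    have : f s = (t / 2) ^ 2 * s⁻¹ := by simp only [hf]; ring
    rw [this, Real.sqrt_mul (by positivity), Real.sqrt_sq (by positivity), Real.sqrt_inv]
  have e3 : -f s = -(t * (√s)⁻¹) ^ 2 / 4 := by
    simp only [hf]
    rw [mul_pow, inv_pow, Real.sq_sqrt hs0.le]; ring
  have e4 : (s ^ 2)⁻¹ = (√s)⁻¹ ^ 4 := by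
    rw [show (4 : ℕ) = 2 * 2 by norm_num, pow_mul, inv_pow, Real.sq_sqrt hs0.le, inv_pow]
  simp only [smul_eq_mul]
  rw [e1, e2, e3, mul_neg, abs_neg, abs_of_pos (by positivity), subDeriv_zero, e4]
  have hsq : √s ≠ 0 := by positivity
  field_simp
  ring

/-- `∂_t^k P_t` as an integral operator. -/
def poissonOp (k : ℕ) (t : ℝ) (f : EuclideanSpace ℝ (Fin d) → ℝ) (x : EuclideanSpace ℝ (Fin d)) :
    ℝ := ∫ y, poissonKernel k t x y * f y ∂(gammaD d)

theorem poissonOp_congr (k : ℕ) (t : ℝ) {f g : EuclideanSpace ℝ (Fin d) → ℝ}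
    (h : f =ᵐ[gammaD d] g) : poissonOp k t f = poissonOp k t g := by
  funext x
  refine integral_congr_ae ?_
  filter_upwards [h] with y hy
  rw [hy]

/-- Fubini for each `x`, justified by the majorant of the kernel that does not depend on `y`. -/
theorem poissonHermite_eq {t : ℝ} (ht : 0 < t) {f : EuclideanSpace ℝ (Fin d) → ℝ}
    (hf : Integrable f (gammaD d)) (x : EuclideanSpace ℝ (Fin d)) :
    poissonHermite t f x = poissonOp 0 t f x := by
  unfold poissonHermite
  rw [subordination_eq ht (fun s => ouSemigroup s f x)]
  simp only [ouSemigroup_eq, ← integral_const_mul]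
  obtain ⟨M, hM, h⟩ := exists_abs_subDeriv_mul_ouKernel_le d 0 ht
  have hint : Integrable (Function.uncurry fun (s : ℝ) (y : EuclideanSpace ℝ (Fin d)) =>
      subDeriv 0 t s * (ouKernel s x y * f y)) ((volume.restrict (Ioi 0)).prod (gammaD d)) := by
    have hb := ((integrableOn_subDeriv_zero (by positivity : 0 < t / 4)).const_mul
      (M * Real.exp (‖x‖ ^ 2))).mul_prod hf.abs
    refine Integrable.mono' hb ?_ ?_
    · have h1 : Measurable fun z : ℝ × EuclideanSpace ℝ (Fin d) =>
          subDeriv 0 t z.1 * ouKernel z.1 x z.2 :=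
        (measurable_subDeriv_comp 0 measurable_const measurable_fst).mul
          (measurable_ouKernel_comp measurable_fst measurable_const measurable_snd)
      have h2 := h1.aestronglyMeasurable.mul
        (hf.1.comp_snd (μ := (volume : Measure ℝ).restrict (Ioi 0)))
      refine h2.congr (Eventually.of_forall fun z => ?_)
      simp only [Pi.mul_apply, Function.uncurry, mul_assoc]
    · have hae : ∀ᵐ z ∂((volume : Measure ℝ).restrict (Ioi 0)).prod (gammaD d), z.1 ∈ Ioi (0 : ℝ) :=
        Measure.quasiMeasurePreserving_fst.ae (ae_restrict_mem measurableSet_Ioi)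
      filter_upwards [hae] with z hz
      simp only [Function.uncurry]
      rw [← mul_assoc, norm_mul, norm_mul, Real.norm_eq_abs, Real.norm_eq_abs, Real.norm_eq_abs,
        abs_of_pos (ouKernel_pos hz x z.2)]
      exact mul_le_mul_of_nonneg_right (h t z.1 le_rfl hz x z.2) (abs_nonneg _)
  rw [integral_integral_swap hint]
  unfold poissonOp poissonKernel
  refine integral_congr_ae (Eventually.of_forall fun y => ?_)
  simp only [← mul_assoc]
  rw [integral_mul_const]

theorem integrable_poissonKernel_mul (k : ℕ) {t : ℝ} (ht : 0 < t)
    {f : EuclideanSpace ℝ (Fin d) → ℝ} (hf : Integrable f (gammaD d))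
    (x : EuclideanSpace ℝ (Fin d)) :
    Integrable (fun y => poissonKernel k t x y * f y) (gammaD d) := by
  obtain ⟨M, hM, h⟩ := exists_abs_poissonKernel_le d k ht
  exact hf.bdd_mul (measurable_poissonKernel_comp k measurable_const measurable_const
    measurable_id).aestronglyMeasurable (Eventually.of_forall fun y => h t le_rfl x y)

theorem integrable_poissonKernel (k : ℕ) {t : ℝ} (ht : 0 < t) (x : EuclideanSpace ℝ (Fin d)) :
    Integrable (poissonKernel k t x) (gammaD d) := by
  simpa using integrable_poissonKernel_mul k ht (integrable_const (1 : ℝ)) x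

theorem hasDerivAt_poissonOp (k : ℕ) {t : ℝ} (ht : 0 < t) {f : EuclideanSpace ℝ (Fin d) → ℝ}
    (hf : Integrable f (gammaD d)) (x : EuclideanSpace ℝ (Fin d)) :
    HasDerivAt (fun t => poissonOp k t f x) (poissonOp (k + 1) t f x) t := by
  obtain ⟨M, hM, h⟩ := exists_abs_poissonKernel_le d (k + 1) (half_pos ht)
  have hm : ∀ (k : ℕ) (t : ℝ), AEStronglyMeasurable (fun y => poissonKernel k t x y * f y) (gammaD d) :=
    fun k t => (measurable_poissonKernel_comp k measurable_const measurable_const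
      measurable_id).aestronglyMeasurable.mul hf.1
  refine (hasDerivAt_integral_of_dominated_loc_of_deriv_le
    (F := fun t y => poissonKernel k t x y * f y)
    (F' := fun t y => poissonKernel (k + 1) t x y * f y)
    (bound := fun y => M * Real.exp (‖x‖ ^ 2) * |f y|)
    (Ioi_mem_nhds (by linarith : t / 2 < t)) ?_ ?_ ?_ ?_ ?_ ?_).2
  · exact Eventually.of_forall fun t => hm k t
  · exact integrable_poissonKernel_mul k ht hf x
  · exact hm (k + 1) t
  · refine Eventually.of_forall fun y u hu => ?_
    rw [norm_mul, Real.norm_eq_abs, Real.norm_eq_abs]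
    exact mul_le_mul_of_nonneg_right (h u (le_of_lt hu) x y) (abs_nonneg _)
  · exact hf.abs.const_mul _
  · refine Eventually.of_forall fun y u hu => ?_
    exact (hasDerivAt_poissonKernel k ((half_pos ht).trans hu) x y).mul_const _

theorem poissonDeriv_eq (k : ℕ) {t : ℝ} (ht : 0 < t) {f : EuclideanSpace ℝ (Fin d) → ℝ}
    (hf : Integrable f (gammaD d)) (x : EuclideanSpace ℝ (Fin d)) :
    poissonDeriv k f t x = poissonOp k t f x := by
  unfold poissonDeriv
  induction k generalizing t with
  | zero => rw [iteratedDeriv_zero]; exact poissonHermite_eq ht hf x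
  | succ k ih =>
    rw [iteratedDeriv_succ]
    have : iteratedDeriv k (fun s => poissonHermite s f x) =ᶠ[𝓝 t] fun t => poissonOp k t f x := by
      filter_upwards [Ioi_mem_nhds ht] with s hs using ih hs
    rw [this.deriv_eq]
    exact (hasDerivAt_poissonOp k ht hf x).deriv

theorem integral_poissonKernel_mul_zero {t s : ℝ} (ht : 0 < t) (hs : 0 < s)
    (x z : EuclideanSpace ℝ (Fin d)) :
    ∫ y, poissonKernel 0 t x y * poissonKernel 0 s y z ∂(gammaD d) = poissonKernel 0 (t + s) x z := by
  have hm : Measurable fun y => poissonKernel 0 t x y * poissonKernel 0 s y z :=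
    (measurable_poissonKernel_comp 0 measurable_const measurable_const measurable_id).mul
      (measurable_poissonKernel_comp 0 measurable_const measurable_id measurable_const)
  rw [integral_eq_lintegral_of_nonneg_ae (Eventually.of_forall fun y =>
    mul_nonneg (poissonKernel_zero_nonneg ht x y) (poissonKernel_zero_nonneg hs y z))
    hm.aestronglyMeasurable]
  simp_rw [ENNReal.ofReal_mul (poissonKernel_zero_nonneg ht x _)]
  rw [lintegral_poissonKernel_mul_poissonKernel ht hs,
    ENNReal.toReal_ofReal (poissonKernel_zero_nonneg (add_pos ht hs) x z)]

/-- Both sides are differentiated in `t`, starting from the semigroup identity;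
`poissonOp_poissonKernel` then differentiates in `s`. -/
theorem poissonOp_poissonKernel_zero (i : ℕ) {t s : ℝ} (ht : 0 < t) (hs : 0 < s)
    (x z : EuclideanSpace ℝ (Fin d)) :
    poissonOp i t (poissonKernel 0 s z) x = poissonKernel i (t + s) x z := by
  induction i generalizing t with
  | zero =>
    rw [← integral_poissonKernel_mul_zero ht hs]
    unfold poissonOp
    simp_rw [poissonKernel_comm 0 s z]
  | succ i ih =>
    have h1 := hasDerivAt_poissonOp i ht (integrable_poissonKernel 0 hs z) x
    have h2 : HasDerivAt (fun t => poissonKernel i (t + s) x z)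
        (poissonKernel (i + 1) (t + s) x z) t :=
      (hasDerivAt_poissonKernel i (add_pos ht hs) x z).comp_add_const t s
    refine h1.unique (h2.congr_of_eventuallyEq ?_)
    filter_upwards [Ioi_mem_nhds ht] with u hu using ih hu

theorem poissonOp_poissonKernel (i j : ℕ) {t s : ℝ} (ht : 0 < t) (hs : 0 < s)
    (x z : EuclideanSpace ℝ (Fin d)) :
    poissonOp j s (poissonKernel i t x) z = poissonKernel (i + j) (t + s) x z := by
  induction j generalizing s with
  | zero =>
    rw [add_zero, ← poissonOp_poissonKernel_zero i ht hs]
    unfold poissonOp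
    simp_rw [mul_comm]
  | succ j ih =>
    have h1 := hasDerivAt_poissonOp j hs (integrable_poissonKernel i ht x) z
    have h2 : HasDerivAt (fun s => poissonKernel (i + j) (t + s) x z)
        (poissonKernel (i + j + 1) (t + s) x z) s :=
      (hasDerivAt_poissonKernel (i + j) (add_pos ht hs) x z).comp_const_add t s
    refine h1.unique (h2.congr_of_eventuallyEq ?_)
    filter_upwards [Ioi_mem_nhds hs] with u hu using ih hu

/-- `P_t` preserves the integral of nonnegative functions. -/
theorem lintegral_lintegral_poissonKernel_mul {t : ℝ} (ht : 0 < t)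
    {f : EuclideanSpace ℝ (Fin d) → ℝ≥0∞} (hf : AEMeasurable f (gammaD d)) :
    ∫⁻ x, ∫⁻ y, ENNReal.ofReal (poissonKernel 0 t x y) * f y ∂(gammaD d) ∂(gammaD d)
      = ∫⁻ y, f y ∂(gammaD d) := by
  have hm : Measurable (Function.uncurry fun x y : EuclideanSpace ℝ (Fin d) =>
      ENNReal.ofReal (poissonKernel 0 t x y)) :=
    (measurable_poissonKernel_comp 0 measurable_const measurable_fst measurable_snd).ennreal_ofReal
  rw [lintegral_lintegral_swap (hm.aemeasurable.mul hf.comp_snd)]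
  refine lintegral_congr fun y => ?_
  rw [lintegral_mul_const _ hm.of_uncurry_right, lintegral_poissonKernel_left ht, one_mul]

theorem integrable_poissonKernel_mul_prod (k : ℕ) {t : ℝ} (ht : 0 < t)
    {f : EuclideanSpace ℝ (Fin d) → ℝ} (hf : Integrable f (gammaD d)) :
    Integrable (fun z : EuclideanSpace ℝ (Fin d) × EuclideanSpace ℝ (Fin d) =>
      poissonKernel k t z.1 z.2 * f z.2) ((gammaD d).prod (gammaD d)) := by
  obtain ⟨M, hM, h⟩ := exists_abs_poissonKernel_le_zero d k
  have hm : AEStronglyMeasurable (fun z : EuclideanSpace ℝ (Fin d) × EuclideanSpace ℝ (Fin d) =>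
      poissonKernel k t z.1 z.2 * f z.2) ((gammaD d).prod (gammaD d)) :=
    (measurable_poissonKernel_comp k measurable_const measurable_fst
      measurable_snd).aestronglyMeasurable.mul hf.1.comp_snd
  refine ⟨hm, ?_⟩
  rw [hasFiniteIntegral_iff_enorm, lintegral_prod _ hm.enorm]
  calc ∫⁻ x, ∫⁻ y, ‖poissonKernel k t x y * f y‖ₑ ∂(gammaD d) ∂(gammaD d)
      ≤ ∫⁻ x, ∫⁻ y, ENNReal.ofReal (M * (t ^ k)⁻¹) *
        (ENNReal.ofReal (poissonKernel 0 (t / 2) x y) * ‖f y‖ₑ) ∂(gammaD d) ∂(gammaD d) := by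
        refine lintegral_mono fun x => lintegral_mono fun y => ?_
        rw [enorm_mul, ← mul_assoc, ← ENNReal.ofReal_mul (by positivity)]
        gcongr
        rw [Real.enorm_eq_ofReal_abs]
        exact ENNReal.ofReal_le_ofReal (h t ht x y)
    _ = ENNReal.ofReal (M * (t ^ k)⁻¹) * ∫⁻ y, ‖f y‖ₑ ∂(gammaD d) := by
        simp_rw [lintegral_const_mul' _ _ (ENNReal.ofReal_ne_top (r := M * (t ^ k)⁻¹))]
        rw [lintegral_lintegral_poissonKernel_mul (half_pos ht) hf.1.enorm]
    _ < ∞ := ENNReal.mul_lt_top ENNReal.ofReal_lt_top (hasFiniteIntegral_iff_enorm.1 hf.2)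

theorem integrable_poissonOp (k : ℕ) {t : ℝ} (ht : 0 < t) {f : EuclideanSpace ℝ (Fin d) → ℝ}
    (hf : Integrable f (gammaD d)) : Integrable (poissonOp k t f) (gammaD d) :=
  (integrable_poissonKernel_mul_prod k ht hf).integral_prod_left

/-- The semigroup property of `P_t` and its derivatives. -/
theorem poissonOp_poissonOp (i j : ℕ) {t s : ℝ} (ht : 0 < t) (hs : 0 < s)
    {f : EuclideanSpace ℝ (Fin d) → ℝ} (hf : Integrable f (gammaD d))
    (x : EuclideanSpace ℝ (Fin d)) :
    poissonOp i t (poissonOp j s f) x = poissonOp (i + j) (t + s) f x := by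
  obtain ⟨M, hM, h⟩ := exists_abs_poissonKernel_le d i ht
  have hint : Integrable (Function.uncurry fun y z : EuclideanSpace ℝ (Fin d) =>
      poissonKernel i t x y * (poissonKernel j s y z * f z)) ((gammaD d).prod (gammaD d)) :=
    (integrable_poissonKernel_mul_prod j hs hf).bdd_mul
      (f := fun z : EuclideanSpace ℝ (Fin d) × EuclideanSpace ℝ (Fin d) => poissonKernel i t x z.1)
      (measurable_poissonKernel_comp i measurable_const measurable_const
        measurable_fst).aestronglyMeasurable
      (Eventually.of_forall fun z => h t le_rfl x z.1)
  calc poissonOp i t (poissonOp j s f) x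
      = ∫ y, ∫ z, poissonKernel i t x y * (poissonKernel j s y z * f z) ∂(gammaD d) ∂(gammaD d) := by
        simp only [poissonOp, integral_const_mul]
    _ = ∫ z, ∫ y, poissonKernel i t x y * (poissonKernel j s y z * f z) ∂(gammaD d) ∂(gammaD d) :=
        integral_integral_swap hint
    _ = poissonOp (i + j) (t + s) f x := by
        unfold poissonOp
        refine integral_congr_ae (Eventually.of_forall fun z => ?_)
        simp only
        rw [← poissonOp_poissonKernel i j ht hs, poissonOp, ← integral_mul_const]
        refine integral_congr_ae (Eventually.of_forall fun y => ?_)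
        simp only
        rw [poissonKernel_comm j s z y]
        ring

theorem measurable_ouLintegral {f : EuclideanSpace ℝ (Fin d) → ℝ≥0∞} (hf : Measurable f) :
    Measurable (Function.uncurry fun s => ouLintegral s f) := by
  have h : Measurable (Function.uncurry fun (z : ℝ × EuclideanSpace ℝ (Fin d))
      (y : EuclideanSpace ℝ (Fin d)) => ENNReal.ofReal (ouKernel z.1 z.2 y) * f y) :=
    (measurable_ouKernel_comp (by fun_prop) (by fun_prop) (by fun_prop)).ennreal_ofReal.mul
      (hf.comp measurable_snd)
  exact h.lintegral_prod_right

variable {p : EuclideanSpace ℝ (Fin d) → ℝ} {C : ℝ≥0∞}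

/-- Uniform boundedness of `P_t` on nonnegative functions. -/
theorem luxNorm_poisson_le (hp1 : ∀ x, 1 ≤ p x) (hpm : Measurable p)
    (hT : ∀ s, 0 < s → ∀ f : EuclideanSpace ℝ (Fin d) → ℝ≥0∞, Measurable f →
      luxNorm p (gammaD d) (ouLintegral s f) ≤ C * luxNorm p (gammaD d) f)
    {t : ℝ} (ht : 0 < t) {f : EuclideanSpace ℝ (Fin d) → ℝ≥0∞} (hf : Measurable f) :
    luxNorm p (gammaD d) (fun x => ∫⁻ y, ENNReal.ofReal (poissonKernel 0 t x y) * f y ∂(gammaD d))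
      ≤ C * luxNorm p (gammaD d) f := by
  set w : ℝ → ℝ≥0∞ := fun s => ENNReal.ofReal (subDeriv 0 t s) with hw
  have hwm : Measurable w :=
    (measurable_subDeriv_comp 0 measurable_const measurable_id).ennreal_ofReal
  -- The subordinator as a probability measure: `P_t` is an average of the `T_s`, and Minkowski's
  -- inequality preserves the constant `C`.
  set ν : Measure ℝ := (volume.restrict (Ioi 0)).withDensity w with hν
  have hwl : ∀ g : ℝ → ℝ≥0∞, ∫⁻ s, g s ∂ν = ∫⁻ s in Ioi (0 : ℝ), w s * g s := fun g =>
    lintegral_withDensity_eq_lintegral_mul_non_measurable _ hwm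
      (Eventually.of_forall fun _ => ENNReal.ofReal_lt_top) g
  have hν1 : ν univ = 1 := by
    have := hwl (fun _ => 1)
    simpa [hw, lintegral_subDeriv_zero ht] using this
  have : IsFiniteMeasure ν := ⟨by rw [hν1]; exact ENNReal.one_lt_top⟩
  have h := luxNorm_lintegral_le (μ := gammaD d) (ν := ν) (Eventually.of_forall hp1)
    hpm.aemeasurable (measurable_ouLintegral hf)
    (N := fun _ => C * luxNorm p (gammaD d) f) measurable_const ?_
  · rw [lintegral_const, hν1, mul_one] at h
    refine le_trans (le_of_eq ?_) h
    congr 1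
    funext x
    rw [hwl]
    exact lintegral_poissonKernel_mul ht hf x
  · have hac : ∀ᵐ s ∂ν, s ∈ Ioi (0 : ℝ) :=
      (withDensity_absolutelyContinuous _ _).ae_le (ae_restrict_mem measurableSet_Ioi)
    filter_upwards [hac] with s hs using hT s hs f hf

/-- Smoothing estimates for `P_t` on `L^{p(·)}(γ_d)`. -/
theorem exists_varNorm_poissonOp_le (hp1 : ∀ x, 1 ≤ p x) (hpm : Measurable p) (hC0 : C ≠ 0)
    (hCt : C ≠ ∞) (hT : ∀ s, 0 < s → ∀ f : EuclideanSpace ℝ (Fin d) → ℝ≥0∞, Measurable f →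
      luxNorm p (gammaD d) (ouLintegral s f) ≤ C * luxNorm p (gammaD d) f) (k : ℕ) :
    ∃ M : ℝ≥0∞, M ≠ 0 ∧ M ≠ ∞ ∧ ∀ t, 0 < t → ∀ f : EuclideanSpace ℝ (Fin d) → ℝ,
      AEStronglyMeasurable f (gammaD d) →
      varNorm p (gammaD d) (poissonOp k t f)
        ≤ M * ENNReal.ofReal (t ^ k)⁻¹ * varNorm p (gammaD d) f := by
  obtain ⟨M, hM, h⟩ := exists_abs_poissonKernel_le_zero d k
  have hM0 : ENNReal.ofReal M ≠ 0 := by simpa using hM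
  refine ⟨ENNReal.ofReal M * C, mul_ne_zero hM0 hC0, ENNReal.mul_ne_top (by simp) hCt,
    fun t ht f hf => ?_⟩
  rw [poissonOp_congr k t hf.ae_eq_mk]
  have hv : varNorm p (gammaD d) f = varNorm p (gammaD d) (hf.mk f) :=
    luxNorm_congr_ae (by filter_upwards [hf.ae_eq_mk] with x hx; rw [← hx])
  rw [hv]
  have hgm : Measurable fun y => ‖hf.mk f y‖ₑ := hf.stronglyMeasurable_mk.measurable.enorm
  set g := hf.mk f
  have ht0 : ENNReal.ofReal (t ^ k)⁻¹ ≠ 0 := by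
    have : 0 < (t ^ k)⁻¹ := by positivity
    simpa using pow_pos ht k
  calc varNorm p (gammaD d) (poissonOp k t g)
      ≤ luxNorm p (gammaD d) (fun x => (ENNReal.ofReal M * ENNReal.ofReal (t ^ k)⁻¹) *
          ∫⁻ y, ENNReal.ofReal (poissonKernel 0 (t / 2) x y) * ‖g y‖ₑ ∂(gammaD d)) := by
        refine luxNorm_mono (Eventually.of_forall hp1) (Eventually.of_forall fun x => ?_)
        refine (enorm_integral_le_lintegral_enorm _).trans ?_
        rw [← lintegral_const_mul' _ _ (ENNReal.mul_ne_top (by simp) (by simp))]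
        refine lintegral_mono fun y => ?_
        rw [enorm_mul, ← mul_assoc, ← ENNReal.ofReal_mul hM.le, ← ENNReal.ofReal_mul (by positivity)]
        gcongr
        rw [Real.enorm_eq_ofReal_abs]
        exact ENNReal.ofReal_le_ofReal (h t ht x y)
    _ ≤ (ENNReal.ofReal M * ENNReal.ofReal (t ^ k)⁻¹) * (C * varNorm p (gammaD d) g) :=
        (luxNorm_const_mul_le (mul_ne_zero hM0 ht0) (ENNReal.mul_ne_top (by simp) (by simp))).trans
          (mul_le_mul' le_rfl (luxNorm_poisson_le hp1 hpm hT (half_pos ht) hgm))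
    _ = _ := by ring

/-- One has `u ≤ 1 + u^{p(x)}` for `p(x) ≥ 1`, and constants are integrable for the probability
measure `γ_d`. -/
theorem integrable_of_memVarLp (hp1 : ∀ x, 1 ≤ p x) {f : EuclideanSpace ℝ (Fin d) → ℝ}
    (hf : MemVarLp p (gammaD d) f) : Integrable f (gammaD d) := by
  obtain ⟨hm, l, hl, h⟩ := hf
  have hl0 : ENNReal.ofReal l ≠ 0 := by simpa using hl
  refine ⟨hm, ?_⟩
  rw [hasFiniteIntegral_iff_enorm]
  calc ∫⁻ x, ‖f x‖ₑ ∂(gammaD d)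
      ≤ ∫⁻ x, ENNReal.ofReal l * (1 + (‖f x‖ₑ / ENNReal.ofReal l) ^ p x) ∂(gammaD d) := by
        refine lintegral_mono fun x => ?_
        have e : ‖f x‖ₑ = ENNReal.ofReal l * (‖f x‖ₑ / ENNReal.ofReal l) := by
          rw [mul_comm, ENNReal.div_mul_cancel hl0 ENNReal.ofReal_ne_top]
        nth_rewrite 1 [e]
        gcongr
        rcases le_total (‖f x‖ₑ / ENNReal.ofReal l) 1 with h1 | h1
        · exact h1.trans le_self_add
        · exact (ENNReal.le_rpow_self_of_one_le h1 (hp1 x)).trans le_add_self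
    _ = ENNReal.ofReal l * (1 + modular p (gammaD d) fun x => ‖f x‖ₑ / ENNReal.ofReal l) := by
        rw [lintegral_const_mul' _ _ ENNReal.ofReal_ne_top, lintegral_add_left measurable_const]
        simp [modular]
    _ < ∞ := ENNReal.mul_lt_top (by simp) (ENNReal.add_lt_top.2 ⟨by simp, h⟩)

end Poisson

/-! ### Hermite polynomials -/

section Hermite

open Polynomial

/-- The physicists' Hermite polynomials. -/
def hermitePoly : ℕ → ℝ[X]
  | 0 => 1
  | n + 1 => C 2 * X * hermitePoly n - derivative (hermitePoly n)

theorem derivative_hermitePoly_succ (n : ℕ) :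
    derivative (hermitePoly (n + 1)) = C (2 * ((n : ℝ) + 1)) * hermitePoly n := by
  induction n with
  | zero => simp [hermitePoly]
  | succ n ih =>
    have h : hermitePoly (n + 1) = C 2 * X * hermitePoly n - derivative (hermitePoly n) := rfl
    have h2 : hermitePoly (n + 2)
        = C 2 * X * hermitePoly (n + 1) - derivative (hermitePoly (n + 1)) := rfl
    rw [h2, derivative_sub, ih, derivative_mul, derivative_mul, derivative_mul, ih, derivative_C,
      derivative_C, derivative_X]
    simp only [map_mul, map_add, map_one, Nat.cast_add, Nat.cast_one, map_natCast]
    linear_combination C 2 * ((n : ℝ[X]) + 1) * (-h)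

theorem iteratedDeriv_exp_neg_sq (n : ℕ) :
    iteratedDeriv n (fun s : ℝ => Real.exp (-s ^ 2))
      = fun y => (-1) ^ n * (hermitePoly n).eval y * Real.exp (-y ^ 2) := by
  induction n with
  | zero => funext y; simp [hermitePoly]
  | succ n ih =>
    funext y
    rw [iteratedDeriv_succ, ih]
    have h1 := ((hermitePoly n).hasDerivAt y).const_mul ((-1 : ℝ) ^ n)
    have h2 : HasDerivAt (fun y : ℝ => Real.exp (-y ^ 2)) (Real.exp (-y ^ 2) * (-(2 * y))) y := by
      have := (((hasDerivAt_id y).pow 2).neg).exp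
      simpa using this
    have h3 : HasDerivAt (fun y => (-1) ^ n * (hermitePoly n).eval y * Real.exp (-y ^ 2)) _ y :=
      h1.mul h2
    rw [h3.deriv]
    simp only [hermitePoly, eval_sub, eval_mul, eval_C, eval_X, pow_succ]
    ring

theorem integrable_gauss_mul_eval {τ : ℝ} (hτ : 0 < τ) (m : ℝ) (Q : ℝ[X]) :
    Integrable fun y : ℝ => Real.exp (-(y - m) ^ 2 / τ) * Q.eval y := by
  have key : ∀ Q : ℝ[X], Integrable fun y : ℝ => Real.exp (-y ^ 2 / τ) * Q.eval y := by
    intro Q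
    induction Q using Polynomial.induction_on' with
    | add p q hp hq =>
      refine (hp.add hq).congr (Eventually.of_forall fun y => ?_)
      simp only [Pi.add_apply, eval_add]; ring
    | monomial n a =>
      have h := (integrable_rpow_mul_exp_neg_mul_sq (inv_pos.2 hτ)
        (s := n) (by have : (0 : ℝ) ≤ n := n.cast_nonneg
                     linarith)).const_mul a
      refine h.congr (Eventually.of_forall fun y => ?_)
      simp only [eval_monomial, Real.rpow_natCast]
      rw [show -τ⁻¹ * y ^ 2 = -y ^ 2 / τ by field_simp]; ring
  have h := (key (Q.comp (X + C m))).comp_sub_right m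
  refine h.congr (Eventually.of_forall fun y => ?_)
  simp

/-- Integration by parts against a Gaussian density. -/
theorem integral_gauss_mul_X_mul {τ : ℝ} (hτ : 0 < τ) (m : ℝ) (Q : ℝ[X]) :
    ∫ y : ℝ, Real.exp (-(y - m) ^ 2 / τ) * (X * Q).eval y
      = m * (∫ y : ℝ, Real.exp (-(y - m) ^ 2 / τ) * Q.eval y)
        + τ / 2 * ∫ y : ℝ, Real.exp (-(y - m) ^ 2 / τ) * (derivative Q).eval y := by
  have hi := fun Q => integrable_gauss_mul_eval hτ m Q
  have hd : ∀ y : ℝ, HasDerivAt (fun y => Real.exp (-(y - m) ^ 2 / τ) * Q.eval y)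
      (Real.exp (-(y - m) ^ 2 / τ) * (derivative Q - C (2 / τ) * ((X - C m) * Q)).eval y) y := by
    intro y
    have h1 : HasDerivAt (fun y : ℝ => Real.exp (-(y - m) ^ 2 / τ))
        (Real.exp (-(y - m) ^ 2 / τ) * (-(2 * (y - m)) / τ)) y := by
      have := (((((hasDerivAt_id y).sub_const m).pow 2).neg).div_const τ).exp
      simpa using this
    refine (h1.mul (Q.hasDerivAt y)).congr_deriv ?_
    simp only [eval_sub, eval_mul, eval_C, eval_X]
    ring
  have h0 := integral_eq_zero_of_hasDerivAt_of_integrable hd (hi _) (hi _)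
  have hsplit : ∀ y : ℝ, Real.exp (-(y - m) ^ 2 / τ) *
      (derivative Q - C (2 / τ) * ((X - C m) * Q)).eval y
      = Real.exp (-(y - m) ^ 2 / τ) * (derivative Q).eval y
        - 2 / τ * (Real.exp (-(y - m) ^ 2 / τ) * (X * Q).eval y)
        + 2 / τ * m * (Real.exp (-(y - m) ^ 2 / τ) * Q.eval y) := by
    intro y
    simp only [eval_sub, eval_mul, eval_C, eval_X]
    ring
  simp only [hsplit] at h0
  have hsub : Integrable fun y : ℝ => Real.exp (-(y - m) ^ 2 / τ) * (derivative Q).eval y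
        - 2 / τ * (Real.exp (-(y - m) ^ 2 / τ) * (X * Q).eval y) :=
    (hi (derivative Q)).sub ((hi (X * Q)).const_mul (2 / τ))
  rw [integral_add hsub ((hi Q).const_mul _),
    integral_sub (hi _) ((hi (X * Q)).const_mul _), integral_const_mul, integral_const_mul] at h0
  field_simp at h0 ⊢
  linarith

/-- The one-dimensional Mehler formula for Hermite polynomials. -/
theorem integral_gauss_mul_hermitePoly {r : ℝ} (hr : r ^ 2 < 1) (x : ℝ) (n : ℕ) :
    ∫ y : ℝ, Real.exp (-(y - r * x) ^ 2 / (1 - r ^ 2)) * (hermitePoly n).eval y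
      = √(Real.pi * (1 - r ^ 2)) * (r ^ n * (hermitePoly n).eval x) := by
  set τ := 1 - r ^ 2 with hτd
  have hτ : 0 < τ := by linarith
  set I : ℝ[X] → ℝ := fun Q => ∫ y : ℝ, Real.exp (-(y - r * x) ^ 2 / τ) * Q.eval y with hI
  have hmulC : ∀ a Q, I (C a * Q) = a * I Q := by
    intro a Q
    simp only [hI, eval_mul, eval_C, ← integral_const_mul]
    exact integral_congr_ae (Eventually.of_forall fun y => by ring)
  have hone : I 1 = √(Real.pi * τ) := by
    have h := integral_gaussian τ⁻¹
    rw [← integral_sub_right_eq_self _ (r * x)] at h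
    simp only [hI, eval_one, mul_one]
    rw [show Real.pi * τ = Real.pi / τ⁻¹ by field_simp, ← h]
    refine integral_congr_ae (Eventually.of_forall fun y => ?_)
    simp only
    congr 1; field_simp
  -- The recursion `H_{n+1} = 2XH_n - H_n'` requires the formula for `H_n'` as well. It is
  -- multiplied by `r` so that the power is `r^n` and not `r^{n-1}`.
  have key : I (hermitePoly n) = √(Real.pi * τ) * (r ^ n * (hermitePoly n).eval x) ∧
      r * I (derivative (hermitePoly n))
        = √(Real.pi * τ) * (r ^ n * (derivative (hermitePoly n)).eval x) := by
    induction n with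
    | zero =>
      have : I 0 = 0 := by simp [hI]
      simp [hermitePoly, hone, this]
    | succ n ih =>
      constructor
      · have h1 : I (hermitePoly (n + 1))
            = 2 * I (X * hermitePoly n) - I (derivative (hermitePoly n)) := by
          rw [← hmulC]
          simp only [hI]
          rw [← integral_sub (integrable_gauss_mul_eval hτ _ _) (integrable_gauss_mul_eval hτ _ _)]
          refine integral_congr_ae (Eventually.of_forall fun y => ?_)
          simp only [hermitePoly, eval_sub, eval_mul, eval_C, eval_X]
          ring
        have h2 : I (X * hermitePoly n) = r * x * I (hermitePoly n)
            + τ / 2 * I (derivative (hermitePoly n)) := integral_gauss_mul_X_mul hτ _ _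
        rw [h1, h2]
        simp only [hermitePoly, eval_sub, eval_mul, eval_C, eval_X]
        linear_combination 2 * r * x * ih.1 - r * ih.2 + I (derivative (hermitePoly n)) * hτd
      · rw [derivative_hermitePoly_succ, hmulC, ih.1, eval_mul, eval_C]
        ring
  exact key.1

variable {d : ℕ}

theorem hermiteFn_eq (ν : Fin d → ℕ) (x : EuclideanSpace ℝ (Fin d)) :
    hermiteFn ν x = 1 / √((2 : ℝ) ^ (∑ i, ν i) * ∏ i, ((ν i).factorial : ℝ)) *
      ∏ i, (hermitePoly (ν i)).eval (x i) := by
  unfold hermiteFn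
  congr 1
  refine Finset.prod_congr rfl fun i _ => ?_
  rw [iteratedDeriv_exp_neg_sq]
  have h1 : ((-1 : ℝ) ^ ν i) * (-1) ^ ν i = 1 := by rw [← mul_pow]; simp
  have h2 : Real.exp (x i ^ 2) * Real.exp (-x i ^ 2) = 1 := by
    rw [← Real.exp_add]; simp
  linear_combination (eval (x i) (hermitePoly (ν i))) * (Real.exp (x i ^ 2) * Real.exp (-x i ^ 2) * h1
    + h2)

/-- The Mehler kernel with respect to Lebesgue measure is a product of one-dimensional Gaussians
centred at `e^{-s}x_i`, so its action on `h_ν` factors over the coordinates. -/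
theorem gaussDensity_mul_ouKernel {s : ℝ} (hs : 0 < s) (x y : EuclideanSpace ℝ (Fin d)) :
    gaussDensity d y * ouKernel s x y = ∏ i, ((√(Real.pi * (1 - Real.exp (-s) ^ 2)))⁻¹ *
      Real.exp (-(y i - Real.exp (-s) * x i) ^ 2 / (1 - Real.exp (-s) ^ 2))) := by
  have hτ := one_sub_exp_pos hs
  rw [exp_neg_two_mul] at hτ
  unfold gaussDensity ouKernel
  rw [exp_neg_two_mul]
  set r := Real.exp (-s)
  set τ := 1 - r ^ 2 with hτd
  rw [Finset.prod_mul_distrib, Finset.prod_const, Finset.card_univ, Fintype.card_fin,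
    ← Real.exp_sum, ← Finset.sum_div, Finset.sum_neg_distrib]
  have h1 : ∑ i, (y i - r * x i) ^ 2 = ‖y‖ ^ 2 - 2 * r * inner ℝ x y + r ^ 2 * ‖x‖ ^ 2 := by
    rw [EuclideanSpace.real_norm_sq_eq, EuclideanSpace.real_norm_sq_eq, PiLp.inner_apply,
      Finset.mul_sum, Finset.mul_sum, ← Finset.sum_sub_distrib, ← Finset.sum_add_distrib]
    refine Finset.sum_congr rfl fun i _ => ?_
    simp only [RCLike.inner_apply, conj_trivial]
    ring
  have h2 : (√(Real.pi * τ))⁻¹ ^ d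
      = 1 / Real.pi ^ ((d : ℝ) / 2) * (1 / τ ^ ((d : ℝ) / 2)) := by
    rw [inv_pow, Real.sqrt_eq_rpow, ← Real.rpow_natCast, ← Real.rpow_mul (by positivity),
      show 1 / 2 * (d : ℝ) = d / 2 by ring, Real.mul_rpow Real.pi_pos.le hτ.le]
    field_simp
  rw [h1, h2]
  have h3 : Real.exp (-(‖y‖ ^ 2 - 2 * r * inner ℝ x y + r ^ 2 * ‖x‖ ^ 2) / τ)
      = Real.exp (-‖y‖ ^ 2) *
        Real.exp (-(r ^ 2 * (‖x‖ ^ 2 + ‖y‖ ^ 2) - 2 * r * inner ℝ x y) / τ) := by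
    rw [← Real.exp_add]
    congr 1
    field_simp
    rw [hτd]; ring
  rw [h3]
  ring

theorem integral_gammaD (f : EuclideanSpace ℝ (Fin d) → ℝ) :
    ∫ x, f x ∂(gammaD d) = ∫ x, gaussDensity d x * f x := by
  have h : gammaD d = volume.withDensity fun x => ENNReal.ofReal (gaussDensity d x) := rfl
  rw [h, integral_withDensity_eq_integral_toReal_smul
    measurable_gaussDensity.ennreal_ofReal (Eventually.of_forall fun x => ENNReal.ofReal_lt_top)]
  refine integral_congr_ae (Eventually.of_forall fun x => ?_)
  simp only [smul_eq_mul, ENNReal.toReal_ofReal (gaussDensity_pos x).le]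

/-- `T_s h_ν = e^{-s|ν|} h_ν`. -/
theorem ouSemigroup_hermiteFn {s : ℝ} (hs : 0 < s) (ν : Fin d → ℕ)
    (x : EuclideanSpace ℝ (Fin d)) :
    ouSemigroup s (hermiteFn ν) x = Real.exp (-(((∑ i, ν i : ℕ) : ℝ) * s)) * hermiteFn ν x := by
  have hτ := one_sub_exp_pos hs
  rw [exp_neg_two_mul] at hτ
  rw [ouSemigroup_eq, integral_gammaD, hermiteFn_eq]
  set c := 1 / √((2 : ℝ) ^ (∑ i, ν i) * ∏ i, ((ν i).factorial : ℝ))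
  set r := Real.exp (-s) with hr
  set g : Fin d → ℝ → ℝ := fun i v => (√(Real.pi * (1 - r ^ 2)))⁻¹ *
    (Real.exp (-(v - r * x i) ^ 2 / (1 - r ^ 2)) * (hermitePoly (ν i)).eval v) with hg
  have h1 : ∀ y, gaussDensity d y * (ouKernel s x y * hermiteFn ν y) = c * ∏ i, g i (y i) := by
    intro y
    rw [← mul_assoc, gaussDensity_mul_ouKernel hs, hermiteFn_eq]
    simp only [hg, Finset.prod_mul_distrib]
    ring
  have h2 : ∀ i, ∫ v, g i v = r ^ ν i * (hermitePoly (ν i)).eval (x i) := by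
    intro i
    have hπ : 0 < Real.pi * (1 - r ^ 2) := by positivity
    simp only [hg]
    rw [integral_const_mul, integral_gauss_mul_hermitePoly (by linarith), ← mul_assoc,
      inv_mul_cancel₀ (by positivity), one_mul]
  simp only [h1]
  have h3 := (EuclideanSpace.volume_preserving_symm_measurableEquiv_toLp (Fin d)).integral_comp'
    (fun z : Fin d → ℝ => c * ∏ i, g i (z i))
  have h4 : ∫ y : EuclideanSpace ℝ (Fin d), c * ∏ i, g i (y i)
      = ∫ z : Fin d → ℝ, c * ∏ i, g i (z i) := h3
  rw [h4, integral_const_mul, integral_fintype_prod_volume_eq_prod]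
  simp only [h2, Finset.prod_mul_distrib]
  rw [Finset.prod_pow_eq_pow_sum, hr, ← Real.exp_nat_mul]
  rw [show ((∑ i, ν i : ℕ) : ℝ) * -s = -(((∑ i, ν i : ℕ) : ℝ) * s) by ring]
  ring

/-- `P_t h_ν = e^{-t√|ν|} h_ν`. -/
theorem poissonHermite_hermiteFn {t : ℝ} (ht : 0 < t) (ν : Fin d → ℕ)
    (x : EuclideanSpace ℝ (Fin d)) :
    poissonHermite t (hermiteFn ν) x
      = Real.exp (-(t * √((∑ i, ν i : ℕ) : ℝ))) * hermiteFn ν x := by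
  unfold poissonHermite
  rw [subordination_eq ht (fun s => ouSemigroup s (hermiteFn ν) x)]
  set l : ℝ := ((∑ i, ν i : ℕ) : ℝ) with hl
  have hl0 : 0 ≤ l := Nat.cast_nonneg _
  have h1 : ∫ s in Ioi (0 : ℝ), subDeriv 0 t s * ouSemigroup s (hermiteFn ν) x
      = ∫ s in Ioi (0 : ℝ), subDeriv 0 t s * Real.exp (-(l * s)) * hermiteFn ν x :=
    setIntegral_congr_fun measurableSet_Ioi fun s hs => by
      rw [ouSemigroup_hermiteFn hs, ← mul_assoc]
  rw [h1, integral_mul_const]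
  congr 1
  rw [integral_eq_lintegral_of_nonneg_ae
    (Eventually.of_forall fun s => mul_nonneg (subDeriv_zero_nonneg ht.le s) (Real.exp_pos _).le)
    ((measurable_subDeriv_comp 0 measurable_const measurable_id).mul
      (by fun_prop)).aestronglyMeasurable]
  have h2 := lintegral_subDeriv_zero_mul_exp ht hl0
  simp only [← ENNReal.ofReal_mul (subDeriv_zero_nonneg ht.le _)] at h2
  rw [h2, ENNReal.toReal_ofReal (Real.exp_pos _).le]

theorem besselIntegrand_hermiteFn {t : ℝ} (β : ℝ) (ht : 0 < t) (ν : Fin d → ℕ)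
    (x : EuclideanSpace ℝ (Fin d)) :
    besselIntegrand β (hermiteFn ν) x t
      = t ^ (β - 1) * Real.exp (-((1 + √((∑ i, ν i : ℕ) : ℝ)) * t)) * hermiteFn ν x := by
  unfold besselIntegrand
  rw [poissonHermite_hermiteFn ht, add_mul, neg_add, Real.exp_add, one_mul,
    mul_comm t (√((∑ i, ν i : ℕ) : ℝ))]
  ring

theorem integrableOn_besselIntegrand_hermiteFn {β : ℝ} (hβ : 0 < β) (ν : Fin d → ℕ)
    (x : EuclideanSpace ℝ (Fin d)) :
    IntegrableOn (besselIntegrand β (hermiteFn ν) x) (Ioi 0) := by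
  have h := (integrableOn_rpow_mul_exp_neg_mul_rpow (s := β - 1) (p := 1)
    (b := 1 + √((∑ i, ν i : ℕ) : ℝ)) (by linarith) one_pos (by positivity)).mul_const (hermiteFn ν x)
  refine IntegrableOn.congr_fun (f := fun t => _) h (fun t ht => ?_) measurableSet_Ioi
  rw [besselIntegrand_hermiteFn β ht]
  simp only [Real.rpow_one, neg_mul]

/-- `J_β h_ν = (1 + √|ν|)^{-β} h_ν`. -/
theorem besselPotential_hermiteFn {β : ℝ} (hβ : 0 < β) (ν : Fin d → ℕ)
    (x : EuclideanSpace ℝ (Fin d)) :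
    besselPotential β (hermiteFn ν) x
      = 1 / (1 + √((∑ i, ν i : ℕ) : ℝ)) ^ β * hermiteFn ν x := by
  have hr : 0 < 1 + √((∑ i, ν i : ℕ) : ℝ) := by positivity
  unfold besselPotential
  rw [setIntegral_congr_fun measurableSet_Ioi fun t ht => besselIntegrand_hermiteFn β ht ν x,
    integral_mul_const, Real.integral_rpow_mul_exp_neg_mul_Ioi hβ hr, Real.div_rpow zero_le_one hr.le,
    Real.one_rpow]
  have := (Real.Gamma_pos_of_pos hβ).ne'
  field_simp

end Hermite

/-! ### Bessel potentials -/

section Bessel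

variable {d : ℕ}

/-- The measure `t^{β-1} e^{-t} dt` on `(0,∞)`. -/
def besselWeight (β : ℝ) : Measure ℝ :=
  (volume.restrict (Ioi 0)).withDensity fun t => ENNReal.ofReal (t ^ (β - 1) * Real.exp (-t))

theorem measurable_besselDensity (β : ℝ) :
    Measurable fun t : ℝ => ENNReal.ofReal (t ^ (β - 1) * Real.exp (-t)) := by
  fun_prop

theorem lintegral_besselWeight (β : ℝ) (g : ℝ → ℝ≥0∞) :
    ∫⁻ t, g t ∂(besselWeight β)
      = ∫⁻ t in Ioi (0 : ℝ), ENNReal.ofReal (t ^ (β - 1) * Real.exp (-t)) * g t :=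
  lintegral_withDensity_eq_lintegral_mul_non_measurable _ (measurable_besselDensity β)
    (Eventually.of_forall fun _ => ENNReal.ofReal_lt_top) g

theorem ae_besselWeight_pos (β : ℝ) : ∀ᵐ t ∂(besselWeight β), 0 < t :=
  (withDensity_absolutelyContinuous _ _).ae_le (ae_restrict_mem measurableSet_Ioi)

theorem isFiniteMeasure_besselWeight {β : ℝ} (hβ : 0 < β) :
    IsFiniteMeasure (besselWeight β) := by
  refine isFiniteMeasure_withDensity_ofReal ?_
  have h := Real.GammaIntegral_convergent hβ
  refine (IntegrableOn.congr_fun h (fun t _ => ?_) measurableSet_Ioi).2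
  ring

theorem integrable_besselWeight_iff {β : ℝ} {g : ℝ → ℝ} :
    Integrable g (besselWeight β) ↔
      IntegrableOn (fun t => t ^ (β - 1) * Real.exp (-t) * g t) (Ioi 0) := by
  unfold besselWeight
  rw [integrable_withDensity_iff_integrable_smul' (measurable_besselDensity β)
    (Eventually.of_forall fun _ => ENNReal.ofReal_lt_top)]
  refine integrableOn_congr_fun (fun t ht => ?_) measurableSet_Ioi
  have : (0 : ℝ) < t := ht
  rw [ENNReal.toReal_ofReal (by positivity), smul_eq_mul]

theorem integral_besselWeight {β : ℝ} (g : ℝ → ℝ) :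
    ∫ t, g t ∂(besselWeight β) = ∫ t in Ioi (0 : ℝ), t ^ (β - 1) * Real.exp (-t) * g t := by
  unfold besselWeight
  rw [integral_withDensity_eq_integral_toReal_smul (measurable_besselDensity β)
    (Eventually.of_forall fun _ => ENNReal.ofReal_lt_top)]
  refine setIntegral_congr_fun measurableSet_Ioi fun t ht => ?_
  have : (0 : ℝ) < t := ht
  rw [ENNReal.toReal_ofReal (by positivity), smul_eq_mul]

theorem measurable_poissonOp (k : ℕ) {f : EuclideanSpace ℝ (Fin d) → ℝ}
    (hf : AEStronglyMeasurable f (gammaD d)) :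
    Measurable (Function.uncurry fun t => poissonOp k t f) := by
  have hg : Measurable (hf.mk f) := hf.stronglyMeasurable_mk.measurable
  have e : (fun t => poissonOp k t f) = fun t => poissonOp k t (hf.mk f) := by
    funext t
    exact poissonOp_congr k t hf.ae_eq_mk
  rw [e]
  have h : Measurable (Function.uncurry fun (z : ℝ × EuclideanSpace ℝ (Fin d))
      (y : EuclideanSpace ℝ (Fin d)) => poissonKernel k z.1 z.2 y * hf.mk f y) :=
    (measurable_poissonKernel_comp k (by fun_prop) (by fun_prop) (by fun_prop)).mul
      (hg.comp measurable_snd)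
  exact (h.stronglyMeasurable.integral_prod_right (ν := gammaD d)).measurable

theorem lintegral_enorm_poissonOp_le {t : ℝ} (ht : 0 < t) {f : EuclideanSpace ℝ (Fin d) → ℝ}
    (hf : AEStronglyMeasurable f (gammaD d)) :
    ∫⁻ x, ‖poissonOp 0 t f x‖ₑ ∂(gammaD d) ≤ ∫⁻ x, ‖f x‖ₑ ∂(gammaD d) := by
  rw [← lintegral_lintegral_poissonKernel_mul ht hf.enorm]
  refine lintegral_mono fun x => (enorm_integral_le_lintegral_enorm _).trans_eq ?_
  refine lintegral_congr fun y => ?_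
  rw [enorm_mul, Real.enorm_of_nonneg (poissonKernel_zero_nonneg ht x y)]

/-- `P_t` is a contraction of `L¹(γ_d)` and the weight is a finite measure. This yields both the
almost everywhere convergence of the Bessel integral and the Fubini arguments. -/
theorem integrable_poissonOp_besselWeight {β : ℝ} (hβ : 0 < β)
    {f : EuclideanSpace ℝ (Fin d) → ℝ} (hf : Integrable f (gammaD d)) :
    Integrable (Function.uncurry fun t => poissonOp 0 t f) ((besselWeight β).prod (gammaD d)) := by
  have := isFiniteMeasure_besselWeight hβ
  have hm := measurable_poissonOp 0 hf.1
  refine ⟨hm.aestronglyMeasurable, ?_⟩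
  rw [hasFiniteIntegral_iff_enorm, lintegral_prod _ hm.enorm.aemeasurable]
  calc ∫⁻ t, ∫⁻ x, ‖poissonOp 0 t f x‖ₑ ∂(gammaD d) ∂(besselWeight β)
      ≤ ∫⁻ _, ∫⁻ x, ‖f x‖ₑ ∂(gammaD d) ∂(besselWeight β) := by
        refine lintegral_mono_ae ?_
        filter_upwards [ae_besselWeight_pos β] with t ht
          using lintegral_enorm_poissonOp_le ht hf.1
    _ < ∞ := by
        rw [lintegral_const]
        exact ENNReal.mul_lt_top hf.2 (measure_lt_top _ _)

theorem besselPotential_eq (β : ℝ) {f : EuclideanSpace ℝ (Fin d) → ℝ}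
    (hf : Integrable f (gammaD d)) :
    besselPotential β f
      = fun x => 1 / Real.Gamma β * ∫ t, poissonOp 0 t f x ∂(besselWeight β) := by
  funext x
  unfold besselPotential besselIntegrand
  rw [integral_besselWeight]
  congr 1
  refine setIntegral_congr_fun measurableSet_Ioi fun t ht => ?_
  rw [poissonHermite_eq ht hf]

theorem ae_integrableOn_besselIntegrand {β : ℝ} (hβ : 0 < β)
    {f : EuclideanSpace ℝ (Fin d) → ℝ} (hf : Integrable f (gammaD d)) :
    ∀ᵐ x ∂(gammaD d), IntegrableOn (besselIntegrand β f x) (Ioi 0) := by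
  have := isFiniteMeasure_besselWeight hβ
  filter_upwards [(integrable_poissonOp_besselWeight hβ hf).prod_left_ae] with x hx
  have h := integrable_besselWeight_iff.1 hx
  refine IntegrableOn.congr_fun h (fun t ht => ?_) measurableSet_Ioi
  simp only [besselIntegrand, Function.uncurry]
  rw [poissonHermite_eq ht hf]

theorem integrable_besselPotential {β : ℝ} (hβ : 0 < β) {f : EuclideanSpace ℝ (Fin d) → ℝ}
    (hf : Integrable f (gammaD d)) : Integrable (besselPotential β f) (gammaD d) := by
  have := isFiniteMeasure_besselWeight hβ
  rw [besselPotential_eq β hf]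
  exact (integrable_poissonOp_besselWeight hβ hf).integral_prod_right.const_mul _

/-- For fixed `t` and `x` the kernel of `∂^k P_t` is bounded in `y`, so Fubini applies at every `x`;
the semigroup property does the rest. -/
theorem poissonOp_besselPotential {β : ℝ} (hβ : 0 < β) (k : ℕ) {t : ℝ} (ht : 0 < t)
    {f : EuclideanSpace ℝ (Fin d) → ℝ} (hf : Integrable f (gammaD d)) :
    poissonOp k t (besselPotential β f)
      = fun x => 1 / Real.Gamma β * ∫ s, poissonOp k (t + s) f x ∂(besselWeight β) := by
  have := isFiniteMeasure_besselWeight hβ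
  funext x
  obtain ⟨M, hM, h⟩ := exists_abs_poissonKernel_le d k ht
  have hint : Integrable (Function.uncurry fun (s : ℝ) (y : EuclideanSpace ℝ (Fin d)) =>
      poissonKernel k t x y * poissonOp 0 s f y) ((besselWeight β).prod (gammaD d)) :=
    (integrable_poissonOp_besselWeight hβ hf).bdd_mul
      (f := fun z : ℝ × EuclideanSpace ℝ (Fin d) => poissonKernel k t x z.2)
      (measurable_poissonKernel_comp k measurable_const measurable_const
        measurable_snd).aestronglyMeasurable
      (Eventually.of_forall fun z => h t le_rfl x z.2)
  calc poissonOp k t (besselPotential β f) x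
      = 1 / Real.Gamma β * ∫ y, ∫ s, poissonKernel k t x y * poissonOp 0 s f y
          ∂(besselWeight β) ∂(gammaD d) := by
        rw [besselPotential_eq β hf]
        unfold poissonOp
        rw [← integral_const_mul]
        refine integral_congr_ae (Eventually.of_forall fun y => ?_)
        simp only [integral_const_mul]
        ring
    _ = 1 / Real.Gamma β * ∫ s, poissonOp k t (poissonOp 0 s f) x ∂(besselWeight β) := by
        rw [← integral_integral_swap hint]
        rfl
    _ = _ := by
        congr 1
        refine integral_congr_ae ?_
        filter_upwards [ae_besselWeight_pos β] with s hs
        rw [poissonOp_poissonOp k 0 ht hs hf, add_zero]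

theorem varNorm_integral_besselWeight_le {β : ℝ} (hβ : 0 < β)
    {p : EuclideanSpace ℝ (Fin d) → ℝ} (hp1 : ∀ x, 1 ≤ p x) (hpm : Measurable p)
    {H : ℝ → EuclideanSpace ℝ (Fin d) → ℝ} (hH : Measurable (Function.uncurry H))
    {N : ℝ → ℝ≥0∞} (hN : Measurable N) (h : ∀ s, 0 < s → varNorm p (gammaD d) (H s) ≤ N s) :
    varNorm p (gammaD d) (fun x => 1 / Real.Gamma β * ∫ s, H s x ∂(besselWeight β))
      ≤ ENNReal.ofReal (1 / Real.Gamma β) * ∫⁻ s, N s ∂(besselWeight β) := by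
  have := isFiniteMeasure_besselWeight hβ
  have hΓ : 0 < 1 / Real.Gamma β := one_div_pos.2 (Real.Gamma_pos_of_pos hβ)
  calc varNorm p (gammaD d) (fun x => 1 / Real.Gamma β * ∫ s, H s x ∂(besselWeight β))
      ≤ luxNorm p (gammaD d) (fun x =>
          ENNReal.ofReal (1 / Real.Gamma β) * ∫⁻ s, ‖H s x‖ₑ ∂(besselWeight β)) := by
        refine luxNorm_mono (Eventually.of_forall hp1) (Eventually.of_forall fun x => ?_)
        simp only
        rw [enorm_mul, Real.enorm_of_nonneg hΓ.le]
        gcongr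
        exact enorm_integral_le_lintegral_enorm _
    _ ≤ _ := by
        refine (luxNorm_const_mul_le (ENNReal.ofReal_pos.2 hΓ).ne' ENNReal.ofReal_ne_top).trans
          (mul_le_mul' le_rfl ?_)
        refine luxNorm_lintegral_le (Eventually.of_forall hp1) hpm.aemeasurable
          (F := fun s x => ‖H s x‖ₑ) hH.enorm hN ?_
        filter_upwards [ae_besselWeight_pos β] with s hs using h s hs

/-- Boundedness of `J_β` on `L^{p(·)}(γ_d)`. -/
theorem exists_varNorm_besselPotential_le {β : ℝ} (hβ : 0 < β)
    {p : EuclideanSpace ℝ (Fin d) → ℝ} {C : ℝ≥0∞} (hp1 : ∀ x, 1 ≤ p x) (hpm : Measurable p)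
    (hC0 : C ≠ 0) (hCt : C ≠ ∞)
    (hT : ∀ s, 0 < s → ∀ f : EuclideanSpace ℝ (Fin d) → ℝ≥0∞, Measurable f →
      luxNorm p (gammaD d) (ouLintegral s f) ≤ C * luxNorm p (gammaD d) f) :
    ∃ K : ℝ≥0, ∀ f : EuclideanSpace ℝ (Fin d) → ℝ, Integrable f (gammaD d) →
      varNorm p (gammaD d) (besselPotential β f) ≤ K * varNorm p (gammaD d) f := by
  have := isFiniteMeasure_besselWeight hβ
  obtain ⟨M, hM0, hMt, hM⟩ := exists_varNorm_poissonOp_le hp1 hpm hC0 hCt hT 0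
  set K : ℝ≥0∞ := ENNReal.ofReal (1 / Real.Gamma β) * (M * besselWeight β univ) with hK
  have hKt : K ≠ ∞ := ENNReal.mul_ne_top ENNReal.ofReal_ne_top
    (ENNReal.mul_ne_top hMt (measure_ne_top _ _))
  refine ⟨K.toNNReal, fun f hf => ?_⟩
  rw [ENNReal.coe_toNNReal hKt, besselPotential_eq β hf]
  refine (varNorm_integral_besselWeight_le hβ hp1 hpm (measurable_poissonOp 0 hf.1)
    (N := fun _ => M * varNorm p (gammaD d) f) measurable_const fun s hs => ?_).trans_eq ?_
  · simpa using hM s hs f hf.1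
  · rw [lintegral_const, hK]
    ring

end Bessel

/-! ### Bessel potentials on Besov-Lipschitz spaces -/

section Besov

theorem lintegral_Ioi_comp_half (t : ℝ) (G : ℝ → ℝ≥0∞) :
    ∫⁻ s in Ioi t, G s = 2 * ∫⁻ s in Ioi (t / 2), G (2 * s) := by
  have himg : (fun s : ℝ => 2 * s) '' Ioi (t / 2) = Ioi t := by
    rw [image_mul_left_Ioi two_pos]
    congr 1; ring
  have h := lintegral_image_eq_lintegral_abs_deriv_mul (s := Ioi (t / 2)) (f := fun s : ℝ => 2 * s)
    (f' := fun _ => 2) measurableSet_Ioi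
    (fun s _ => by simpa using ((hasDerivAt_id s).const_mul (2 : ℝ)).hasDerivWithinAt)
    (fun a _ b _ hab => by simpa using hab) G
  rw [himg] at h
  rw [h, lintegral_const_mul' _ _ (by simp)]
  simp

variable {Φ : ℝ → ℝ≥0∞}

/-- The part `s ≤ t` of the Hardy-type estimate. -/
theorem rpow_mul_le_lintegral_hardyKernel (hΦ : Antitone Φ) {δ κ t : ℝ} (hδ : 0 < δ) (hκ : 0 < κ)
    (ht : 0 < t) :
    ENNReal.ofReal (t ^ κ) * Φ (t / 2) ≤ ENNReal.ofReal (2 * 4 ^ (δ + κ)) *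
      ∫⁻ s, hardyKernel δ t s * (ENNReal.ofReal (s ^ κ) * Φ s) ∂haarPos := by
  -- The integral is restricted to `(t/4, t/2]`. There `Φ(s) ≥ Φ(t/2)` by monotonicity, and the
  -- other factors are at least `4^{-δ}`, `(t/4)^κ` and `2/t`.
  have h1 : ENNReal.ofReal ((1 / 4) ^ δ * (t / 4) ^ κ * (2 / t)) * Φ (t / 2)
        * ENNReal.ofReal (t / 4)
      ≤ ∫⁻ s, hardyKernel δ t s * (ENNReal.ofReal (s ^ κ) * Φ s) ∂haarPos := by
    rw [lintegral_haarPos]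
    calc ENNReal.ofReal ((1 / 4) ^ δ * (t / 4) ^ κ * (2 / t)) * Φ (t / 2) * ENNReal.ofReal (t / 4)
        = ∫⁻ _ in Ioc (t / 4) (t / 2),
            ENNReal.ofReal ((1 / 4) ^ δ * (t / 4) ^ κ * (2 / t)) * Φ (t / 2) := by
          rw [setLIntegral_const, Real.volume_Ioc]
          congr 2; ring
      _ ≤ ∫⁻ s in Ioc (t / 4) (t / 2), ENNReal.ofReal (1 / s) *
            (hardyKernel δ t s * (ENNReal.ofReal (s ^ κ) * Φ s)) := by
          refine setLIntegral_mono' measurableSet_Ioc fun s hs => ?_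
          have hs0 : 0 < s := lt_trans (by positivity) hs.1
          have hmin : 1 / 4 ≤ min (t / s) (s / t) := by
            refine le_min ?_ ?_
            · rw [le_div_iff₀ hs0]; linarith [hs.2]
            · rw [le_div_iff₀ ht]; linarith [hs.1]
          have hh : ENNReal.ofReal ((1 / 4) ^ δ) ≤ hardyKernel δ t s :=
            ENNReal.ofReal_le_ofReal (Real.rpow_le_rpow (by norm_num) hmin hδ.le)
          have hk : ENNReal.ofReal ((t / 4) ^ κ) ≤ ENNReal.ofReal (s ^ κ) :=
            ENNReal.ofReal_le_ofReal (Real.rpow_le_rpow (by positivity) hs.1.le hκ.le)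
          have hi : ENNReal.ofReal (2 / t) ≤ ENNReal.ofReal (1 / s) := by
            refine ENNReal.ofReal_le_ofReal ?_
            rw [div_le_div_iff₀ ht hs0]; linarith [hs.2]
          rw [ENNReal.ofReal_mul (by positivity), ENNReal.ofReal_mul (by positivity)]
          calc ENNReal.ofReal ((1 / 4) ^ δ) * ENNReal.ofReal ((t / 4) ^ κ) * ENNReal.ofReal (2 / t)
                * Φ (t / 2)
              = ENNReal.ofReal (2 / t) * (ENNReal.ofReal ((1 / 4) ^ δ) *
                (ENNReal.ofReal ((t / 4) ^ κ) * Φ (t / 2))) := by ring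
            _ ≤ _ := by gcongr; exact hΦ hs.2
      _ ≤ _ := lintegral_mono_set fun s hs => lt_trans (by positivity) hs.1
  refine le_trans (le_of_eq ?_) (mul_le_mul' le_rfl h1)
  rw [mul_assoc, mul_comm (Φ _), ← mul_assoc, ← mul_assoc, ← ENNReal.ofReal_mul (by positivity),
    ← ENNReal.ofReal_mul (by positivity)]
  congr 2
  rw [Real.div_rpow zero_le_one (by norm_num), Real.div_rpow ht.le (by norm_num), Real.one_rpow,
    Real.rpow_add (by norm_num)]
  have h4δ : (0 : ℝ) < 4 ^ δ := by positivity
  have h4κ : (0 : ℝ) < 4 ^ κ := by positivity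
  field_simp
  norm_num

/-- The part `s > t` of the Hardy-type estimate. -/
theorem lintegral_Ioi_rpow_mul_le_hardyKernel {δ κ β : ℝ} {n : ℕ} (hδ : 0 < δ)
    (hδκ : δ = κ + n - β) {t : ℝ} (ht : 0 < t) :
    ENNReal.ofReal (t ^ δ) * ∫⁻ s in Ioi t,
        ENNReal.ofReal (s ^ (β - 1)) * (ENNReal.ofReal ((s / 2) ^ n)⁻¹ * Φ (s / 2))
      ≤ ENNReal.ofReal (2 ^ β * 4 ^ δ) *
        ∫⁻ s, hardyKernel δ t s * (ENNReal.ofReal (s ^ κ) * Φ s) ∂haarPos := by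
  rw [lintegral_Ioi_comp_half, lintegral_haarPos, ← mul_assoc,
    ← lintegral_const_mul' _ _ (ENNReal.mul_ne_top ENNReal.ofReal_ne_top ENNReal.ofNat_ne_top),
    ← lintegral_const_mul' _ _ ENNReal.ofReal_ne_top]
  have hsub : Ioi (t / 2) ⊆ Ioi 0 := Ioi_subset_Ioi (by positivity)
  refine le_trans (setLIntegral_mono' measurableSet_Ioi fun s hs => ?_) (lintegral_mono_set hsub)
  have hs0 : 0 < s := hsub hs
  have hst : t < 2 * s := by have : t / 2 < s := hs; linarith
  -- After rescaling, `s` may lie slightly below `t`, but `t < 2s` still gives `s/t ≥ t/(4s)`.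
  have hmin : t / s / 4 ≤ min (t / s) (s / t) := by
    refine le_min (div_le_self (by positivity) (by norm_num)) ?_
    rw [div_div, div_le_div_iff₀ (by positivity) ht]
    nlinarith
  have hh : ENNReal.ofReal ((t / s / 4) ^ δ) ≤ hardyKernel δ t s :=
    ENNReal.ofReal_le_ofReal (Real.rpow_le_rpow (by positivity) hmin hδ.le)
  refine le_trans (le_of_eq ?_) (mul_le_mul' le_rfl (mul_le_mul' le_rfl (mul_le_mul' hh le_rfl)))
  have e2 : 2 * s / 2 = s := by ring
  have e3 : (2 : ℝ≥0∞) = ENNReal.ofReal 2 := by simp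
  rw [e2, e3]
  simp only [← mul_assoc]
  rw [← ENNReal.ofReal_mul (by positivity), ← ENNReal.ofReal_mul (by positivity),
    ← ENNReal.ofReal_mul (by positivity), ← ENNReal.ofReal_mul (by positivity),
    ← ENNReal.ofReal_mul (by positivity), ← ENNReal.ofReal_mul (by positivity)]
  congr 2
  rw [Real.div_rpow (by positivity) (by norm_num), Real.div_rpow ht.le hs0.le,
    Real.mul_rpow (by norm_num) hs0.le, Real.rpow_sub_one (by norm_num), Real.rpow_sub_one hs0.ne']
  have h4δ : (0 : ℝ) < 4 ^ δ := by positivity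
  have hsδ : s ^ δ * s ^ β = s ^ κ * s ^ n := by
    rw [← Real.rpow_natCast, ← Real.rpow_add hs0, ← Real.rpow_add hs0, hδκ]
    congr 1; ring
  have hsδ0 : 0 < s ^ δ := by positivity
  field_simp
  linear_combination hsδ

/-- Split at `s = t`. Below, `(t+s)/2 ≥ t/2` and `∫₀ᵗ s^{β-1}ds = t^β/β`; above, `(t+s)/2 ≥ s/2`. Of
the factor `e^{-s}` only the bound 1 is kept, and the relation between `δ`, `κ`, `n`, `β` balances
the powers. -/
theorem exists_rpow_mul_lintegral_besselWeight_le {δ κ β : ℝ} {n : ℕ} (hδ : 0 < δ) (hκ : 0 < κ)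
    (hβ : 0 < β) (hδκ : δ = κ + n - β) :
    ∃ K : ℝ≥0∞, K ≠ 0 ∧ K ≠ ∞ ∧ ∀ Φ : ℝ → ℝ≥0∞, Antitone Φ → ∀ t, 0 < t →
      ENNReal.ofReal (t ^ δ) * ∫⁻ s, ENNReal.ofReal (((t + s) / 2) ^ n)⁻¹ * Φ ((t + s) / 2)
          ∂(besselWeight β)
        ≤ K * ∫⁻ s, hardyKernel δ t s * (ENNReal.ofReal (s ^ κ) * Φ s) ∂haarPos := by
  refine ⟨ENNReal.ofReal (2 ^ n / β) * ENNReal.ofReal (2 * 4 ^ (δ + κ))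
    + ENNReal.ofReal (2 ^ β * 4 ^ δ), ?_, by finiteness, fun Φ hΦ t ht => ?_⟩
  · have : 0 < (2 : ℝ) ^ β * 4 ^ δ := by positivity
    exact (lt_of_lt_of_le (ENNReal.ofReal_pos.2 this) le_add_self).ne'
  have hA : ∫⁻ s in Ioc 0 t, ENNReal.ofReal (s ^ (β - 1) * Real.exp (-s)) *
        (ENNReal.ofReal (((t + s) / 2) ^ n)⁻¹ * Φ ((t + s) / 2))
      ≤ ENNReal.ofReal (t ^ β / β) * (ENNReal.ofReal ((t / 2) ^ n)⁻¹ * Φ (t / 2)) := by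
    have hm : Measurable fun s : ℝ => ENNReal.ofReal (s ^ (β - 1)) := by fun_prop
    rw [← lintegral_Ioc_rpow hβ ht, ← lintegral_mul_const _ hm]
    refine setLIntegral_mono' measurableSet_Ioc fun s hs => ?_
    have hs0 : 0 < s := hs.1
    have h1 : s ^ (β - 1) * Real.exp (-s) ≤ s ^ (β - 1) :=
      mul_le_of_le_one_right (by positivity) (Real.exp_le_one_iff.2 (by linarith))
    have h2 : t / 2 ≤ (t + s) / 2 := by linarith
    gcongr
    exact hΦ h2
  have hB : ∫⁻ s in Ioi t, ENNReal.ofReal (s ^ (β - 1) * Real.exp (-s)) *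
        (ENNReal.ofReal (((t + s) / 2) ^ n)⁻¹ * Φ ((t + s) / 2))
      ≤ ∫⁻ s in Ioi t,
        ENNReal.ofReal (s ^ (β - 1)) * (ENNReal.ofReal ((s / 2) ^ n)⁻¹ * Φ (s / 2)) := by
    refine setLIntegral_mono' measurableSet_Ioi fun s hs => ?_
    have hs0 : 0 < s := ht.trans hs
    have h1 : s ^ (β - 1) * Real.exp (-s) ≤ s ^ (β - 1) :=
      mul_le_of_le_one_right (by positivity) (Real.exp_le_one_iff.2 (by linarith))
    have h2 : s / 2 ≤ (t + s) / 2 := by linarith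
    gcongr
    exact hΦ h2
  rw [lintegral_besselWeight, ← Ioc_union_Ioi_eq_Ioi ht.le,
    lintegral_union measurableSet_Ioi (Ioc_disjoint_Ioi le_rfl), mul_add, add_mul]
  refine add_le_add ?_ ?_
  · refine (mul_le_mul' le_rfl hA).trans ?_
    rw [mul_assoc]
    refine le_trans (le_of_eq ?_)
      (mul_le_mul' le_rfl (rpow_mul_le_lintegral_hardyKernel hΦ hδ hκ ht))
    simp only [← mul_assoc]
    rw [← ENNReal.ofReal_mul (by positivity), ← ENNReal.ofReal_mul (by positivity),
      ← ENNReal.ofReal_mul (by positivity)]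
    congr 2
    have h : t ^ δ * t ^ β = t ^ κ * t ^ n := by
      rw [← Real.rpow_natCast, ← Real.rpow_add ht, ← Real.rpow_add ht, hδκ]
      congr 1; ring
    rw [div_pow]
    field_simp
    linear_combination h
  · exact (mul_le_mul' le_rfl hB).trans (lintegral_Ioi_rpow_mul_le_hardyKernel hδ hδκ ht)

variable {d : ℕ}

/-- The decreasing majorant of `t ↦ ‖∂_t^m P_t f‖_{p(·)}`. -/
def poissonSup (p : EuclideanSpace ℝ (Fin d) → ℝ) (m : ℕ) (f : EuclideanSpace ℝ (Fin d) → ℝ)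
    (t : ℝ) : ℝ≥0∞ :=
  ⨆ (s : ℝ) (_ : t ≤ s ∧ 0 < s), varNorm p (gammaD d) (poissonOp m s f)

theorem antitone_poissonSup (p : EuclideanSpace ℝ (Fin d) → ℝ) (m : ℕ)
    (f : EuclideanSpace ℝ (Fin d) → ℝ) : Antitone (poissonSup p m f) :=
  fun _ _ hab => iSup₂_le fun s hs => le_iSup₂_of_le s ⟨hab.trans hs.1, hs.2⟩ le_rfl

theorem varNorm_poissonOp_le_poissonSup (p : EuclideanSpace ℝ (Fin d) → ℝ) (m : ℕ)
    (f : EuclideanSpace ℝ (Fin d) → ℝ) {t : ℝ} (ht : 0 < t) :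
    varNorm p (gammaD d) (poissonOp m t f) ≤ poissonSup p m f t :=
  le_iSup₂_of_le t ⟨le_rfl, ht⟩ le_rfl

variable {p : EuclideanSpace ℝ (Fin d) → ℝ} {C : ℝ≥0∞}

/-- The seminorm estimate for `J_β`. -/
theorem exists_besovSeminorm_besselPotential_le {α β : ℝ} (hβ : 0 < β) {q : ℝ → ℝ}
    (hq : IsPZeroInfty q) (hp1 : ∀ x, 1 ≤ p x) (hpm : Measurable p) (hC0 : C ≠ 0) (hCt : C ≠ ∞)
    (hT : ∀ s, 0 < s → ∀ f : EuclideanSpace ℝ (Fin d) → ℝ≥0∞, Measurable f →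
      luxNorm p (gammaD d) (ouLintegral s f) ≤ C * luxNorm p (gammaD d) f) :
    ∃ K : ℝ≥0, ∀ f : EuclideanSpace ℝ (Fin d) → ℝ, Integrable f (gammaD d) →
      besovSeminorm (α + β) p q (besselPotential β f) ≤ K * besovSeminorm α p q f := by
  have hq1 := ae_one_le_of_isPZeroInfty hq
  set m := ⌊α⌋₊ + 1 with hm
  set k := ⌊α + β⌋₊ + 1 with hk
  have hmk : m ≤ k := by
    have := Nat.floor_le_floor (show α ≤ α + β by linarith)
    omega
  obtain ⟨n, hn⟩ := Nat.exists_eq_add_of_le' hmk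
  set κ : ℝ := (m : ℝ) - α with hκd
  set δ : ℝ := (k : ℝ) - (α + β) with hδd
  have hκ : 0 < κ := by
    have := Nat.lt_floor_add_one α
    rw [hκd, hm]; push_cast; linarith
  have hδ : 0 < δ := by
    have := Nat.lt_floor_add_one (α + β)
    rw [hδd, hk]; push_cast; linarith
  have hδκ : δ = κ + n - β := by
    rw [hδd, hκd, hn]; push_cast; ring
  obtain ⟨M₀, -, hM₀t, hM₀⟩ := exists_varNorm_poissonOp_le hp1 hpm hC0 hCt hT 0
  obtain ⟨M, hM0, hMt, hM⟩ := exists_varNorm_poissonOp_le hp1 hpm hC0 hCt hT n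
  obtain ⟨K, hK0, hKt, hK⟩ := exists_rpow_mul_lintegral_besselWeight_le hδ hκ hβ hδκ
  obtain ⟨Q, hQ0, hQt, hQ⟩ := exists_luxNorm_hardy_le hq hδ
  have hΓ : 0 < 1 / Real.Gamma β := one_div_pos.2 (Real.Gamma_pos_of_pos hβ)
  set A : ℝ≥0∞ := ENNReal.ofReal (1 / Real.Gamma β) * M * K with hA
  have hA0 : A ≠ 0 := mul_ne_zero (mul_ne_zero (ENNReal.ofReal_pos.2 hΓ).ne' hM0) hK0
  have hAt : A ≠ ∞ := by finiteness
  refine ⟨(A * (Q * (M₀ + 1))).toNNReal, fun f hf => ?_⟩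
  rw [ENNReal.coe_toNNReal (by finiteness)]
  set Φ := poissonSup p m f with hΦd
  have hΦ : Antitone Φ := antitone_poissonSup p m f
  -- For `s > t`, `∂^m P_s f = P_{s-t} ∂^m P_t f` and `P_{s-t}` is uniformly bounded; the extra 1
  -- covers `s = t`.
  have hΦle : ∀ t, 0 < t → Φ t ≤ (M₀ + 1) * varNorm p (gammaD d) (poissonOp m t f) := by
    intro t ht
    refine iSup₂_le fun s hs => ?_
    rcases hs.1.eq_or_lt with rfl | hts
    · rw [add_mul, one_mul]; exact le_add_self
    · have e : poissonOp m s f = poissonOp 0 (s - t) (poissonOp m t f) := by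
        funext x
        rw [poissonOp_poissonOp 0 m (sub_pos.2 hts) ht hf, zero_add, sub_add_cancel]
      rw [e]
      refine (hM₀ _ (sub_pos.2 hts) _ (integrable_poissonOp m ht hf).1).trans ?_
      rw [add_mul]
      simp
  -- Half of the time is spent on the `n` additional derivatives, at the price `u^{-n}`, and the
  -- other half on the `m` derivatives that the norm of `f` controls.
  have hdec : ∀ u, 0 < u → varNorm p (gammaD d) (poissonOp k (u + u) f)
      ≤ M * (ENNReal.ofReal (u ^ n)⁻¹ * Φ u) := by
    intro u hu
    have e : poissonOp k (u + u) f = poissonOp n u (poissonOp m u f) := by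
      funext x
      rw [poissonOp_poissonOp n m hu hu hf, hn]
    rw [e, ← mul_assoc]
    exact (hM u hu _ (integrable_poissonOp m hu hf).1).trans
      (mul_le_mul' le_rfl (varNorm_poissonOp_le_poissonSup p m f hu))
  -- The monotone majorant is measurable for free, so measurability of `t ↦ ‖∂_t^m P_t f‖` itself is
  -- never needed.
  have hΦm : Measurable Φ := hΦ.measurable
  have hpt : ∀ t, 0 < t → ENNReal.ofReal (t ^ δ) *
      varNorm p (gammaD d) (poissonDeriv k (besselPotential β f) t)
      ≤ A * ∫⁻ s, hardyKernel δ t s * (ENNReal.ofReal (s ^ κ) * Φ s) ∂haarPos := by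
    intro t ht
    have e : poissonDeriv k (besselPotential β f) t
        = fun x => 1 / Real.Gamma β * ∫ s, poissonOp k (t + s) f x ∂(besselWeight β) := by
      rw [← poissonOp_besselPotential hβ k ht hf]
      funext x
      exact poissonDeriv_eq k ht (integrable_besselPotential hβ hf) x
    have hHm : Measurable (Function.uncurry fun s => poissonOp k (t + s) f) :=
      Measurable.comp (g := Function.uncurry fun s => poissonOp k s f)
        (f := fun z : ℝ × EuclideanSpace ℝ (Fin d) => (t + z.1, z.2))
        (measurable_poissonOp k hf.1) (by fun_prop)
    have hNm : Measurable fun s : ℝ =>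
        ENNReal.ofReal (((t + s) / 2) ^ n)⁻¹ * Φ ((t + s) / 2) :=
      Measurable.mul (by fun_prop) (hΦm.comp (by fun_prop))
    have h := varNorm_integral_besselWeight_le hβ hp1 hpm hHm
      (N := fun s => M * (ENNReal.ofReal (((t + s) / 2) ^ n)⁻¹ * Φ ((t + s) / 2)))
      (hNm.const_mul M) fun s hs => by
        have := hdec ((t + s) / 2) (by positivity)
        rwa [add_halves] at this
    rw [lintegral_const_mul _ hNm] at h
    rw [e]
    calc _ ≤ ENNReal.ofReal (t ^ δ) * _ := mul_le_mul' le_rfl h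
      _ = ENNReal.ofReal (1 / Real.Gamma β) * M * (ENNReal.ofReal (t ^ δ) *
          ∫⁻ s, ENNReal.ofReal (((t + s) / 2) ^ n)⁻¹ * Φ ((t + s) / 2) ∂(besselWeight β)) := by ring
      _ ≤ ENNReal.ofReal (1 / Real.Gamma β) * M * (K *
          ∫⁻ s, hardyKernel δ t s * (ENNReal.ofReal (s ^ κ) * Φ s) ∂haarPos) :=
        mul_le_mul' le_rfl (hK Φ hΦ t ht)
      _ = _ := by rw [hA]; ring
  have hFm : Measurable fun s : ℝ => ENNReal.ofReal (s ^ κ) * Φ s :=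
    Measurable.mul (by fun_prop) hΦm
  calc besovSeminorm (α + β) p q (besselPotential β f)
      ≤ luxNorm q haarPos (fun t => A *
          ∫⁻ s, hardyKernel δ t s * (ENNReal.ofReal (s ^ κ) * Φ s) ∂haarPos) := by
        refine luxNorm_mono hq1 ?_
        filter_upwards [ae_haarPos_pos] with t ht using hpt t ht
    _ ≤ A * (Q * luxNorm q haarPos (fun s => ENNReal.ofReal (s ^ κ) * Φ s)) :=
        (luxNorm_const_mul_le hA0 hAt).trans (mul_le_mul' le_rfl (hQ _ hFm))
    _ ≤ A * (Q * ((M₀ + 1) * besovSeminorm α p q f)) := by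
        refine mul_le_mul' le_rfl (mul_le_mul' le_rfl ?_)
        refine le_trans (luxNorm_mono hq1 ?_)
          (luxNorm_const_mul_le (C := M₀ + 1) (by simp) (by finiteness))
        filter_upwards [ae_haarPos_pos] with t ht
        have e : poissonDeriv m f t = poissonOp m t f := by
          funext x
          exact poissonDeriv_eq m ht hf x
        rw [e, mul_left_comm]
        exact mul_le_mul' le_rfl (hΦle t ht)
    _ = _ := by ring

end Besov

end GaussianBesov

end

open GaussianBesov in
/-- The first two parts say that the integral formula defining `J_β` converges and gives the
continuous extension to `L^{p(·)}(γ_d)` of the operator `h_ν ↦ (1 + √|ν|)^{-β} h_ν`; the third part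
is the boundedness of `J_β` from `B^α_{p(·),q(·)}(γ_d)` into `B^{α+β}_{p(·),q(·)}(γ_d)`. -/
theorem mainTheorem2 (d : ℕ) (hd : 1 ≤ d) (α β : ℝ) (hα : 0 ≤ α) (hβ : 0 < β)
    (p : EuclideanSpace ℝ (Fin d) → ℝ) (hp : IsPGammaInfty p) (hpLH : IsLH0 p)
    (hp_inf : 1 < expInf p (gammaD d)) (hp_sup : expSup p (gammaD d) < ⊤)
    (q : ℝ → ℝ) (hq : IsPZeroInfty q) :
    (∀ (ν : Fin d → ℕ) (x : EuclideanSpace ℝ (Fin d)),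
      MeasureTheory.IntegrableOn (besselIntegrand β (hermiteFn ν) x) (Set.Ioi 0) ∧
      besselPotential β (hermiteFn ν) x
        = 1 / (1 + Real.sqrt ((∑ i, ν i : ℕ) : ℝ)) ^ β * hermiteFn ν x) ∧
    (∃ C : NNReal, ∀ f : EuclideanSpace ℝ (Fin d) → ℝ, MemVarLp p (gammaD d) f →
      (∀ᵐ x ∂(gammaD d), MeasureTheory.IntegrableOn (besselIntegrand β f x) (Set.Ioi 0)) ∧
      MemVarLp p (gammaD d) (besselPotential β f) ∧
      varNorm p (gammaD d) (besselPotential β f) ≤ C * varNorm p (gammaD d) f) ∧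
    (∃ C : NNReal, ∀ f : EuclideanSpace ℝ (Fin d) → ℝ, MemBesov α p q f →
      MemBesov (α + β) p q (besselPotential β f) ∧
      besovNorm (α + β) p q (besselPotential β f) ≤ C * besovNorm α p q f) := by
  obtain ⟨hp1, hpm, K, hK0, hKt, hT⟩ := isPGammaInfty_ouLintegral_bounded hd hp hpLH hp_inf
  have hp1' : ∀ᵐ x ∂(gammaD d), 1 ≤ p x := Filter.Eventually.of_forall hp1
  obtain ⟨C₁, hC₁⟩ := exists_varNorm_besselPotential_le hβ hp1 hpm hK0 hKt hT
  obtain ⟨C₂, hC₂⟩ := exists_besovSeminorm_besselPotential_le (α := α) hβ hq hp1 hpm hK0 hKt hT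
  have hmem : ∀ f, MemVarLp p (gammaD d) f → MemVarLp p (gammaD d) (besselPotential β f) := by
    intro f hf
    have hi := integrable_of_memVarLp hp1 hf
    exact (memVarLp_iff hp1').2 ⟨(integrable_besselPotential hβ hi).1,
      (hC₁ f hi).trans_lt (ENNReal.mul_lt_top (by simp) ((memVarLp_iff hp1').1 hf).2)⟩
  refine ⟨fun ν x => ⟨integrableOn_besselIntegrand_hermiteFn hβ ν x,
    besselPotential_hermiteFn hβ ν x⟩, ⟨C₁, fun f hf => ?_⟩, ⟨max C₁ C₂, fun f hf => ?_⟩⟩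
  · have hi := integrable_of_memVarLp hp1 hf
    exact ⟨ae_integrableOn_besselIntegrand hβ hi, hmem f hf, hC₁ f hi⟩
  · have hi := integrable_of_memVarLp hp1 hf.1
    refine ⟨⟨hmem f hf.1, (hC₂ f hi).trans_lt (ENNReal.mul_lt_top (by simp) hf.2)⟩, ?_⟩
    unfold besovNorm
    rw [mul_add]
    refine add_le_add ((hC₁ f hi).trans ?_) ((hC₂ f hi).trans ?_)
    · gcongr
      exact le_max_left _ _
    · gcongr
      exact le_max_right _ _
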